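/- **Setting.** Fix $C^2$ functions $k,\gamma:(0,\infty)\to(0,\infty)$ and exponents $\alpha\in(0,1)$, $\beta\in(1,2)$, $\tilde\beta<\beta$, $\bar\alpha,\bar\beta>1$ and constants $k_0,k_1,k_2,\gamma_0,\gamma_1,\gamma_2>0$ such that $k(\xi)\sim\xi^{\alpha+1}$ and $\gamma(\xi)=\xi^\beta+O(\xi^{\tilde\beta})$ as $\xi\to\infty$; $k(\xi)=k_0+O(\xi^{\bar\alpha})$ and $\gamma(\xi)=\gamma_0+O(\xi^{\bar\beta})$ as $\xi\to0^+$; $|k'(\xi)|\le k_1\xi^{\alpha}$, $|k''(\xi)|\le k_2\xi^{\alpha-1}$, $|\gamma'(\xi)|\le\gamma_1\xi^{\beta-1}$, $|\gamma''(\xi)|\le\gamma_2\xi^{\beta-2}$ for $\xi\ge1$; $|k'(\xi)|\le k_1\xi^{\bar\alpha-1}$, $|k''(\xi)|\le k_2\xi^{\bar\alpha-2}$, $|\gamma'(\xi)|\le\gamma_1\xi^{\bar\beta-1}$, $|\gamma''(\xi)|\le\gamma_2\xi^{\bar\beta-2}$ for $0<\xi\le1$. Fix also $\bar\theta_1\in(\beta-1,1)$.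 All constants below may depend on these data. For $\theta\in\mathbb R$ and $y=\{y_n\}_{n\in\mathbb Z}$ let $\|y\|_\theta=\sup_{n\le0}2^n|y_n|+\sup_{n>0}2^{\theta n}|y_n|$, $\mathcal Y_\theta=\{y:\|y\|_\theta<\infty\}$ and $D^+_n(y)=y_{n+1}-y_n$. For a bounded sequence $p=\{p_n\}_{n\in\mathbb Z}$ and $A>0$ let $$\zeta_n(p)=\frac{\ln2}{2^{n+p_n}}\frac{k(2^{n+p_n})}{\gamma(2^{n+1+p_{n+1}})},\quad \theta_n(p)=\frac{2\zeta_{n+1}(p)}{\zeta_n(p)},\quad \bar\mu_n(A,p)=e^{-A2^n}\exp\Bigl(-2^n\sum_{j=n+1}^\infty2^{-j}\ln\theta_{j-1}(p)\Bigr).$$ Given $M>0$, $A_M>0$ denotes the value of $A$ for which the positive bounded solution $\{a_n\}_{n\in\mathbb Z}$ of $a_{n+1}=\zeta_n(0)a_n^2$ with $a_n=\frac{2\gamma_0}{k_0\ln2}(2^n+A_02^{2n})+o(2^{2n})$ as $n\to-\infty$ (for some $A_0\in\mathbb R$) and $a_n\sim(\ln2)^{-1}2^\beta2^{\beta-\alpha}2^{(\beta-\alpha)n}e^{-A2^n}$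 as $n\to\infty$ satisfies $\sum_{n\in\mathbb Z}2^na_n=M$. For $\eta_0\in(0,1)$ and $\nu>0$, a family $p(t)=\{p_n(t)\}_{n\in\mathbb Z}$, differentiable in $t>0$ for each $n$, is called *admissible* if for all $t>0$ $$|p_n(t)|\le\eta_0\ (n\in\mathbb Z),\quad \|D^+(p(t))\|_{\bar\theta_1}\le\eta_0t^{-\bar\theta_1/\beta}e^{-\frac\nu2t},\quad \Bigl\|\frac{dp}{dt}(t)\Bigr\|_{\bar\theta_1-\beta}\le\eta_0\bigl(1+t^{-\bar\theta_1/\beta}\bigr)e^{-\frac\nu2t}.$$ For $N\in\mathbb N$ and an admissible $p^N$ let $\sigma^N_n(t)=8\bar\mu_n(A_M,p^N(t))\frac{\gamma(2^{n+1+p^N_{n+1}(t)})}{\gamma(2^{n+p^N_n(t)})}$ for $n<N$, $\sigma^N_N(t)=0$, and $$\mathscr L^N_n(y;t)=\frac{\gamma(2^{n+p^N_n(t)})}{4}\Bigl(y_{n-1}-y_n-\sigma^N_n(t)(y_n-y_{n+1})\Bigr),\qquad n\le N.$$ **Theorem.** For every $M>0$ there exist $\eta_0\in(0,1)$ and $\nu>0$,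 depending only on $M$, with the following property. Let $\theta\in(-1,\beta)$ and $\tilde\theta\in[\theta,\beta]$ with $\tilde\theta-\theta<\beta$. Let $N\in\mathbb N$, let $p^N$ be admissible for $(\eta_0,\nu)$, and let $y^0\in\mathcal Y_\theta$ with $y^0_n=0$ for $n>N$. Then for every $t_0\ge0$ there is a unique solution $t\mapsto y(t)=T^N(t;t_0)(y^0)\in\mathcal Y_\theta$, $t\ge t_0$, of $$\frac{dy_n}{dt}=\mathscr L^N_n(y(t);t)\quad(n\le N,\ t>t_0),\qquad y_n(t)=0\quad(n>N),\qquad y(t_0)=y^0,$$ each $y_n$ being continuous on $[t_0,\infty)$. Furthermore there exist constants $C_1,C_2$ depending only on $M,\theta,\tilde\theta$ (in particular independent of $N$, $p^N$, $y^0$, $t_0$) such that for all $t>t_0$ $$\bigl\|\{D^+_n(y(t))\}_{n<N}\bigr\|_{\tilde\theta}\le C_1\|y^0\|_\theta(t-t_0)^{-\frac{\tilde\theta-\theta}{\beta}}e^{-\nu(t-t_0)},$$ and, if $\tilde\theta>0$, $$\bigl\|\{y_n(t)-y_N(t)\}_{n\le N}\bigr\|_{\tilde\theta}\le C_2\|y^0\|_\theta(t-t_0)^{-\frac{\tilde\theta-\theta}{\beta}}e^{-\nu(t-t_0)},$$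 $$\bigl|\mathscr L^N_N(y(t);t)\bigr|\le C_2\,2^{(\beta-\tilde\theta)N}\|y^0\|_\theta(t-t_0)^{-\frac{\tilde\theta-\theta}{\beta}}e^{-\nu(t-t_0)}.$$ In particular, for $\tilde\theta=\beta$ the last bound reads $|\mathscr L^N_N(y(t);t)|\le C_2\|y^0\|_\theta(t-t_0)^{-\frac{\beta-\theta}{\beta}}e^{-\nu(t-t_0)}$. Here a sequence given only for $n<N$ or $n\le N$ is extended by $0$ to all of $\mathbb Z$ when its norm is taken. -/

import Mathlib

open Filter Asymptotics Topology Set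
open scoped ENNReal

noncomputable section

namespace CoagFrag

/-- The one-variable profiles `k` (coagulation) and `γ` (fragmentation) of the kernels, with the
regularity and growth assumptions imposed on them. -/
structure Kernels where
  /-- coagulation profile -/
  k : ℝ → ℝ
  /-- fragmentation profile -/
  γ : ℝ → ℝ
  /-- growth exponent of `k` at infinity is `α + 1` -/
  α : ℝ
  /-- growth exponent of `γ` at infinity -/
  β : ℝ
  /-- order of the error of `γ` at infinity -/
  βtilde : ℝ
  /-- order of the error of `k` at zero -/
  αbar : ℝ
  /-- order of the error of `γ` at zero -/
  βbar : ℝ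
  k₀ : ℝ
  k₁ : ℝ
  k₂ : ℝ
  γ₀ : ℝ
  γ₁ : ℝ
  γ₂ : ℝ
  hα : α ∈ Ioo (0 : ℝ) 1
  hβ : β ∈ Ioo (1 : ℝ) 2
  hβtilde : βtilde < β
  hαbar : 1 < αbar
  hβbar : 1 < βbar
  hk₀ : 0 < k₀
  hk₁ : 0 < k₁
  hk₂ : 0 < k₂
  hγ₀ : 0 < γ₀
  hγ₁ : 0 < γ₁
  hγ₂ : 0 < γ₂
  k_contDiff : ContDiffOn ℝ 2 k (Ioi 0)
  k_pos : ∀ ξ, 0 < ξ → 0 < k ξ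
  k_atTop : k ~[atTop] fun ξ => ξ ^ (α + 1)
  k_zero : (fun ξ => k ξ - k₀) =O[𝓝[>] 0] fun ξ => ξ ^ αbar
  k_deriv_ge : ∀ ξ, 1 ≤ ξ → |deriv k ξ| ≤ k₁ * ξ ^ α
  k_deriv_le : ∀ ξ, 0 < ξ → ξ ≤ 1 → |deriv k ξ| ≤ k₁ * ξ ^ (αbar - 1)
  k_deriv2_ge : ∀ ξ, 1 ≤ ξ → |deriv (deriv k) ξ| ≤ k₂ * ξ ^ (α - 1)
  k_deriv2_le : ∀ ξ, 0 < ξ → ξ ≤ 1 → |deriv (deriv k) ξ| ≤ k₂ * ξ ^ (αbar - 2)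
  γ_contDiff : ContDiffOn ℝ 2 γ (Ioi 0)
  γ_pos : ∀ ξ, 0 < ξ → 0 < γ ξ
  γ_atTop : (fun ξ => γ ξ - ξ ^ β) =O[atTop] fun ξ => ξ ^ βtilde
  γ_zero : (fun ξ => γ ξ - γ₀) =O[𝓝[>] 0] fun ξ => ξ ^ βbar
  γ_deriv_ge : ∀ ξ, 1 ≤ ξ → |deriv γ ξ| ≤ γ₁ * ξ ^ (β - 1)
  γ_deriv_le : ∀ ξ, 0 < ξ → ξ ≤ 1 → |deriv γ ξ| ≤ γ₁ * ξ ^ (βbar - 1)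
  γ_deriv2_ge : ∀ ξ, 1 ≤ ξ → |deriv (deriv γ) ξ| ≤ γ₂ * ξ ^ (β - 2)
  γ_deriv2_le : ∀ ξ, 0 < ξ → ξ ≤ 1 → |deriv (deriv γ) ξ| ≤ γ₂ * ξ ^ (βbar - 2)

/-- `‖y‖_θ = sup_{n ≤ 0} 2^n |y_n| + sup_{n > 0} 2^{θ n} |y_n|`, with values in `[0, ∞]`. -/
def seqNorm (θ : ℝ) (y : ℤ → ℝ) : ℝ≥0∞ :=
  (⨆ (n : ℤ) (_ : n ≤ 0), ENNReal.ofReal ((2 : ℝ) ^ n * |y n|)) +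
    ⨆ (n : ℤ) (_ : 0 < n), ENNReal.ofReal ((2 : ℝ) ^ (θ * n) * |y n|)

/-- The space `𝒴_θ` of sequences of finite norm. -/
def seqSpace (θ : ℝ) : Set (ℤ → ℝ) := {y | seqNorm θ y < ∞}

/-- Forward difference `D⁺_n(y) = y_{n+1} - y_n`. -/
def dPlus (y : ℤ → ℝ) (n : ℤ) : ℝ := y (n + 1) - y n

/-- The sequence equal to `z_n` for `n ≤ N` and to `0` for `n > N`. -/
def cutoff (N : ℤ) (z : ℤ → ℝ) (n : ℤ) : ℝ := if n ≤ N then z n else 0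

/-- `ζ_n(p) = (ln 2 / 2^{n+p_n}) k(2^{n+p_n}) / γ(2^{n+1+p_{n+1}})`. -/
def zetaCoeff (K : Kernels) (p : ℤ → ℝ) (n : ℤ) : ℝ :=
  Real.log 2 / (2 : ℝ) ^ ((n : ℝ) + p n) *
    (K.k ((2 : ℝ) ^ ((n : ℝ) + p n)) / K.γ ((2 : ℝ) ^ ((n : ℝ) + 1 + p (n + 1))))

/-- `θ_n(p) = 2 ζ_{n+1}(p) / ζ_n(p)`. -/
def thetaCoeff (K : Kernels) (p : ℤ → ℝ) (n : ℤ) : ℝ :=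
  2 * zetaCoeff K p (n + 1) / zetaCoeff K p n

/-- `μ̄_n(A,p) = e^{-A 2^n} exp(-2^n ∑_{j ≥ n+1} 2^{-j} ln θ_{j-1}(p))`; the summation index is
`j = n + 1 + i`, `i = 0, 1, 2, …`. -/
def muBar (K : Kernels) (A : ℝ) (p : ℤ → ℝ) (n : ℤ) : ℝ :=
  Real.exp (-A * (2 : ℝ) ^ n) *
    Real.exp (-(2 : ℝ) ^ n *
      ∑' i : ℕ, (2 : ℝ) ^ (-(n + 1 + (i : ℤ))) * Real.log (thetaCoeff K p (n + (i : ℤ))))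

/-- `a` is the family of coefficients `a_n(A,0)` of the stationary solution
`∑_n a_n δ(x - n)` with decay parameter `A`: positive, bounded, solving
`a_{n+1} = ζ_{n,0} a_n²`, with the prescribed behaviour as `n → ±∞`. -/
structure IsStationaryPeaks (K : Kernels) (A : ℝ) (a : ℤ → ℝ) : Prop where
  pos : ∀ n, 0 < a n
  bounded : ∃ B : ℝ, ∀ n, a n ≤ B
  recurrence : ∀ n, a (n + 1) = zetaCoeff K (fun _ => 0) n * a n ^ 2
  atBot : ∃ A₀ : ℝ,
    (fun n : ℤ => a n -
      K.γ₀ * 2 / (K.k₀ * Real.log 2) * ((2 : ℝ) ^ n + A₀ * (2 : ℝ) ^ (2 * n)))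
      =o[atBot] fun n : ℤ => (2 : ℝ) ^ (2 * n)
  atTop : a ~[atTop] fun n : ℤ =>
    (Real.log 2)⁻¹ * (2 : ℝ) ^ K.β * (2 : ℝ) ^ (K.β - K.α) *
      ((2 : ℝ) ^ ((K.β - K.α) * n) * Real.exp (-A * (2 : ℝ) ^ n))

/-- `A` is the value `A_M`: the stationary solution with peaks at the integers and decay
parameter `A > 0` has total mass `∑_n 2^n a_n = M`. -/
def IsMassParameter (K : Kernels) (M A : ℝ) : Prop :=
  0 < A ∧ ∃ a : ℤ → ℝ, IsStationaryPeaks K A a ∧ HasSum (fun n : ℤ => (2 : ℝ) ^ n * a n) M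

/-- The standing decay assumptions on the time-dependent shifts `p(t)`, `t > 0`. -/
structure IsAdmissibleShift (K : Kernels) (θ₁ η₀ ν : ℝ) (p : ℝ → ℤ → ℝ) : Prop where
  abs_le : ∀ t, 0 < t → ∀ n, |p t n| ≤ η₀
  dPlus_le : ∀ t, 0 < t → seqNorm θ₁ (dPlus (p t)) ≤
    ENNReal.ofReal (η₀ * t ^ (-(θ₁ / K.β)) * Real.exp (-(ν / 2) * t))
  differentiable : ∀ t, 0 < t → ∀ n, DifferentiableAt ℝ (fun s => p s n) t
  deriv_le : ∀ t, 0 < t → seqNorm (θ₁ - K.β) (fun n => deriv (fun s => p s n) t) ≤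
    ENNReal.ofReal (η₀ * (1 + t ^ (-(θ₁ / K.β))) * Real.exp (-(ν / 2) * t))

/-- The truncated coefficients `σ^N_n`, for the shifts `q = p^N(t)` at a given time. -/
def sigmaTrunc (K : Kernels) (A : ℝ) (N : ℤ) (q : ℤ → ℝ) (n : ℤ) : ℝ :=
  if n < N then
    8 * muBar K A q n *
      (K.γ ((2 : ℝ) ^ ((n : ℝ) + 1 + q (n + 1))) / K.γ ((2 : ℝ) ^ ((n : ℝ) + q n)))
  else 0

/-- The truncated operator `ℒ^N_n(y;t)`, for the shifts `q = p^N(t)`. -/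
def opTrunc (K : Kernels) (A : ℝ) (N : ℤ) (q : ℤ → ℝ) (y : ℤ → ℝ) (n : ℤ) : ℝ :=
  K.γ ((2 : ℝ) ^ ((n : ℝ) + q n)) / 4 *
    (y (n - 1) - y n - sigmaTrunc K A N q n * (y n - y (n + 1)))

/-- `y` is a solution in `𝒴_θ`, on `[t₀, ∞)`, of the lattice equation truncated at `n = N`, with
initial datum `y⁰` at time `t₀`. The values of `y` at times before `t₀` are irrelevant. -/
structure IsTruncSolution (K : Kernels) (A : ℝ) (N : ℤ) (p : ℝ → ℤ → ℝ) (θ t₀ : ℝ)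
    (y₀ : ℤ → ℝ) (y : ℝ → ℤ → ℝ) : Prop where
  mem : ∀ t, t₀ ≤ t → y t ∈ seqSpace θ
  initial : y t₀ = y₀
  continuousOn : ∀ n, ContinuousOn (fun t => y t n) (Ici t₀)
  eq_zero : ∀ t, t₀ ≤ t → ∀ n, N < n → y t n = 0
  hasDerivAt : ∀ t, t₀ < t → ∀ n, n ≤ N →
    HasDerivAt (fun s => y s n) (opTrunc K A N (p t) (y t) n) t

end CoagFrag

end

namespace CoagFrag

/-! ### Growth and logarithmic regularity of the profiles -/

/-! With the downward rates `gam` and the upward rates `upRate`, the truncated operator is a quarter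
of a birth-death generator. Sequences constant on `n ≤ N` lie in its kernel, so only differences can
decay. The differences `w n = y (n+1) - y n`, `n < N`, solve the linear system `diffRhs`, whose
off-diagonal coefficients are nonnegative. It is closed because the upward rate vanishes at `N`, so
that `w N` never enters. All quantitative bounds therefore follow from a comparison principle
(`comparison`) and explicit positive barriers that do not depend on `N`.

The first barrier gives exponential decay (`exists_exponential_decay`). After division by the
downward rate, the supersolution inequality involves only the ratio `8 μ̄_n` (`jumpRatio`), which
tends to 8 as `n → -∞` and to 0 as `n → ∞`. Then `2^(-n)` works far to the left, `2^n` far to the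
right, and a recursion joins them. The inequality holds with a fixed relative margin, which produces
a decay rate and also absorbs small shifts, because the logarithms of the rates are Lipschitz in the
shifts. The resulting weight is that of index `β - 1`.

The second barrier gives smoothing on unit time intervals (`exists_smoothing`). For large `n` the
upward rate is bounded while the downward rate grows like `2^(βn)`, so the system is nearly a
transport equation whose constant-flux profile is `2^(-βn)`. A self-similar function of `2^(βn) τ`,
with `τ` the elapsed time, interpolates between the weight `θ` at `τ = 0` and the weight `β` for `τ
> 0`. An additional factor `exp(-B/(1+s^κ))` pays for the motion of the shifts, whose derivative is
singular at `t = 0`.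

For long times, smoothing, decay in the weight `β - 1` and smoothing again are composed
(`exists_diff_decay`). Telescoping from `N` and the formula for the boundary flux give the other two
estimates. Applying the decay to the difference of two solutions gives uniqueness. The comparison
principle needs some bound on compact time intervals, although lying in `𝒴_θ` at each time gives
only finiteness at each time; a Baire category argument bridges this gap. Existence is Picard
iteration, since all rates are bounded on `n ≤ N`. -/

theorem exists_two_sided_bound {f : ℝ → ℝ} {e f₀ : ℝ} (hf : ContinuousOn f (Ioi 0))
    (hpos : ∀ ξ, 0 < ξ → 0 < f ξ) (hf₀ : 0 < f₀) (he : 0 ≤ e)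
    (hzero : Tendsto f (𝓝[>] 0) (𝓝 f₀)) (htop : Tendsto (fun ξ => f ξ / ξ ^ e) atTop (𝓝 1)) :
    ∃ c C : ℝ, 0 < c ∧ 0 < C ∧
      ∀ ξ, 0 < ξ → c * max 1 (ξ ^ e) ≤ f ξ ∧ f ξ ≤ C * max 1 (ξ ^ e) := by
  have h1 : ∀ᶠ ξ in 𝓝[>] (0 : ℝ), f ξ ∈ Ioo (f₀ / 2) (2 * f₀) :=
    hzero (Ioo_mem_nhds (by linarith) (by linarith))
  obtain ⟨a, ha, ha'⟩ := mem_nhdsGT_iff_exists_Ioo_subset.1 h1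
  have h2 : ∀ᶠ ξ in atTop, f ξ / ξ ^ e ∈ Ioo (1 / 2 : ℝ) 2 :=
    htop (Ioo_mem_nhds (by norm_num) (by norm_num))
  obtain ⟨b, hb⟩ := eventually_atTop.1 h2
  rw [mem_Ioi] at ha
  -- Arranging `a₁ ≤ 1 ≤ b₁` resolves the maximum in each outer range: it is `1` below `a₁` and `ξ ^
  -- e` above `b₁`. Compactness handles the middle.
  set a₁ := min a 1 / 2 with ha₁
  set b₁ := max b 1 with hb₁
  have ha₁0 : 0 < a₁ := by positivity
  have ha₁1 : a₁ ≤ 1 := by have := min_le_right a 1; rw [ha₁]; linarith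
  have ha₁a : a₁ < a := by have := min_le_left a 1; rw [ha₁]; linarith
  have hb₁1 : 1 ≤ b₁ := le_max_right _ _
  have hsub : Icc a₁ b₁ ⊆ Ioi 0 := fun x hx => lt_of_lt_of_le ha₁0 hx.1
  have hne : (Icc a₁ b₁).Nonempty := nonempty_Icc.2 (ha₁1.trans hb₁1)
  obtain ⟨x, hx, hxmin⟩ := isCompact_Icc.exists_isMinOn hne (hf.mono hsub)
  obtain ⟨y, hy, hymax⟩ := isCompact_Icc.exists_isMaxOn hne (hf.mono hsub)
  have hfx := hpos x (hsub hx)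
  have hfy := hpos y (hsub hy)
  have hbe : 1 ≤ b₁ ^ e := Real.one_le_rpow hb₁1 he
  refine ⟨min (min (f₀ / 2) (1 / 2)) (f x / b₁ ^ e), max (max (2 * f₀) 2) (f y),
    by positivity, by positivity, fun ξ hξ => ?_⟩
  set c := min (min (f₀ / 2) (1 / 2)) (f x / b₁ ^ e)
  set C := max (max (2 * f₀) 2) (f y)
  have hc1 : c ≤ f₀ / 2 := (min_le_left _ _).trans (min_le_left _ _)
  have hc2 : c ≤ 1 / 2 := (min_le_left _ _).trans (min_le_right _ _)
  have hc3 : c ≤ f x / b₁ ^ e := min_le_right _ _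
  have hC1 : 2 * f₀ ≤ C := (le_max_left _ _).trans (le_max_left _ _)
  have hC2 : 2 ≤ C := (le_max_right _ _).trans (le_max_left _ _)
  have hC3 : f y ≤ C := le_max_right _ _
  have hc0 : 0 < c := by positivity
  rcases lt_or_ge ξ a₁ with h | h
  · have hm : max 1 (ξ ^ e) = 1 :=
      max_eq_left (Real.rpow_le_one hξ.le (h.le.trans ha₁1) he)
    have := ha' ⟨hξ, h.trans ha₁a⟩
    have h3 : f₀ / 2 < f ξ := this.1
    have h4 : f ξ < 2 * f₀ := this.2
    rw [hm]
    constructor <;> linarith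
  · rcases le_or_gt ξ b₁ with h' | h'
    · have h5 : f x ≤ f ξ := hxmin ⟨h, h'⟩
      have h6 : f ξ ≤ f y := hymax ⟨h, h'⟩
      have hm : max 1 (ξ ^ e) ≤ b₁ ^ e :=
        max_le hbe (Real.rpow_le_rpow hξ.le h' he)
      have hm1 : (1 : ℝ) ≤ max 1 (ξ ^ e) := le_max_left _ _
      constructor
      · calc c * max 1 (ξ ^ e) ≤ f x / b₁ ^ e * b₁ ^ e := by gcongr
          _ = f x := by field_simp
          _ ≤ f ξ := h5
      · nlinarith
    · have hξ1 : 1 ≤ ξ := hb₁1.trans h'.le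
      have hm : max 1 (ξ ^ e) = ξ ^ e := max_eq_right (Real.one_le_rpow hξ1 he)
      have h7 := hb ξ ((le_max_left b 1).trans h'.le)
      have hp : 0 < ξ ^ e := by positivity
      have h8 : 1 / 2 < f ξ / ξ ^ e := h7.1
      have h9 : f ξ / ξ ^ e < 2 := h7.2
      rw [lt_div_iff₀ hp] at h8
      rw [div_lt_iff₀ hp] at h9
      rw [hm]
      constructor <;> nlinarith

/-- The bounds on `f'` say that `ξ |f' ξ|` is at most a multiple of `max 1 (ξ^e)`, hence of `f ξ`.
In the variable `x = log₂ ξ` this makes `log f` Lipschitz, so a shift of size `η` changes a rate by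
a factor at most `exp (L η)`, uniformly in the site. -/
theorem exists_log_deriv_bound {f : ℝ → ℝ} {e e' c c₁ : ℝ} (hf : ContDiffOn ℝ 2 f (Ioi 0))
    (he' : 0 ≤ e') (hc : 0 < c) (hc₁ : 0 < c₁) (hlow : ∀ ξ, 0 < ξ → c * max 1 (ξ ^ e) ≤ f ξ)
    (hge : ∀ ξ, 1 ≤ ξ → |deriv f ξ| ≤ c₁ * ξ ^ (e - 1))
    (hle : ∀ ξ, 0 < ξ → ξ ≤ 1 → |deriv f ξ| ≤ c₁ * ξ ^ (e' - 1)) :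
    ∃ L : ℝ, 0 < L ∧ ∀ x : ℝ, ∃ d, HasDerivAt (fun x : ℝ => f ((2 : ℝ) ^ x)) d x ∧
      |d| ≤ L * f ((2 : ℝ) ^ x) := by
  have hlog : 0 < Real.log 2 := Real.log_pos (by norm_num)
  refine ⟨c₁ / c * Real.log 2, by positivity, fun x => ?_⟩
  have hξ : (0 : ℝ) < 2 ^ x := by positivity
  have hd : HasDerivAt f (deriv f ((2 : ℝ) ^ x)) ((2 : ℝ) ^ x) :=
    ((hf.differentiableOn (by norm_num)).differentiableAt (Ioi_mem_nhds hξ)).hasDerivAt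
  have hd2 : HasDerivAt (fun x : ℝ => (2 : ℝ) ^ x) ((2 : ℝ) ^ x * Real.log 2) x :=
    Real.hasStrictDerivAt_const_rpow (by norm_num) x |>.hasDerivAt
  refine ⟨_, hd.comp x hd2, ?_⟩
  generalize (2 : ℝ) ^ x = ξ at *
  have key : |deriv f ξ| * ξ ≤ c₁ * max 1 (ξ ^ e) := by
    rcases le_total ξ 1 with h | h
    · calc |deriv f ξ| * ξ ≤ c₁ * ξ ^ (e' - 1) * ξ := by gcongr; exact hle ξ hξ h
        _ = c₁ * ξ ^ e' := by
          rw [mul_assoc, ← Real.rpow_add_one hξ.ne']; norm_num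
        _ ≤ c₁ * max 1 (ξ ^ e) := by
          gcongr; exact (Real.rpow_le_one hξ.le h he').trans (le_max_left _ _)
    · calc |deriv f ξ| * ξ ≤ c₁ * ξ ^ (e - 1) * ξ := by gcongr; exact hge ξ h
        _ = c₁ * ξ ^ e := by
          rw [mul_assoc, ← Real.rpow_add_one hξ.ne']; norm_num
        _ ≤ c₁ * max 1 (ξ ^ e) := by gcongr; exact le_max_right _ _
  have hl := hlow ξ hξ
  rw [abs_mul, abs_of_pos (mul_pos hξ hlog)]
  calc |deriv f ξ| * (ξ * Real.log 2) = (|deriv f ξ| * ξ) * Real.log 2 := by ring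
    _ ≤ (c₁ * max 1 (ξ ^ e)) * Real.log 2 := by gcongr
    _ = c₁ / c * Real.log 2 * (c * max 1 (ξ ^ e)) := by field_simp
    _ ≤ _ := by gcongr

theorem abs_log_sub_log_le {g : ℝ → ℝ} {L : ℝ} (hpos : ∀ x, 0 < g x)
    (hd : ∀ x, ∃ d, HasDerivAt g d x ∧ |d| ≤ L * g x) (x y : ℝ) :
    |Real.log (g x) - Real.log (g y)| ≤ L * |x - y| := by
  choose d hd hdL using hd
  have := Convex.norm_image_sub_le_of_norm_hasDerivWithin_le (s := univ) (C := L)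
    (f := fun x => Real.log (g x)) (f' := fun x => d x / g x)
    (fun x _ => ((hd x).log (hpos x).ne').hasDerivWithinAt)
    (fun x _ => by
      rw [Real.norm_eq_abs, abs_div, abs_of_pos (hpos x), div_le_iff₀ (hpos x)]; exact hdL x)
    convex_univ (mem_univ y) (mem_univ x)
  simpa [Real.norm_eq_abs] using this

theorem tendsto_of_sub_isBigO_rpow {f : ℝ → ℝ} {f₀ e : ℝ} (he : 0 < e)
    (h : (fun ξ => f ξ - f₀) =O[𝓝[>] 0] fun ξ => ξ ^ e) : Tendsto f (𝓝[>] 0) (𝓝 f₀) := by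
  have h1 : Tendsto (fun ξ : ℝ => ξ ^ e) (𝓝[>] 0) (𝓝 0) := by
    have := (Real.continuousAt_rpow_const 0 e (Or.inr he.le)).tendsto
    rw [Real.zero_rpow he.ne'] at this
    exact this.mono_left nhdsWithin_le_nhds
  have := (h.trans_tendsto h1).add_const f₀
  simpa using this

theorem Kernels.tendsto_k_zero (K : Kernels) : Tendsto K.k (𝓝[>] 0) (𝓝 K.k₀) :=
  tendsto_of_sub_isBigO_rpow (by linarith [K.hαbar]) K.k_zero

theorem Kernels.tendsto_γ_zero (K : Kernels) : Tendsto K.γ (𝓝[>] 0) (𝓝 K.γ₀) :=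
  tendsto_of_sub_isBigO_rpow (by linarith [K.hβbar]) K.γ_zero

theorem Kernels.exists_k_bound (K : Kernels) : ∃ L : ℝ, 0 < L ∧
    ∀ x : ℝ, ∃ d, HasDerivAt (fun x : ℝ => K.k ((2 : ℝ) ^ x)) d x ∧
      |d| ≤ L * K.k ((2 : ℝ) ^ x) := by
  have hα := K.hα.1
  have hne : ∀ᶠ ξ : ℝ in atTop, ξ ^ (K.α + 1) ≠ 0 := by
    filter_upwards [eventually_gt_atTop 0] with ξ hξ
    positivity
  obtain ⟨c, C, hc, -, hb⟩ := exists_two_sided_bound K.k_contDiff.continuousOn K.k_pos K.hk₀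
    (by linarith) K.tendsto_k_zero ((isEquivalent_iff_tendsto_one hne).1 K.k_atTop)
  exact exists_log_deriv_bound (e := K.α + 1) (e' := K.αbar) K.k_contDiff
    (by linarith [K.hαbar]) hc K.hk₁ (fun ξ hξ => (hb ξ hξ).1)
    (by simpa using K.k_deriv_ge) K.k_deriv_le

theorem Kernels.exists_γ_bound (K : Kernels) : ∃ L c C : ℝ, 0 < L ∧ 0 < c ∧ 0 < C ∧
    (∀ x : ℝ, ∃ d, HasDerivAt (fun x : ℝ => K.γ ((2 : ℝ) ^ x)) d x ∧
      |d| ≤ L * K.γ ((2 : ℝ) ^ x)) ∧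
    ∀ x : ℝ, c * max 1 ((2 : ℝ) ^ (K.β * x)) ≤ K.γ ((2 : ℝ) ^ x) ∧
      K.γ ((2 : ℝ) ^ x) ≤ C * max 1 ((2 : ℝ) ^ (K.β * x)) := by
  have hβ := K.hβ.1
  have hlim : Tendsto (fun ξ => K.γ ξ / ξ ^ K.β) atTop (𝓝 1) := by
    have hlit : (fun ξ : ℝ => ξ ^ K.βtilde) =o[atTop] fun ξ => ξ ^ K.β := by
      refine isLittleO_of_tendsto' ?_ ?_
      · filter_upwards [eventually_gt_atTop 0] with ξ hξ h
        exact absurd h (Real.rpow_pos_of_pos hξ _).ne'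
      · refine (tendsto_rpow_neg_atTop (sub_pos.2 K.hβtilde)).congr' ?_
        filter_upwards [eventually_gt_atTop 0] with ξ hξ
        rw [← Real.rpow_sub hξ, neg_sub]
    have h2 : (fun ξ : ℝ => K.γ ξ - ξ ^ K.β) =o[atTop] fun ξ : ℝ => ξ ^ K.β :=
      K.γ_atTop.trans_isLittleO hlit
    have hne : ∀ᶠ ξ : ℝ in atTop, ξ ^ K.β ≠ 0 := by
      filter_upwards [eventually_gt_atTop 0] with ξ hξ
      positivity
    exact (isEquivalent_iff_tendsto_one hne).1 h2
  obtain ⟨c, C, hc, hC, hb⟩ := exists_two_sided_bound K.γ_contDiff.continuousOn K.γ_pos K.hγ₀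
    (by linarith) K.tendsto_γ_zero hlim
  obtain ⟨L, hL, hd⟩ := exists_log_deriv_bound (e := K.β) (e' := K.βbar) K.γ_contDiff
    (by linarith [K.hβbar]) hc K.hγ₁ (fun ξ hξ => (hb ξ hξ).1) K.γ_deriv_ge K.γ_deriv_le
  refine ⟨L, c, C, hL, hc, hC, hd, fun x => ?_⟩
  have := hb ((2 : ℝ) ^ x) (by positivity)
  rwa [← Real.rpow_mul (by norm_num), mul_comm x] at this

/-! ### Comparison principles -/

/-- After the last time at which `v ≥ 0`, the function is nondecreasing and so cannot have become
negative. The initial condition is imposed only to the right of `t₀` because the barriers contain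
the shifts, which are controlled only for positive times. -/
theorem nonneg_of_deriv_nonneg_of_neg {v v' : ℝ → ℝ} {t₀ T : ℝ}
    (hv : ∀ t ∈ Ioc t₀ T, HasDerivAt v (v' t) t) (hneg : ∀ t ∈ Ioc t₀ T, v t < 0 → 0 ≤ v' t)
    (hinit : ∀ᶠ t in 𝓝[>] t₀, 0 ≤ v t) : ∀ t ∈ Ioc t₀ T, 0 ≤ v t := by
  intro t₁ ht₁
  by_contra! hlt
  obtain ⟨s₀, hs₀v, hs₀⟩ := (hinit.and (Ioo_mem_nhdsGT ht₁.1)).exists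
  have hcont : ContinuousOn v (Icc s₀ t₁) := fun x hx =>
    (hv x ⟨hs₀.1.trans_le hx.1, hx.2.trans ht₁.2⟩).continuousAt.continuousWithinAt
  set S := Icc s₀ t₁ ∩ v ⁻¹' Ici 0 with hS
  have hSc : IsClosed S := hcont.preimage_isClosed_of_isClosed isClosed_Icc isClosed_Ici
  have hSne : S.Nonempty := ⟨s₀, ⟨le_rfl, hs₀.2.le⟩, hs₀v⟩
  have hSb : BddAbove S := ⟨t₁, fun x hx => hx.1.2⟩
  have hs := hSc.csSup_mem hSne hSb
  set s := sSup S
  have hneg' : ∀ x ∈ Ioc s t₁, v x < 0 := by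
    intro x hx
    by_contra! h
    have : x ≤ s := le_csSup hSb ⟨⟨hs.1.1.trans hx.1.le, hx.2⟩, h⟩
    linarith [hx.1]
  have hmem : ∀ x ∈ Icc s t₁, x ∈ Ioc t₀ T := fun x hx =>
    ⟨hs₀.1.trans_le (hs.1.1.trans hx.1), hx.2.trans ht₁.2⟩
  have hmono : MonotoneOn v (Icc s t₁) := by
    refine monotoneOn_of_deriv_nonneg (convex_Icc _ _)
      (fun x hx => (hv x (hmem x hx)).continuousAt.continuousWithinAt)
      (fun x hx => ?_) (fun x hx => ?_)
    · rw [interior_Icc] at hx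
      exact (hv x (hmem x (Ioo_subset_Icc_self hx))).differentiableAt.differentiableWithinAt
    · rw [interior_Icc] at hx
      rw [(hv x (hmem x (Ioo_subset_Icc_self hx))).deriv]
      exact hneg x (hmem x (Ioo_subset_Icc_self hx)) (hneg' x ⟨hx.1, hx.2.le⟩)
  have h1 : v s ≤ v t₁ := hmono ⟨le_rfl, hs.1.2⟩ ⟨hs.1.2, le_rfl⟩ hs.1.2
  have h2 : 0 ≤ v s := hs.2
  linarith

/-- The right-hand side, at site `n`, of the system satisfied by the differences of a solution of
a birth-death equation with rates `a`, `b`. -/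
noncomputable def diffRhs (a b w : ℤ → ℝ) (n : ℤ) : ℝ :=
  (a n * w (n - 1) - (a (n + 1) + b n) * w n + b (n + 1) * w (n + 1)) / 4

/-- The part of `diffRhs` coming from the neighbours of `n`. -/
noncomputable def neighbourPart (a b w : ℤ → ℝ) (n : ℤ) : ℝ :=
  (a n * w (n - 1) + b (n + 1) * w (n + 1)) / 4

/-- On an infinite lattice a first touching point need not exist, so each site is treated separately
and its neighbours are estimated by the crude bound `B`. If `F` is the neighbour part of the barrier
and `D` the right side of `hsup`, then `F ≤ C Φ` and `F + δ Φ ≤ D` give `F ≤ C/(C+δ) D`. The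
strictness `δ` thus shrinks the crude constant by a fixed factor. -/
theorem comparison_step {N : ℤ} {t₀ T C δ K B : ℝ} {a b w Φ Φ' : ℝ → ℤ → ℝ} (hC : 0 < C)
    (hδ : 0 < δ) (hB0 : 0 ≤ B)
    (ha : ∀ t ∈ Ioc t₀ T, ∀ n, 0 ≤ a t n) (hb : ∀ t ∈ Ioc t₀ T, ∀ n, 0 ≤ b t n)
    (hbN : ∀ t ∈ Ioc t₀ T, b t N = 0)
    (hw : ∀ t ∈ Ioc t₀ T, ∀ n < N, HasDerivAt (fun s => w s n) (diffRhs (a t) (b t) (w t) n) t)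
    (hΦ : ∀ t ∈ Ioc t₀ T, ∀ n < N, HasDerivAt (fun s => Φ s n) (Φ' t n) t)
    (hpos : ∀ t ∈ Ioc t₀ T, ∀ n, 0 < Φ t n)
    (hsup : ∀ t ∈ Ioc t₀ T, ∀ n < N, neighbourPart (a t) (b t) (Φ t) n + δ * Φ t n ≤
      Φ' t n + (a t (n + 1) + b t n) / 4 * Φ t n)
    (hnb : ∀ t ∈ Ioc t₀ T, ∀ n < N, neighbourPart (a t) (b t) (Φ t) n ≤ C * Φ t n)
    (hB : ∀ t ∈ Ioc t₀ T, ∀ n < N, |w t n| ≤ B * Φ t n)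
    (hinit : ∀ n < N, ∀ᶠ t in 𝓝[>] t₀, |w t n| ≤ K * Φ t n) :
    ∀ t ∈ Ioc t₀ T, ∀ n < N, w t n ≤ max K (C / (C + δ) * B) * Φ t n := by
  intro t ht n hn
  set M := max K (C / (C + δ) * B) with hM
  rcases le_or_gt t t₀ with h | h
  · exact absurd ht.1 (not_lt.2 h)
  have hM0 : 0 ≤ M := le_trans (by positivity) (le_max_right _ _)
  have key := nonneg_of_deriv_nonneg_of_neg (v := fun s => M * Φ s n - w s n)
    (v' := fun s => M * Φ' s n - diffRhs (a s) (b s) (w s) n) (t₀ := t₀) (T := T)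
    (fun s hs => ((hΦ s hs n hn).const_mul M).sub (hw s hs n hn)) ?_ ?_ t ht
  · exact sub_nonneg.1 key
  · intro s hs hneg
    have h1 : a s n * w s (n - 1) ≤ B * (a s n * Φ s (n - 1)) := by
      have := (abs_le.1 (hB s hs (n - 1) (by linarith))).2
      nlinarith [ha s hs n]
    have h2 : b s (n + 1) * w s (n + 1) ≤ B * (b s (n + 1) * Φ s (n + 1)) := by
      rcases lt_or_eq_of_le (Int.add_one_le_iff.2 hn) with h3 | h3
      · have := (abs_le.1 (hB s hs (n + 1) h3)).2
        nlinarith [hb s hs (n + 1)]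
      -- Here `n + 1 = N`: nothing is known about `w N`, but its coefficient vanishes.
      · rw [h3, hbN s hs]; simp
    set F := neighbourPart (a s) (b s) (Φ s) n with hF
    set D := Φ' s n + (a s (n + 1) + b s n) / 4 * Φ s n with hD
    have h3 := hsup s hs n hn
    have h4 := hnb s hs n hn
    have h5 : B * F ≤ M * D := by
      have hF0 : 0 ≤ F := by
        have := mul_nonneg (ha s hs n) (hpos s hs (n - 1)).le
        have := mul_nonneg (hb s hs (n + 1)) (hpos s hs (n + 1)).le
        simp only [hF, neighbourPart]; linarith
      have h6 : F * (C + δ) ≤ C * D := by nlinarith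
      have h7 : C / (C + δ) * B ≤ M := le_max_right _ _
      have hD0 : 0 ≤ D := by nlinarith [hpos s hs n]
      calc B * F ≤ B * (C * D / (C + δ)) := by
            gcongr; rw [le_div_iff₀ (by positivity)]; exact h6
        _ = C / (C + δ) * B * D := by ring
        _ ≤ M * D := by gcongr
    have h6 : diffRhs (a s) (b s) (w s) n ≤
        B * F - (a s (n + 1) + b s n) / 4 * w s n := by
      simp only [hF, diffRhs, neighbourPart]; linarith
    have h7 : 0 ≤ (a s (n + 1) + b s n) / 4 * (w s n - M * Φ s n) :=
      mul_nonneg (by linarith [ha s hs (n + 1), hb s hs n]) (by linarith)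
    have h8 : M * D = M * Φ' s n + (a s (n + 1) + b s n) / 4 * (M * Φ s n) := by
      rw [hD]; ring
    linarith
  · filter_upwards [hinit n hn, Ioc_mem_nhdsGT (ht.1.trans_le ht.2)] with s hs hsT
    have := (abs_le.1 hs).2
    have h9 : K * Φ s n ≤ M * Φ s n :=
      mul_le_mul_of_nonneg_right (le_max_left _ _) (hpos s hsT n).le
    linarith

theorem diffRhs_neg (a b w : ℤ → ℝ) (n : ℤ) :
    diffRhs a b (fun m => -w m) n = -diffRhs a b w n := by
  simp only [diffRhs]; ring

/-- Iterating the previous step for `w` and `-w` replaces `B` by `max K (q^k |B|)` with `q < 1`. In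
the limit both `B` and `C` disappear from the conclusion, so they may depend on `N` and on the
solution. -/
theorem comparison {N : ℤ} {t₀ T C δ K B : ℝ} {a b w Φ Φ' : ℝ → ℤ → ℝ} (hC : 0 < C)
    (hδ : 0 < δ) (hK : 0 ≤ K)
    (ha : ∀ t ∈ Ioc t₀ T, ∀ n, 0 ≤ a t n) (hb : ∀ t ∈ Ioc t₀ T, ∀ n, 0 ≤ b t n)
    (hbN : ∀ t ∈ Ioc t₀ T, b t N = 0)
    (hw : ∀ t ∈ Ioc t₀ T, ∀ n < N, HasDerivAt (fun s => w s n) (diffRhs (a t) (b t) (w t) n) t)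
    (hΦ : ∀ t ∈ Ioc t₀ T, ∀ n < N, HasDerivAt (fun s => Φ s n) (Φ' t n) t)
    (hpos : ∀ t ∈ Ioc t₀ T, ∀ n, 0 < Φ t n)
    (hsup : ∀ t ∈ Ioc t₀ T, ∀ n < N, neighbourPart (a t) (b t) (Φ t) n + δ * Φ t n ≤
      Φ' t n + (a t (n + 1) + b t n) / 4 * Φ t n)
    (hnb : ∀ t ∈ Ioc t₀ T, ∀ n < N, neighbourPart (a t) (b t) (Φ t) n ≤ C * Φ t n)
    (hB : ∀ t ∈ Ioc t₀ T, ∀ n < N, |w t n| ≤ B * Φ t n)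
    (hinit : ∀ n < N, ∀ᶠ t in 𝓝[>] t₀, |w t n| ≤ K * Φ t n) :
    ∀ t ∈ Ioc t₀ T, ∀ n < N, |w t n| ≤ K * Φ t n := by
  set q := C / (C + δ) with hq
  have hq0 : 0 ≤ q := by positivity
  have hq1 : q < 1 := by rw [hq, div_lt_one (by positivity)]; linarith
  have iter : ∀ k : ℕ, ∀ t ∈ Ioc t₀ T, ∀ n < N, |w t n| ≤ max K (q ^ k * |B|) * Φ t n := by
    intro k
    induction k with
    | zero =>
      intro t ht n hn
      refine (hB t ht n hn).trans (mul_le_mul_of_nonneg_right ?_ (hpos t ht n).le)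
      simpa using Or.inr (le_abs_self B)
    | succ k ih =>
      intro t ht n hn
      have hB0 : 0 ≤ max K (q ^ k * |B|) := hK.trans (le_max_left _ _)
      have h1 := comparison_step hC hδ hB0 ha hb hbN hw hΦ hpos hsup hnb ih hinit t ht n hn
      have h2 := comparison_step (w := fun t n => -w t n) hC hδ hB0 ha hb hbN
        (fun s hs m hm => by rw [diffRhs_neg]; exact (hw s hs m hm).neg) hΦ hpos hsup hnb
        (by simpa using ih) (by simpa using hinit) t ht n hn
      have h3 : max K (C / (C + δ) * max K (q ^ k * |B|)) ≤ max K (q ^ (k + 1) * |B|) := by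
        rw [← hq]
        refine max_le (le_max_left _ _) ?_
        rw [mul_max_of_nonneg _ _ hq0]
        refine max_le ((mul_le_of_le_one_left hK hq1.le).trans (le_max_left _ _)) ?_
        exact le_of_eq_of_le (by ring) (le_max_right _ _)
      have h4 := mul_le_mul_of_nonneg_right h3 (hpos t ht n).le
      exact abs_le.2 ⟨by linarith, by linarith⟩
  intro t ht n hn
  have hlim : Tendsto (fun k : ℕ => max K (q ^ k * |B|) * Φ t n) atTop
      (𝓝 (max K (0 * |B|) * Φ t n)) :=
    ((tendsto_const_nhds.max
      ((tendsto_pow_atTop_nhds_zero_of_lt_one hq0 hq1).mul_const _)).mul_const _)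
  have := ge_of_tendsto' hlim (fun k => iter k t ht n hn)
  simpa [max_eq_left hK] using this

/-! ### Local boundedness of pointwise bounded solutions -/

section LocallyBounded

variable {ι : Type*} {u : ι → ℝ → ℝ} {t₀ Λ : ℝ}

/-- By the mean value theorem, on an interval of length at most `1/(2Λ)` a bound `B` improves to `b
+ B/2`. Iteration leads to the fixed point `2 b`, independent of the finite bound one started from.
-/
theorem bounded_on_short_interval
    (hcont : ∀ i, ContinuousOn (u i) (Ici t₀)) (hΛ : 0 < Λ)
    (hder : ∀ t, t₀ < t → ∀ i, ∃ d, HasDerivAt (u i) d t ∧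
      ∀ b, (∀ j, |u j t| ≤ b) → |d| ≤ Λ * b)
    {s t r b B : ℝ} (hs : t₀ ≤ s) (hst : t - s ≤ 1 / (2 * Λ)) (hr : r ∈ Icc s t)
    (hB : ∀ x ∈ Icc s t, ∀ i, |u i x| ≤ B) (hb : ∀ i, |u i r| ≤ b) :
    ∀ x ∈ Icc s t, ∀ i, |u i x| ≤ 2 * b := by
  have step : ∀ B, (∀ x ∈ Icc s t, ∀ i, |u i x| ≤ B) →
      ∀ x ∈ Icc s t, ∀ i, |u i x| ≤ b + B / 2 := by
    intro B hB x hx i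
    have hB0 : 0 ≤ B := (abs_nonneg _).trans (hB x hx i)
    have main : ∀ y z, y ∈ Icc s t → z ∈ Icc s t → y < z → |u i z - u i y| ≤ B / 2 := by
      intro y z hy hz hyz
      have hder' : ∀ x ∈ Ioo y z, HasDerivAt (u i) (deriv (u i) x) x := by
        intro x hx
        obtain ⟨d, hd, -⟩ := hder x (by linarith [hx.1, hy.1]) i
        rwa [hd.deriv]
      obtain ⟨c, hc, hceq⟩ := exists_hasDerivAt_eq_slope (u i) (deriv (u i)) hyz
        ((hcont i).mono fun x hx => by
          have := hx.1; have := hy.1; simp only [mem_Ici]; linarith) hder'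
      obtain ⟨d, hd, hdb⟩ := hder c (by linarith [hc.1, hy.1]) i
      have hbd := hdb B (hB c ⟨by linarith [hc.1, hy.1], by linarith [hc.2, hz.2]⟩)
      rw [← hd.deriv, hceq, abs_div, abs_of_pos (sub_pos.2 hyz),
        div_le_iff₀ (sub_pos.2 hyz)] at hbd
      have h1 : z - y ≤ 1 / (2 * Λ) := by linarith [hy.1, hz.2]
      calc |u i z - u i y| ≤ Λ * B * (z - y) := hbd
        _ ≤ Λ * B * (1 / (2 * Λ)) := by gcongr
        _ = B / 2 := by field_simp
    have h2 : |u i x - u i r| ≤ B / 2 := by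
      rcases lt_trichotomy x r with h | h | h
      · rw [abs_sub_comm]; exact main x r hx hr h
      · rw [h]; simp; positivity
      · exact main r x hr hx h
    have h3 := hb i
    have h4 := abs_sub_abs_le_abs_sub (u i x) (u i r)
    linarith
  have iter : ∀ k : ℕ, ∀ x ∈ Icc s t, ∀ i, |u i x| ≤ 2 * b + (1 / 2 : ℝ) ^ k * (|B| + 2 * |b|) := by
    intro k
    induction k with
    | zero =>
      intro x hx i
      have := hB x hx i
      have := le_abs_self B
      have := neg_abs_le b
      simp; linarith
    | succ k ih =>
      intro x hx i
      have := step _ ih x hx i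
      rw [pow_succ]; linarith
  intro x hx i
  have hlim : Tendsto (fun k : ℕ => 2 * b + (1 / 2 : ℝ) ^ k * (|B| + 2 * |b|)) atTop
      (𝓝 (2 * b + 0 * (|B| + 2 * |b|))) :=
    ((tendsto_pow_atTop_nhds_zero_of_lt_one (by norm_num) (by norm_num)).mul_const _).const_add _
  have := ge_of_tendsto' hlim (fun k => iter k x hx i)
  simpa using this

end LocallyBounded

/-- By the Baire category theorem, a solution whose values are bounded sequences is bounded on
compact time intervals, if the right-hand side is bounded on bounded sequences. -/
theorem exists_bound_of_pointwise_bounded {ι : Type*} {u : ι → ℝ → ℝ} {t₀ Λ : ℝ}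
    (hcont : ∀ i, ContinuousOn (u i) (Ici t₀)) (hΛ : 0 < Λ)
    (hder : ∀ t, t₀ < t → ∀ i, ∃ d, HasDerivAt (u i) d t ∧
      ∀ b, (∀ j, |u j t| ≤ b) → |d| ≤ Λ * b)
    (hpt : ∀ t, t₀ ≤ t → ∃ b, ∀ i, |u i t| ≤ b) (T : ℝ) :
    ∃ B, ∀ t ∈ Icc t₀ T, ∀ i, |u i t| ≤ B := by
  -- `G` consists of the times near which the solution is uniformly bounded. The closed set `E` of
  -- bad times is shown to be empty.
  set G : Set ℝ := {x | ∃ B, ∀ᶠ y in 𝓝 x, t₀ ≤ y → ∀ i, |u i y| ≤ B} with hG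
  have hGo : IsOpen G := by
    rw [isOpen_iff_mem_nhds]
    rintro x ⟨B, hB⟩
    filter_upwards [eventually_eventually_nhds.2 hB] with y hy
    exact ⟨B, hy⟩
  have hcompact : ∀ s t, t₀ ≤ s → Icc s t ⊆ G → ∃ B, ∀ x ∈ Icc s t, ∀ i, |u i x| ≤ B := by
    intro s t hs hst
    obtain ⟨B, hB⟩ := isCompact_Icc.induction_on (s := Icc s t)
      (p := fun S => ∃ B, ∀ x ∈ S, t₀ ≤ x → ∀ i, |u i x| ≤ B) ⟨0, by simp⟩
      (fun S S' h ⟨B, hB⟩ => ⟨B, fun x hx => hB x (h hx)⟩)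
      (fun S S' ⟨B, hB⟩ ⟨B', hB'⟩ => ⟨max B B', fun x hx hx0 i => hx.elim
        (fun h => (hB x h hx0 i).trans (le_max_left _ _))
        (fun h => (hB' x h hx0 i).trans (le_max_right _ _))⟩)
      (fun x hx => by
        obtain ⟨B, hB⟩ := hst hx
        exact ⟨_, mem_nhdsWithin_of_mem_nhds hB, B, fun y hy => hy⟩)
    exact ⟨B, fun x hx => hB x hx (hs.trans hx.1)⟩
  set E : Set ℝ := Ici t₀ ∩ Gᶜ with hE
  have hEc : IsClosed E := isClosed_Ici.inter hGo.isClosed_compl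
  have hEempty : E = ∅ := by
    by_contra hne
    have hne' : Nonempty E := nonempty_iff_ne_empty.2 hne |>.to_subtype
    have : CompleteSpace E := hEc.completeSpace_coe
    have hclosed : ∀ m : ℕ, IsClosed {x : E | ∀ i, |u i x| ≤ m} := by
      intro m
      simp only [ofPred_forall]
      refine isClosed_iInter fun i => ?_
      have : Continuous fun x : E => |u i x| :=
        ((hcont i).comp_continuous continuous_subtype_val (fun x => x.2.1)).abs
      exact isClosed_le this continuous_const
    -- Baire in the complete space `E`: on some relatively open piece of `E` a single bound `m`
    -- holds. It remains to extend it to the gaps of `E` nearby.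
    obtain ⟨m, x, hx⟩ := nonempty_interior_of_iUnion_of_closed hclosed (by
      refine eq_univ_of_forall fun x => ?_
      obtain ⟨b, hb⟩ := hpt x x.2.1
      obtain ⟨m, hm⟩ := exists_nat_ge b
      exact mem_iUnion.2 ⟨m, fun i => (hb i).trans hm⟩)
    rw [mem_interior_iff_mem_nhds, Metric.mem_nhds_iff] at hx
    obtain ⟨ε, hε, hball⟩ := hx
    have hEm : ∀ y ∈ E, |y - x| < ε → ∀ i, |u i y| ≤ m := fun y hy hyx =>
      hball (show (⟨y, hy⟩ : E) ∈ Metric.ball x ε by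
        rw [Metric.mem_ball, Subtype.dist_eq, Real.dist_eq]; exact hyx)
    set r := min (ε / 2) (1 / (2 * Λ)) with hr
    have hr0 : 0 < r := by positivity
    have hr1 : r < ε := (min_le_left _ _).trans_lt (by linarith)
    have hr2 : r ≤ 1 / (2 * Λ) := min_le_right _ _
    have main : ∀ t, t₀ ≤ t → |t - x| ≤ r → ∀ i, |u i t| ≤ 2 * m := by
      intro t ht htx
      have hm0 : (0 : ℝ) ≤ m := m.cast_nonneg
      rw [abs_le] at htx
      by_cases htE : t ∈ E
      · intro i
        have := hEm t htE (abs_lt.2 ⟨by linarith, by linarith⟩) i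
        linarith
      obtain ⟨b, hb⟩ := hpt t ht
      -- Let `a` be the point of `E` nearest to `t` between `x` and `t`. Between `a` and `t` the
      -- solution is locally bounded, and propagation from `t` gives the bound `2 b` up to, but
      -- excluding, `a`. This makes the whole closed interval bounded, so propagation from `a`
      -- applies and replaces `b` by the uniform `m`.
      rcases le_total (x : ℝ) t with hxt | hxt
      · have hsc : IsClosed (E ∩ Icc (x : ℝ) t) := hEc.inter isClosed_Icc
        have hsb : BddAbove (E ∩ Icc (x : ℝ) t) := ⟨t, fun y hy => hy.2.2⟩
        have ha := hsc.csSup_mem ⟨x, x.2, le_rfl, hxt⟩ hsb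
        set a := sSup (E ∩ Icc (x : ℝ) t)
        have hat : a ≤ t := ha.2.2
        have hnot : ∀ y, a < y → y ≤ t → y ∈ G := by
          intro y hy hyt
          by_contra h
          have := le_csSup hsb (a := y) ⟨⟨ha.1.1.trans hy.le, h⟩, ha.2.1.trans hy.le, hyt⟩
          linarith
        have hbound : ∀ s, a < s → s ≤ t → ∀ i, |u i s| ≤ 2 * b := by
          intro s has hst
          have hs0 : t₀ ≤ s := ha.1.1.trans has.le
          obtain ⟨B, hB⟩ := hcompact s t hs0 fun y hy => hnot y (has.trans_le hy.1) hy.2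
          exact bounded_on_short_interval hcont hΛ hder hs0 (by linarith [ha.2.1])
            ⟨hst, le_rfl⟩ hB hb s ⟨le_rfl, hst⟩
        have ham := hEm a ha.1 (abs_lt.2 ⟨by linarith [ha.2.1], by linarith⟩)
        refine bounded_on_short_interval (B := max m (2 * b)) hcont hΛ hder ha.1.1
          (by linarith [ha.2.1]) (r := a) ⟨le_rfl, hat⟩ (fun y hy i => ?_) ham t ⟨hat, le_rfl⟩
        rcases eq_or_lt_of_le hy.1 with h | h
        · rw [← h]; exact (ham i).trans (le_max_left _ _)
        · exact (hbound y h hy.2 i).trans (le_max_right _ _)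
      · have hsc : IsClosed (E ∩ Icc t (x : ℝ)) := hEc.inter isClosed_Icc
        have hsb : BddBelow (E ∩ Icc t (x : ℝ)) := ⟨t, fun y hy => hy.2.1⟩
        have ha := hsc.csInf_mem ⟨x, x.2, hxt, le_rfl⟩ hsb
        set a := sInf (E ∩ Icc t (x : ℝ))
        have hat : t ≤ a := ha.2.1
        have hnot : ∀ y, t ≤ y → y < a → y ∈ G := by
          intro y hty hya
          by_contra h
          have := csInf_le hsb (a := y) ⟨⟨ht.trans hty, h⟩, hty, hya.le.trans ha.2.2⟩
          linarith
        have hbound : ∀ s, t ≤ s → s < a → ∀ i, |u i s| ≤ 2 * b := by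
          intro s hts hsa
          obtain ⟨B, hB⟩ := hcompact t s ht fun y hy => hnot y hy.1 (hy.2.trans_lt hsa)
          exact bounded_on_short_interval hcont hΛ hder ht (by linarith [ha.2.2])
            ⟨le_rfl, hts⟩ hB hb s ⟨hts, le_rfl⟩
        have ham := hEm a ha.1 (abs_lt.2 ⟨by linarith, by linarith [ha.2.2]⟩)
        refine bounded_on_short_interval (B := max m (2 * b)) hcont hΛ hder ht
          (by linarith [ha.2.2]) (r := a) ⟨hat, le_rfl⟩ (fun y hy i => ?_) ham t ⟨le_rfl, hat⟩
        rcases eq_or_lt_of_le hy.2 with h | h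
        · rw [h]; exact (ham i).trans (le_max_left _ _)
        · exact (hbound y hy.1 h i).trans (le_max_right _ _)
    refine x.2.2 ⟨2 * m, ?_⟩
    filter_upwards [Metric.ball_mem_nhds (x : ℝ) hr0] with y hy hy0
    rw [Metric.mem_ball, Real.dist_eq] at hy
    exact main y hy0 hy.le
  refine hcompact t₀ T le_rfl fun x hx => ?_
  by_contra h
  have : x ∈ E := ⟨hx.1, h⟩
  rw [hEempty] at this
  exact this

/-! ### Existence for equations with bounded right-hand side -/

section Existence

open MeasureTheory BoundedContinuousFunction
open scoped NNReal

variable {F : ℤ → ℝ → (ℤ → ℝ) → ℝ} {Λ t₀ : ℝ}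

theorem abs_integral_le_exp {g : ℝ → ℝ} {c l : ℝ} (hc : 0 ≤ c) (hl : 0 < l)
    (hg : ∀ s, t₀ < s → |g s| ≤ c * Real.exp (l * (s - t₀))) (hg0 : ∀ s, s ≤ t₀ → g s = 0)
    (t : ℝ) : |∫ s in t₀..t, g s| ≤ c / l * Real.exp (l * |t - t₀|) := by
  rcases le_total t t₀ with h | h
  · have : ∫ s in t₀..t, g s = 0 := by
      rw [intervalIntegral.integral_congr (g := fun _ => (0 : ℝ)), intervalIntegral.integral_zero]
      intro s hs
      rw [uIcc_of_ge h] at hs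
      exact hg0 s hs.2
    rw [this, abs_zero]
    positivity
  · have h1 := intervalIntegral.norm_integral_le_of_norm_le (f := g) (μ := volume) h
      (Eventually.of_forall fun s hs => hg s hs.1) (by
        apply Continuous.intervalIntegrable; fun_prop)
    have h2 : ∫ s in t₀..t, c * Real.exp (l * (s - t₀)) =
        c / l * Real.exp (l * (t - t₀)) - c / l * Real.exp (l * (t₀ - t₀)) := by
      refine intervalIntegral.integral_eq_sub_of_hasDerivAt
        (f := fun s => c / l * Real.exp (l * (s - t₀))) (fun s _ => ?_) (by
          apply Continuous.intervalIntegrable; fun_prop)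
      have := ((((hasDerivAt_id s).sub_const t₀).const_mul l).exp).const_mul (c / l)
      refine this.congr_deriv ?_
      field_simp
      simp
    rw [h2, Real.norm_eq_abs] at h1
    rw [abs_of_nonneg (sub_nonneg.2 h)]
    have h3 : 0 ≤ c / l * Real.exp (l * (t₀ - t₀)) := by positivity
    linarith

theorem intervalIntegrable_of_exp_bound {g : ℝ → ℝ} {c l : ℝ} (hl : 0 < l)
    (hgc : ContinuousOn g (Ioi t₀)) (hc : 0 ≤ c)
    (hg : ∀ s, t₀ < s → |g s| ≤ c * Real.exp (l * (s - t₀))) (a b : ℝ) :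
    IntervalIntegrable ((Ioi t₀).indicator g) volume a b := by
  rw [intervalIntegrable_iff]
  refine Measure.integrableOn_of_bounded (M := c * Real.exp (l * |max a b - t₀|)) (by simp)
    ?_ ?_
  · exact ((aestronglyMeasurable_indicator_iff measurableSet_Ioi).2
      (hgc.aestronglyMeasurable measurableSet_Ioi))
  · rw [ae_restrict_iff' measurableSet_uIoc]
    refine Eventually.of_forall fun s hs => ?_
    rw [uIoc] at hs
    by_cases h : s ∈ Ioi t₀
    · rw [indicator_of_mem h, Real.norm_eq_abs]
      refine (hg s h).trans ?_
      gcongr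
      refine le_trans ?_ (le_abs_self _)
      linarith [hs.2]
    · rw [indicator_of_notMem h, norm_zero]; positivity

/-- Picard iteration for `x`, where `u = exp (l (t - t₀)) x` and `x` is bounded on all of `ℤ × ℝ`.
With `l = 2Λ` the integral map contracts by `Λ / l = 1/2`, so one fixed point gives a global
solution. The integrand is cut off to `t > t₀`, since the right-hand side is continuous only there.
-/
theorem exists_solution_of_bounded_rhs (hΛ : 0 < Λ)
    (hlip : ∀ n t, t₀ < t → ∀ u v : ℤ → ℝ, ∀ b, (∀ m, |u m - v m| ≤ b) →
      |F n t u - F n t v| ≤ Λ * b)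
    (hzero : ∀ n t, F n t (fun _ => 0) = 0)
    (hcont : ∀ n, ∀ u : ℤ → ℝ → ℝ, (∀ m, Continuous (u m)) →
      ContinuousOn (fun t => F n t (fun m => u m t)) (Ioi t₀))
    {u₀ : ℤ → ℝ} {b₀ : ℝ} (hu₀ : ∀ n, |u₀ n| ≤ b₀) :
    ∃ u : ℤ → ℝ → ℝ, (∀ n, u n t₀ = u₀ n) ∧ (∀ n, Continuous (u n)) ∧
      (∀ t, t₀ ≤ t → ∃ b, ∀ n, |u n t| ≤ b) ∧
      ∀ t, t₀ < t → ∀ n, HasDerivAt (u n) (F n t (fun m => u m t)) t := by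
  set l := 2 * Λ with hl
  have hl0 : 0 < l := by positivity
  let U : BoundedContinuousFunction (ℤ × ℝ) ℝ → ℤ → ℝ → ℝ := fun x m s => Real.exp (l * (s - t₀)) * x (m, s)
  have hUc : ∀ x m, Continuous (U x m) := fun x m => by
    simp only [U]
    exact (by fun_prop : Continuous fun s => Real.exp (l * (s - t₀))).mul
      (x.continuous.comp (by fun_prop))
  let g : BoundedContinuousFunction (ℤ × ℝ) ℝ → ℤ → ℝ → ℝ := fun x n s => F n s (fun m => U x m s)
  have hgc : ∀ x n, ContinuousOn (g x n) (Ioi t₀) := fun x n => hcont n _ (hUc x)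
  have hgd : ∀ x y n s, t₀ < s → |g x n s - g y n s| ≤
      Λ * dist x y * Real.exp (l * (s - t₀)) := by
    intro x y n s hs
    rw [mul_assoc]
    refine hlip n s hs _ _ _ fun m => ?_
    have := BoundedContinuousFunction.dist_coe_le_dist (f := x) (g := y) (m, s)
    rw [Real.dist_eq] at this
    simp only [U]
    rw [← mul_sub, abs_mul, Real.abs_exp, mul_comm]
    gcongr
  have hgb : ∀ x n s, t₀ < s → |g x n s| ≤ Λ * ‖x‖ * Real.exp (l * (s - t₀)) := by
    intro x n s hs
    have h0 : g 0 n s = 0 := by simp [g, U, hzero]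
    have := hgd x 0 n s hs
    rwa [h0, sub_zero, dist_zero_right] at this
  let I : BoundedContinuousFunction (ℤ × ℝ) ℝ → ℤ → ℝ → ℝ := fun x n t => ∫ s in t₀..t, (Ioi t₀).indicator (g x n) s
  have hint : ∀ x n a b, IntervalIntegrable ((Ioi t₀).indicator (g x n)) volume a b :=
    fun x n a b => intervalIntegrable_of_exp_bound hl0 (hgc x n) (by positivity) (hgb x n) a b
  have hIc : ∀ x n, Continuous (I x n) := fun x n =>
    intervalIntegral.continuous_primitive (hint x n) t₀
  have hIb : ∀ x n t, |I x n t| ≤ Λ * ‖x‖ / l * Real.exp (l * |t - t₀|) := by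
    intro x n t
    refine abs_integral_le_exp (by positivity) hl0 (fun s hs => ?_) (fun s hs => ?_) t
    · rw [indicator_of_mem (show s ∈ Ioi t₀ from hs)]; exact hgb x n s hs
    · exact indicator_of_notMem (not_lt.2 hs) _
  have hId : ∀ x y n t, |I x n t - I y n t| ≤ Λ * dist x y / l * Real.exp (l * |t - t₀|) := by
    intro x y n t
    simp only [I]
    rw [← intervalIntegral.integral_sub (hint x n _ _) (hint y n _ _)]
    refine abs_integral_le_exp (by positivity) hl0 (fun s hs => ?_) (fun s hs => ?_) t
    · simp only [indicator_of_mem (show s ∈ Ioi t₀ from hs)]; exact hgd x y n s hs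
    · simp [indicator_of_notMem (show s ∉ Ioi t₀ from not_lt.2 hs)]
  let f : BoundedContinuousFunction (ℤ × ℝ) ℝ → BoundedContinuousFunction (ℤ × ℝ) ℝ := fun x => BoundedContinuousFunction.ofNormedAddCommGroup
    (fun z : ℤ × ℝ => Real.exp (-(l * |z.2 - t₀|)) * (u₀ z.1 + I x z.1 z.2))
    (by
      rw [continuous_prod_of_discrete_left]
      intro n
      exact (by fun_prop : Continuous fun s => Real.exp (-(l * |s - t₀|))).mul
        ((continuous_const (y := u₀ n)).add (hIc x n)))
    (b₀ + Λ * ‖x‖ / l)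
    (by
      rintro ⟨n, t⟩
      simp only [Real.norm_eq_abs, abs_mul, Real.abs_exp]
      have h1 : |u₀ n + I x n t| ≤ b₀ + Λ * ‖x‖ / l * Real.exp (l * |t - t₀|) :=
        (abs_add_le _ _).trans (add_le_add (hu₀ n) (hIb x n t))
      have h2 : Real.exp (-(l * |t - t₀|)) ≤ 1 := Real.exp_le_one_iff.2 (by
        have := abs_nonneg (t - t₀); nlinarith)
      have h3 : 0 ≤ b₀ := (abs_nonneg _).trans (hu₀ n)
      have h4 : Real.exp (-(l * |t - t₀|)) * Real.exp (l * |t - t₀|) = 1 := by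
        rw [← Real.exp_add]; simp
      calc Real.exp (-(l * |t - t₀|)) * |u₀ n + I x n t|
          ≤ Real.exp (-(l * |t - t₀|)) * (b₀ + Λ * ‖x‖ / l * Real.exp (l * |t - t₀|)) := by gcongr
        _ = Real.exp (-(l * |t - t₀|)) * b₀ +
            Λ * ‖x‖ / l * (Real.exp (-(l * |t - t₀|)) * Real.exp (l * |t - t₀|)) := by ring
        _ ≤ 1 * b₀ + Λ * ‖x‖ / l * 1 := by rw [h4]; gcongr
        _ = _ := by ring)
  have hfa : ∀ x n t, f x (n, t) = Real.exp (-(l * |t - t₀|)) * (u₀ n + I x n t) :=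
    fun _ _ _ => rfl
  have hf : ContractingWith (1 / 2 : ℝ≥0) f := by
    refine ⟨by rw [← NNReal.coe_lt_coe]; norm_num, LipschitzWith.of_dist_le_mul fun x y => ?_⟩
    rw [BoundedContinuousFunction.dist_le (by positivity)]
    rintro ⟨n, t⟩
    have h4 : Real.exp (-(l * |t - t₀|)) * Real.exp (l * |t - t₀|) = 1 := by
      rw [← Real.exp_add]; simp
    have h5 : (f x) (n, t) - (f y) (n, t) =
        Real.exp (-(l * |t - t₀|)) * (I x n t - I y n t) := by
      rw [hfa, hfa]; ring
    rw [Real.dist_eq, h5, abs_mul, Real.abs_exp]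
    calc Real.exp (-(l * |t - t₀|)) * |I x n t - I y n t|
        ≤ Real.exp (-(l * |t - t₀|)) * (Λ * dist x y / l * Real.exp (l * |t - t₀|)) := by
          gcongr; exact hId x y n t
      _ = Λ * dist x y / l * (Real.exp (-(l * |t - t₀|)) * Real.exp (l * |t - t₀|)) := by ring
      _ = ((1 / 2 : ℝ≥0) : ℝ) * dist x y := by
        rw [h4, hl]; push_cast; field_simp
  set x := ContractingWith.fixedPoint f hf with hx
  have hfix : f x = x := hf.fixedPoint_isFixedPt
  have hval : ∀ n t, x (n, t) = Real.exp (-(l * |t - t₀|)) * (u₀ n + I x n t) := by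
    intro n t
    rw [← hfa, hfix]
  have hU : ∀ n t, t₀ ≤ t → U x n t = u₀ n + I x n t := by
    intro n t ht
    simp only [U]
    rw [hval, ← mul_assoc, ← Real.exp_add, abs_of_nonneg (sub_nonneg.2 ht)]
    simp
  refine ⟨fun n t => u₀ n + I x n t, fun n => by simp [I], fun n => continuous_const.add (hIc x n),
    fun t ht => ⟨b₀ + Λ * ‖x‖ / l * Real.exp (l * |t - t₀|), fun n =>
      (abs_add_le _ _).trans (add_le_add (hu₀ n) (hIb x n t))⟩, fun t ht n => ?_⟩
  have hnhds : Ioi t₀ ∈ 𝓝 t := Ioi_mem_nhds ht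
  have heq : (Ioi t₀).indicator (g x n) =ᶠ[𝓝 t] g x n := by
    filter_upwards [hnhds] with s hs
    exact indicator_of_mem hs _
  have hct : ContinuousAt ((Ioi t₀).indicator (g x n)) t :=
    ((hgc x n).continuousAt hnhds).congr heq.symm
  have hmeas : StronglyMeasurableAtFilter ((Ioi t₀).indicator (g x n)) (𝓝 t) volume :=
    ⟨Ioi t₀, hnhds, ((hgc x n).aestronglyMeasurable measurableSet_Ioi).congr (by
      rw [EventuallyEq, ae_restrict_iff' measurableSet_Ioi]
      exact Eventually.of_forall fun s hs => (indicator_of_mem hs _).symm)⟩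
  have hd := (intervalIntegral.integral_hasDerivAt_right (hint x n t₀ t) hmeas hct).const_add (u₀ n)
  rw [indicator_of_mem (show t ∈ Ioi t₀ from ht)] at hd
  refine hd.congr_deriv ?_
  simp only [g, fun m => hU m t ht.le]

end Existence

/-! ### The coefficients of the truncated operator -/

/-- The fragmentation rate `γ(2^{n+q_n})` at the site `n`. -/
noncomputable def gam (K : Kernels) (q : ℤ → ℝ) (n : ℤ) : ℝ := K.γ ((2 : ℝ) ^ ((n : ℝ) + q n))

/-- The ratio `8 μ̄_n` of consecutive weights of the reversible measure. -/
noncomputable def jumpRatio (K : Kernels) (A : ℝ) (q : ℤ → ℝ) (n : ℤ) : ℝ := 8 * muBar K A q n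

/-- The upward rate of the truncated operator at the site `n`. -/
noncomputable def upRate (K : Kernels) (A : ℝ) (N : ℤ) (q : ℤ → ℝ) (n : ℤ) : ℝ :=
  if n < N then jumpRatio K A q n * gam K q (n + 1) else 0

theorem gam_pos (K : Kernels) (q : ℤ → ℝ) (n : ℤ) : 0 < gam K q n := K.γ_pos _ (by positivity)

theorem jumpRatio_pos (K : Kernels) (A : ℝ) (q : ℤ → ℝ) (n : ℤ) : 0 < jumpRatio K A q n := by
  unfold jumpRatio muBar; positivity

theorem upRate_nonneg (K : Kernels) (A : ℝ) (N : ℤ) (q : ℤ → ℝ) (n : ℤ) :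
    0 ≤ upRate K A N q n := by
  unfold upRate
  split_ifs
  · exact (mul_pos (jumpRatio_pos K A q n) (gam_pos K q _)).le
  · exact le_rfl

theorem upRate_le (K : Kernels) (A : ℝ) (N : ℤ) (q : ℤ → ℝ) (n : ℤ) :
    upRate K A N q n ≤ jumpRatio K A q n * gam K q (n + 1) := by
  unfold upRate
  split_ifs
  · exact le_rfl
  · exact (mul_pos (jumpRatio_pos K A q n) (gam_pos K q _)).le

theorem opTrunc_eq (K : Kernels) (A : ℝ) (N : ℤ) (q y : ℤ → ℝ) (n : ℤ) :
    opTrunc K A N q y n =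
      (upRate K A N q n * (y (n + 1) - y n) - gam K q n * (y n - y (n - 1))) / 4 := by
  have h := (gam_pos K q n).ne'
  have h1 : K.γ ((2 : ℝ) ^ ((n : ℝ) + 1 + q (n + 1))) = gam K q (n + 1) := by
    simp [gam]
  rw [opTrunc, sigmaTrunc, upRate, h1]
  change gam K q n / 4 * (y (n - 1) - y n - (if n < N then
    8 * muBar K A q n * (gam K q (n + 1) / gam K q n) else 0) * (y n - y (n + 1))) = _
  split_ifs
  · rw [jumpRatio]; field_simp; ring
  · ring

/-- Each term of the operator is a rate times a difference of `y`, so its own difference involves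
`dPlus y` alone. -/
theorem dPlus_opTrunc (K : Kernels) (A : ℝ) (N : ℤ) (q y : ℤ → ℝ) (n : ℤ) :
    opTrunc K A N q y (n + 1) - opTrunc K A N q y n =
      diffRhs (gam K q) (upRate K A N q) (dPlus y) n := by
  rw [opTrunc_eq, opTrunc_eq]
  simp only [diffRhs, dPlus, add_sub_cancel_right, sub_add_cancel]
  ring

/-! ### The weights of the reversible measure -/

theorem log_zetaCoeff (K : Kernels) (q : ℤ → ℝ) (n : ℤ) :
    Real.log (zetaCoeff K q n) = Real.log (Real.log 2) - (n + q n) * Real.log 2 +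
      Real.log (K.k ((2 : ℝ) ^ ((n : ℝ) + q n))) - Real.log (gam K q (n + 1)) := by
  have h1 : K.γ ((2 : ℝ) ^ ((n : ℝ) + 1 + q (n + 1))) = gam K q (n + 1) := by simp [gam]
  have hl : Real.log 2 ≠ 0 := (Real.log_pos (by norm_num)).ne'
  have hp : (2 : ℝ) ^ ((n : ℝ) + q n) ≠ 0 := (by positivity : (0 : ℝ) < _).ne'
  have hk := (K.k_pos ((2 : ℝ) ^ ((n : ℝ) + q n)) (by positivity)).ne'
  have hg := (gam_pos K q (n + 1)).ne'
  rw [zetaCoeff, h1, Real.log_mul (div_ne_zero hl hp) (div_ne_zero hk hg), Real.log_div hl hp,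
    Real.log_div hk hg, Real.log_rpow (by norm_num)]
  ring

theorem zetaCoeff_pos (K : Kernels) (q : ℤ → ℝ) (n : ℤ) : 0 < zetaCoeff K q n := by
  have hk := K.k_pos ((2 : ℝ) ^ ((n : ℝ) + q n)) (by positivity)
  have hg := K.γ_pos ((2 : ℝ) ^ ((n : ℝ) + 1 + q (n + 1))) (by positivity)
  have hl : 0 < Real.log 2 := Real.log_pos (by norm_num)
  unfold zetaCoeff
  positivity

theorem log_thetaCoeff (K : Kernels) (q : ℤ → ℝ) (n : ℤ) :
    Real.log (thetaCoeff K q n) = -(q (n + 1) - q n) * Real.log 2 +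
      (Real.log (K.k ((2 : ℝ) ^ (((n + 1 : ℤ) : ℝ) + q (n + 1)))) -
        Real.log (K.k ((2 : ℝ) ^ ((n : ℝ) + q n)))) -
      (Real.log (gam K q (n + 1 + 1)) - Real.log (gam K q (n + 1))) := by
  rw [thetaCoeff, Real.log_div (mul_ne_zero two_ne_zero (zetaCoeff_pos K q _).ne')
    (zetaCoeff_pos K q _).ne', Real.log_mul two_ne_zero (zetaCoeff_pos K q _).ne',
    log_zetaCoeff, log_zetaCoeff]
  push_cast
  ring

theorem abs_log_gam_sub_le {K : Kernels} {L : ℝ}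
    (hd : ∀ x : ℝ, ∃ d, HasDerivAt (fun x : ℝ => K.γ ((2 : ℝ) ^ x)) d x ∧
      |d| ≤ L * K.γ ((2 : ℝ) ^ x)) (q q' : ℤ → ℝ) (n m : ℤ) :
    |Real.log (gam K q n) - Real.log (gam K q' m)| ≤ L * |(n + q n) - (m + q' m)| :=
  abs_log_sub_log_le (fun _ => K.γ_pos _ (by positivity)) hd _ _

/-- `θ_n` compares profiles at consecutive sites, so their power growth cancels. With shifts at most
1 the two positions are at distance at most 3, and log-Lipschitz continuity gives both bounds. -/
theorem exists_log_thetaCoeff_bound (K : Kernels) : ∃ C : ℝ, 0 < C ∧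
    (∀ q : ℤ → ℝ, (∀ n, |q n| ≤ 1) → ∀ n, |Real.log (thetaCoeff K q n)| ≤ C) ∧
    ∀ q q' : ℤ → ℝ, ∀ η, (∀ n, |q n - q' n| ≤ η) → ∀ n,
      |Real.log (thetaCoeff K q n) - Real.log (thetaCoeff K q' n)| ≤ C * η := by
  obtain ⟨L, hL, hk⟩ := K.exists_k_bound
  obtain ⟨L', -, -, hL', -, -, hγ, -⟩ := K.exists_γ_bound
  have hl : 0 < Real.log 2 := Real.log_pos (by norm_num)
  have hkl := abs_log_sub_log_le (g := fun x : ℝ => K.k ((2 : ℝ) ^ x))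
    (fun _ => K.k_pos _ (by positivity)) hk
  refine ⟨3 * Real.log 2 + 3 * L + 3 * L', by positivity, fun q hq n => ?_, fun q q' η hη n => ?_⟩
  · rw [log_thetaCoeff]
    have h0 := abs_le.1 (hq n)
    have h1 := abs_le.1 (hq (n + 1))
    have h2 := abs_le.1 (hq (n + 1 + 1))
    have e1 := abs_le.1 ((hkl (((n + 1 : ℤ) : ℝ) + q (n + 1)) ((n : ℝ) + q n)).trans
      (mul_le_mul_of_nonneg_left (c := 3) (abs_le.2 ⟨by push_cast; linarith,
        by push_cast; linarith⟩) hL.le))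
    have e2 := abs_le.1 ((abs_log_gam_sub_le hγ q q (n + 1 + 1) (n + 1)).trans
      (mul_le_mul_of_nonneg_left (c := 3) (abs_le.2 ⟨by push_cast; linarith,
        by push_cast; linarith⟩) hL'.le))
    rw [abs_le]
    constructor <;> nlinarith
  · rw [log_thetaCoeff, log_thetaCoeff]
    have h0 := abs_le.1 (hη n)
    have h1 := abs_le.1 (hη (n + 1))
    have h2 := abs_le.1 (hη (n + 1 + 1))
    have hη0 : 0 ≤ η := (abs_nonneg _).trans (hη n)
    have e1 := abs_le.1 ((hkl (((n + 1 : ℤ) : ℝ) + q (n + 1)) (((n + 1 : ℤ) : ℝ) + q' (n + 1))).trans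
      (mul_le_mul_of_nonneg_left (c := η) (abs_le.2 ⟨by linarith, by linarith⟩) hL.le))
    have e2 := abs_le.1 ((hkl ((n : ℝ) + q n) ((n : ℝ) + q' n)).trans
      (mul_le_mul_of_nonneg_left (c := η) (abs_le.2 ⟨by linarith, by linarith⟩) hL.le))
    have e3 := abs_le.1 ((abs_log_gam_sub_le hγ q q' (n + 1 + 1) (n + 1 + 1)).trans
      (mul_le_mul_of_nonneg_left (c := η) (abs_le.2 ⟨by linarith, by linarith⟩) hL'.le))
    have e4 := abs_le.1 ((abs_log_gam_sub_le hγ q q' (n + 1) (n + 1)).trans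
      (mul_le_mul_of_nonneg_left (c := η) (abs_le.2 ⟨by linarith, by linarith⟩) hL'.le))
    have e5 : |(q (n + 1) - q n) - (q' (n + 1) - q' n)| * Real.log 2 ≤ 2 * η * Real.log 2 :=
      mul_le_mul_of_nonneg_right (abs_le.2 ⟨by linarith, by linarith⟩) hl.le
    have e6 := abs_le.1 ((abs_mul _ _).trans_le ((congrArg _ (abs_of_pos hl)).trans_le e5))
    have := mul_nonneg hL.le hη0
    have := mul_nonneg hL'.le hη0
    have := mul_nonneg hl.le hη0
    rw [abs_le]
    constructor <;> linarith

/-- The series in the exponent of `muBar`, normalised by the factor `2^n`. -/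
noncomputable def logThetaSeries (K : Kernels) (q : ℤ → ℝ) (n : ℤ) : ℝ :=
  ∑' i : ℕ, Real.log (thetaCoeff K q (n + (i : ℤ))) / 2 / 2 ^ i

theorem muBar_eq (K : Kernels) (A : ℝ) (q : ℤ → ℝ) (n : ℤ) :
    muBar K A q n = Real.exp (-A * (2 : ℝ) ^ n - logThetaSeries K q n) := by
  rw [muBar, ← Real.exp_add, neg_mul (_ ^ n), ← tsum_mul_left, sub_eq_add_neg]
  congr 3
  refine tsum_congr fun i => ?_
  have h : (2 : ℝ) ^ n * (2 : ℝ) ^ (-(n + 1 + (i : ℤ))) = 1 / 2 / 2 ^ i := by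
    rw [← zpow_add₀ two_ne_zero]
    have : n + -(n + 1 + (i : ℤ)) = -1 - (i : ℤ) := by ring
    rw [this, zpow_sub₀ two_ne_zero]
    simp
  rw [← mul_assoc, h]
  ring

theorem norm_div_two_pow_le {x C : ℝ} (h : |x| ≤ C) (i : ℕ) : ‖x / 2 / 2 ^ i‖ ≤ C / 2 / 2 ^ i := by
  rw [Real.norm_eq_abs, abs_div, abs_div, abs_of_pos (show (0 : ℝ) < 2 ^ i by positivity), abs_two]
  gcongr

/-- The weights `1/2/2^i` of the series sum to 1, so the series inherits the bound and the Lipschitz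
constant of `log θ_n`. -/
theorem exists_jumpRatio_bound (K : Kernels) {A : ℝ} : ∃ C : ℝ, 0 < C ∧
    (∀ q : ℤ → ℝ, (∀ n, |q n| ≤ 1) → ∀ n,
      jumpRatio K A q n ≤ C * Real.exp (-A * (2 : ℝ) ^ n)) ∧
    ∀ q q' : ℤ → ℝ, (∀ n, |q n| ≤ 1) → (∀ n, |q' n| ≤ 1) → ∀ η, (∀ n, |q n - q' n| ≤ η) → ∀ n,
      jumpRatio K A q n ≤ Real.exp (C * η) * jumpRatio K A q' n := by
  obtain ⟨C, hC, h1, h2⟩ := exists_log_thetaCoeff_bound K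
  refine ⟨max C (8 * Real.exp C), lt_max_of_lt_left hC, fun q hq n => ?_,
    fun q q' hq hq' η hη n => ?_⟩
  · have : ‖logThetaSeries K q n‖ ≤ C :=
      tsum_of_norm_bounded (hasSum_geometric_two' C) fun i => norm_div_two_pow_le (h1 q hq _) i
    have := (abs_le.1 this).1
    rw [jumpRatio, muBar_eq, sub_eq_add_neg, Real.exp_add]
    calc 8 * (Real.exp (-A * 2 ^ n) * Real.exp (-logThetaSeries K q n))
        ≤ 8 * (Real.exp (-A * 2 ^ n) * Real.exp C) := by gcongr; linarith
      _ = 8 * Real.exp C * Real.exp (-A * 2 ^ n) := by ring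
      _ ≤ _ := by gcongr; exact le_max_right _ _
  · have hη0 : 0 ≤ η := (abs_nonneg _).trans (hη 0)
    have hs : ∀ q : ℤ → ℝ, (∀ n, |q n| ≤ 1) →
        Summable fun i : ℕ => Real.log (thetaCoeff K q (n + (i : ℤ))) / 2 / 2 ^ i := fun q hq =>
      Summable.of_norm_bounded (hasSum_geometric_two' C).summable fun i =>
        norm_div_two_pow_le (h1 q hq _) i
    have : ‖logThetaSeries K q n - logThetaSeries K q' n‖ ≤ C * η := by
      rw [logThetaSeries, logThetaSeries, ← (hs q hq).tsum_sub (hs q' hq')]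
      refine tsum_of_norm_bounded (hasSum_geometric_two' (C * η)) fun i => ?_
      rw [← sub_div, ← sub_div]
      exact norm_div_two_pow_le (h2 q q' η hη _) i
    have := (abs_le.1 this).1
    rw [jumpRatio, jumpRatio, muBar_eq, muBar_eq]
    have h3 : C * η ≤ max C (8 * Real.exp C) * η := by gcongr; exact le_max_left _ _
    rw [mul_left_comm, ← Real.exp_add]
    gcongr
    linarith

theorem continuous_gam {K : Kernels} {p : ℝ → ℤ → ℝ} {s : Set ℝ}
    (hp : ∀ n, ContinuousOn (fun t => p t n) s) (n : ℤ) :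
    ContinuousOn (fun t => gam K (p t) n) s := by
  obtain ⟨L', -, -, -, -, -, hγ, -⟩ := K.exists_γ_bound
  have : Continuous fun x : ℝ => K.γ ((2 : ℝ) ^ x) := continuous_iff_continuousAt.2 fun x => by
    obtain ⟨d, hd, -⟩ := hγ x
    exact hd.continuousAt
  exact this.comp_continuousOn (continuousOn_const.add (hp n))

theorem continuous_jumpRatio {K : Kernels} {A : ℝ} {p : ℝ → ℤ → ℝ} {s : Set ℝ}
    (hp : ∀ n, ContinuousOn (fun t => p t n) s) (hb : ∀ t ∈ s, ∀ n, |p t n| ≤ 1) (n : ℤ) :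
    ContinuousOn (fun t => jumpRatio K A (p t) n) s := by
  obtain ⟨C, hC, h1, -⟩ := exists_log_thetaCoeff_bound K
  obtain ⟨L, -, hk⟩ := K.exists_k_bound
  have hkc : Continuous fun x : ℝ => Real.log (K.k ((2 : ℝ) ^ x)) :=
    continuous_iff_continuousAt.2 fun x => by
      obtain ⟨d, hd, -⟩ := hk x
      exact (hd.log (K.k_pos _ (by positivity)).ne').continuousAt
  have hgc : ∀ n, ContinuousOn (fun t => Real.log (gam K (p t) n)) s := fun n =>
    (continuous_gam hp n).log fun t _ => (gam_pos K _ _).ne'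
  have hkc' : ∀ n : ℤ, ContinuousOn (fun t => Real.log (K.k ((2 : ℝ) ^ ((n : ℝ) + p t n)))) s :=
    fun n => hkc.comp_continuousOn (continuousOn_const.add (hp n))
  have hθ : ∀ n, ContinuousOn (fun t => Real.log (thetaCoeff K (p t) n)) s := fun n => by
    simp only [log_thetaCoeff]
    exact (((((hp _).sub (hp _)).neg).mul continuousOn_const).add
      ((hkc' _).sub (hkc' _))).sub ((hgc _).sub (hgc _))
  simp only [jumpRatio, muBar_eq]
  refine continuousOn_const.mul (Real.continuous_exp.comp_continuousOn (continuousOn_const.sub ?_))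
  exact continuousOn_tsum (fun i => ((hθ _).div_const _).div_const _)
    (hasSum_geometric_two' C).summable fun i t ht => norm_div_two_pow_le (h1 _ (hb t ht) _) i

theorem tendsto_log_two_rpow {f : ℝ → ℝ} {f₀ : ℝ} (h : Tendsto f (𝓝[>] 0) (𝓝 f₀)) (hf₀ : 0 < f₀)
    (j : ℤ) : Tendsto (fun n : ℤ => Real.log (f ((2 : ℝ) ^ ((n + j : ℤ) : ℝ)))) atBot
      (𝓝 (Real.log f₀)) := by
  have h1 : Tendsto (fun x : ℝ => (2 : ℝ) ^ x) atBot (𝓝[>] 0) :=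
    tendsto_nhdsWithin_iff.2 ⟨tendsto_rpow_atBot_of_base_gt_one 2 (by norm_num),
      Eventually.of_forall fun x => by simp only [mem_Ioi]; positivity⟩
  have h2 : Tendsto (fun n : ℤ => ((n + j : ℤ) : ℝ)) atBot atBot :=
    tendsto_intCast_atBot_iff.2 (tendsto_atBot_add_const_right _ j tendsto_id)
  exact (h.comp (h1.comp h2)).log hf₀.ne'

/-- Both profiles have positive limits at `0`, so each `log θ_n → 0` as `n → -∞`. Dominated
convergence removes the series, and the factor 8 remains. -/
theorem tendsto_jumpRatio_atBot (K : Kernels) (A : ℝ) :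
    Tendsto (jumpRatio K A fun _ => 0) atBot (𝓝 8) := by
  obtain ⟨C, hC, h1, -⟩ := exists_log_thetaCoeff_bound K
  have hθ : ∀ i : ℕ, Tendsto (fun n : ℤ => Real.log (thetaCoeff K (fun _ => 0) (n + (i : ℤ))))
      atBot (𝓝 0) := by
    intro i
    simp only [log_thetaCoeff, gam, sub_self, neg_zero, zero_mul, zero_add, add_zero, add_assoc]
    have hk := tendsto_log_two_rpow K.tendsto_k_zero K.hk₀
    have hγ := tendsto_log_two_rpow K.tendsto_γ_zero K.hγ₀
    simpa using ((hk (i + 1)).sub (hk i)).sub ((hγ (i + (1 + 1))).sub (hγ (i + 1)))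
  have hs : Tendsto (logThetaSeries K fun _ => 0) atBot (𝓝 (∑' _ : ℕ, 0)) := by
    refine tendsto_tsum_of_dominated_convergence (bound := fun i : ℕ => C / 2 / 2 ^ i)
      (hasSum_geometric_two' C).summable (fun i => ?_)
      (Eventually.of_forall fun n i => norm_div_two_pow_le (h1 _ (by simp) _) i)
    simpa using ((hθ i).div_const 2).div_const (2 ^ i)
  have h2 : Tendsto (fun n : ℤ => (2 : ℝ) ^ n) atBot (𝓝 0) := by
    have := (tendsto_rpow_atBot_of_base_gt_one 2 (by norm_num)).comp
      (tendsto_intCast_atBot_iff (R := ℝ).2 tendsto_id)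
    refine this.congr fun n => ?_
    simp
  have h3 : Tendsto (fun n : ℤ => 8 * Real.exp (-A * (2 : ℝ) ^ n - logThetaSeries K (fun _ => 0) n))
      atBot (𝓝 (8 * Real.exp (-A * 0 - ∑' _ : ℕ, 0))) :=
    (((h2.const_mul (-A)).sub hs).rexp).const_mul 8
  have h4 : (jumpRatio K A fun _ => 0) =
      fun n : ℤ => 8 * Real.exp (-A * (2 : ℝ) ^ n - logThetaSeries K (fun _ => 0) n) := by
    funext n
    rw [jumpRatio, muBar_eq]
  rw [h4]
  simpa using h3

/-! ### A static supersolution -/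

theorem exists_uniform_margin {S : Finset ℤ} {f g : ℤ → ℝ} (hfg : ∀ n ∈ S, f n < g n)
    (hg : ∀ n ∈ S, 0 < g n) : ∃ c : ℝ, 0 < c ∧ ∀ n ∈ S, f n ≤ (1 - c) * g n := by
  rcases S.eq_empty_or_nonempty with rfl | hS
  · exact ⟨1, one_pos, by simp⟩
  obtain ⟨m, hm, hmin⟩ := S.exists_min_image (fun n => 1 - f n / g n) hS
  refine ⟨1 - f m / g m, ?_, fun n hn => ?_⟩
  · rw [sub_pos, div_lt_one (hg m hm)]; exact hfg m hm
  · have h1 : f n / g n ≤ 1 - (1 - f m / g m) := by linarith [hmin n hn]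
    rwa [div_le_iff₀ (hg n hn)] at h1

/-- In terms of the flux `J n = r n * v n - v (n-1)`, the supersolution inequality says exactly `J
(n+1) < J n`. On the left `J n = (r n - 2) 2^(-n) > 0`. Each new value of `v` is chosen to halve the
flux, which keeps it positive, and positivity is the last clause. Between the two ends only `r > 0`
is needed. -/
theorem exists_supersolution_up_to {r : ℤ → ℝ} (hr : ∀ n, 0 < r n) {m₀ : ℤ}
    (hleft : ∀ n ≤ m₀, 7 ≤ r n) (k : ℕ) : ∃ v : ℤ → ℝ, (∀ n, 0 < v n) ∧
      (∀ n ≤ m₀, v n = (2 : ℝ) ^ (-n)) ∧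
      (∀ n, m₀ ≤ n → n < m₀ + k → v (n - 1) + r (n + 1) * v (n + 1) < (1 + r n) * v n) ∧
      v (m₀ + k - 1) < r (m₀ + k) * v (m₀ + k) := by
  induction k with
  | zero =>
    refine ⟨fun n => (2 : ℝ) ^ (-n), fun n => by positivity, fun _ _ => rfl, fun n h1 h2 => ?_, ?_⟩
    · simp at h2; omega
    · have h1 : (2 : ℝ) ^ (-(m₀ + ((0 : ℕ) : ℤ) - 1)) = 2 * (2 : ℝ) ^ (-m₀) := by
        rw [show -(m₀ + ((0 : ℕ) : ℤ) - 1) = 1 + -m₀ by simp; ring, zpow_add₀ two_ne_zero, zpow_one]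
      have h2 : (0 : ℝ) < (2 : ℝ) ^ (-m₀) := by positivity
      simp only [h1]
      have := hleft m₀ le_rfl
      simp only [Nat.cast_zero, add_zero]
      nlinarith
  | succ k ih =>
    obtain ⟨v, hv, hv0, hv1, hv2⟩ := ih
    set m : ℤ := m₀ + k with hm
    have hm' : m₀ + ((k + 1 : ℕ) : ℤ) = m + 1 := by push_cast; ring
    set x : ℝ := (v m + (r m * v m - v (m - 1)) / 2) / r (m + 1) with hx
    have hrx : r (m + 1) * x = v m + (r m * v m - v (m - 1)) / 2 := by
      rw [hx]; field_simp [(hr (m + 1)).ne']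
    have hx0 : 0 < x := by
      rw [hx]; exact div_pos (by linarith [hv m]) (hr _)
    have hne : ∀ n, n ≤ m → Function.update v (m + 1) x n = v n := fun n hn =>
      Function.update_of_ne (by omega) _ _
    refine ⟨Function.update v (m + 1) x, fun n => ?_, fun n hn => ?_, fun n h1 h2 => ?_, ?_⟩
    · by_cases h : n = m + 1
      · rw [h, Function.update_self]; exact hx0
      · rw [Function.update_of_ne h]; exact hv n
    · rw [hne n (by omega)]; exact hv0 n hn
    · rw [hm'] at h2
      rw [hne n (by omega), hne (n - 1) (by omega)]
      rcases lt_or_eq_of_le (Int.lt_add_one_iff.1 h2) with h | h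
      · rw [hne (n + 1) (by omega)]; exact hv1 n h1 h
      · rw [h, Function.update_self, hrx]; linarith
    · rw [hm', add_sub_cancel_right, hne m le_rfl, Function.update_self, hrx]; linarith

/-- To the left, `2 + 9/2 < 7/8 * (1 + 7)`; to the right, `v = 2^n` up to a constant and `1/2 + 2/8
< 7/8`. At the seam `m₁`, positivity of the flux and `2 r (m₁+1) < 1` suffice. The finitely many
strict inequalities in between share a margin. The ratio `v n / 2^|n|` is constant on each outer
range, so its extremes are attained on the middle range. -/
theorem exists_static_supersolution {r : ℤ → ℝ} (hr : ∀ n, 0 < r n) {m₀ m₁ : ℤ} (hm₀ : m₀ ≤ 0)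
    (hm₁ : 0 ≤ m₁) (hleft : ∀ n ≤ m₀, 7 ≤ r n ∧ r n ≤ 9) (hright : ∀ n, m₁ < n → r n ≤ 1 / 8) :
    ∃ v : ℤ → ℝ, ∃ c c₁ C₁ : ℝ, (∀ n, 0 < v n) ∧ 0 < c ∧ c < 1 ∧ 0 < c₁ ∧ 0 < C₁ ∧
      (∀ n, v (n - 1) + r (n + 1) * v (n + 1) ≤ (1 - c) * ((1 + r n) * v n)) ∧
      ∀ n, c₁ * (2 : ℝ) ^ |n| ≤ v n ∧ v n ≤ C₁ * (2 : ℝ) ^ |n| := by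
  obtain ⟨k, hk⟩ : ∃ k : ℕ, m₁ = m₀ + k := ⟨(m₁ - m₀).toNat, by omega⟩
  obtain ⟨v, hv, hv0, hv1, hv2⟩ := exists_supersolution_up_to hr (fun n hn => (hleft n hn).1) k
  rw [← hk] at hv1 hv2
  let V : ℤ → ℝ := fun n => if n ≤ m₁ then v n else v m₁ * (2 : ℝ) ^ (n - m₁)
  have hVle : ∀ n, n ≤ m₁ → V n = v n := fun n hn => if_pos hn
  have hVge : ∀ n, m₁ ≤ n → V n = v m₁ * (2 : ℝ) ^ (n - m₁) := by
    intro n hn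
    rcases eq_or_lt_of_le hn with h | h
    · rw [← h, hVle _ le_rfl]; simp
    · exact if_neg (not_le.2 h)
  have hV : ∀ n, 0 < V n := by
    intro n
    rcases le_total n m₁ with h | h
    · rw [hVle n h]; exact hv n
    · rw [hVge n h]; have := hv m₁; positivity
  have hstrict : ∀ n ∈ Finset.Icc m₀ m₁,
      V (n - 1) + r (n + 1) * V (n + 1) < (1 + r n) * V n := by
    intro n hn
    rw [Finset.mem_Icc] at hn
    rw [hVle n hn.2, hVle (n - 1) (by omega)]
    rcases lt_or_eq_of_le hn.2 with h | h
    · rw [hVle (n + 1) (by omega)]; exact hv1 n hn.1 h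
    · rw [h, hVge (m₁ + 1) (by omega)]
      have h1 := hright (m₁ + 1) (by omega)
      have h2 := hv m₁
      rw [add_sub_cancel_left, zpow_one]
      nlinarith
  obtain ⟨c, hc, hcm⟩ := exists_uniform_margin hstrict
    (fun n _ => mul_pos (by linarith [hr n]) (hV n))
  have hle : min c (1 / 8) ≤ 1 / 8 := min_le_right _ _
  have hE : ∀ n : ℤ, (0 : ℝ) < (2 : ℝ) ^ |n| := fun n => by positivity
  obtain ⟨a, ha, hamin⟩ := (Finset.Icc m₀ m₁).exists_min_image (fun n => V n / (2 : ℝ) ^ |n|)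
    ⟨m₀, by simp; omega⟩
  obtain ⟨b, hb, hbmax⟩ := (Finset.Icc m₀ m₁).exists_max_image (fun n => V n / (2 : ℝ) ^ |n|)
    ⟨m₀, by simp; omega⟩
  have hratio : ∀ n, ∃ m ∈ Finset.Icc m₀ m₁, V n / (2 : ℝ) ^ |n| = V m / (2 : ℝ) ^ |m| := by
    intro n
    rcases le_total n m₀ with h | h
    · refine ⟨m₀, by simp; omega, ?_⟩
      rw [hVle n (by omega), hVle m₀ (by omega), hv0 n h, hv0 m₀ le_rfl,
        abs_of_nonpos (h.trans hm₀), abs_of_nonpos hm₀, div_self (by positivity),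
        div_self (by positivity)]
    rcases le_total n m₁ with h' | h'
    · exact ⟨n, by simp; omega, rfl⟩
    · refine ⟨m₁, by simp; omega, ?_⟩
      rw [hVge n h', hVge m₁ le_rfl, abs_of_nonneg (hm₁.trans h'), abs_of_nonneg hm₁, sub_self,
        zpow_zero, zpow_sub₀ two_ne_zero]
      field_simp
  refine ⟨V, min c (1 / 8), V a / (2 : ℝ) ^ |a|, V b / (2 : ℝ) ^ |b|, hV, by positivity,
    (min_le_right _ _).trans_lt (by norm_num), div_pos (hV a) (hE a), div_pos (hV b) (hE b),
    fun n => ?_, fun n => ?_⟩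
  · have hpos := mul_pos (by linarith [hr n] : 0 < 1 + r n) (hV n)
    rcases lt_or_ge n m₀ with h | h
    · rw [hVle n (by omega), hVle (n - 1) (by omega), hVle (n + 1) (by omega), hv0 n h.le,
        hv0 (n - 1) (by omega), hv0 (n + 1) (by omega)]
      have e1 : (2 : ℝ) ^ (-(n - 1)) = 2 * (2 : ℝ) ^ (-n) := by
        rw [show -(n - 1) = 1 + -n by ring, zpow_add₀ two_ne_zero, zpow_one]
      have e2 : (2 : ℝ) ^ (-(n + 1)) = 1 / 2 * (2 : ℝ) ^ (-n) := by
        rw [show -(n + 1) = -1 + -n by ring, zpow_add₀ two_ne_zero]; norm_num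
      have h1 := (hleft n h.le).1
      have h2 := (hleft (n + 1) (by omega)).2
      rw [e1, e2]
      have h3 : (0 : ℝ) < (2 : ℝ) ^ (-n) := by positivity
      generalize (2 : ℝ) ^ (-n) = z at *
      have h4 : r (n + 1) * (1 / 2 * z) ≤ 9 / 2 * z := by nlinarith
      have h5 : 7 * z ≤ (1 - 1 / 8) * ((1 + r n) * z) := by nlinarith
      have h6 : (1 - 1 / 8) * ((1 + r n) * z) ≤ (1 - min c (1 / 8)) * ((1 + r n) * z) :=
        mul_le_mul_of_nonneg_right (by linarith [hle]) (by nlinarith)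
      linarith
    rcases le_or_gt n m₁ with h' | h'
    · refine (hcm n (by simp; omega)).trans (mul_le_mul_of_nonneg_right ?_ hpos.le)
      linarith [min_le_left c (1 / 8)]
    · have e1 : V (n - 1) = 1 / 2 * V n := by
        rw [hVge n h'.le, hVge (n - 1) (by omega), show n - 1 - m₁ = -1 + (n - m₁) by ring,
          zpow_add₀ two_ne_zero (-1)]
        norm_num
        ring
      have e2 : V (n + 1) = 2 * V n := by
        rw [hVge n h'.le, hVge (n + 1) (by omega), show n + 1 - m₁ = 1 + (n - m₁) by ring,
          zpow_add₀ two_ne_zero 1]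
        norm_num
        ring
      have h1 := hright (n + 1) (by omega)
      rw [e1, e2]
      have h3 := hV n
      have h4 : r (n + 1) * (2 * V n) ≤ 1 / 4 * V n := by nlinarith
      have h5 : 3 / 4 * V n ≤ (1 - 1 / 8) * ((1 + r n) * V n) := by nlinarith [hr n]
      have h6 : (1 - 1 / 8) * ((1 + r n) * V n) ≤ (1 - min c (1 / 8)) * ((1 + r n) * V n) :=
        mul_le_mul_of_nonneg_right (by linarith [hle]) hpos.le
      linarith
  · obtain ⟨m, hm, hmeq⟩ := hratio n
    rw [← le_div_iff₀ (hE n), ← div_le_iff₀ (hE n), hmeq]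
    exact ⟨hamin m hm, hbmax m hm⟩

/-! ### Weights and bounds for the rates -/

/-- The weight of the norm of `𝒴_θ`: `2^{-n}` for `n ≤ 0` and `2^{-θ n}` for `n > 0`. -/
noncomputable def wt (θ : ℝ) (n : ℤ) : ℝ :=
  if n ≤ 0 then (2 : ℝ) ^ (-n) else (2 : ℝ) ^ (-(θ * n))

/-- The growth `max(1, 2^{βx})` of the fragmentation rate at the position `x`. -/
noncomputable def growth (K : Kernels) (x : ℝ) : ℝ := max 1 ((2 : ℝ) ^ (K.β * x))

theorem wt_pos (θ : ℝ) (n : ℤ) : 0 < wt θ n := by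
  unfold wt; split_ifs <;> positivity

theorem one_le_growth (K : Kernels) (x : ℝ) : 1 ≤ growth K x := le_max_left _ _

theorem growth_of_nonpos (K : Kernels) {x : ℝ} (hx : x ≤ 0) : growth K x = 1 :=
  max_eq_left (Real.rpow_le_one_of_one_le_of_nonpos (by norm_num)
    (mul_nonpos_of_nonneg_of_nonpos (by linarith [K.hβ.1]) hx))

theorem growth_of_nonneg (K : Kernels) {x : ℝ} (hx : 0 ≤ x) :
    growth K x = (2 : ℝ) ^ (K.β * x) :=
  max_eq_right (Real.one_le_rpow (by norm_num) (mul_nonneg (by linarith [K.hβ.1]) hx))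

theorem growth_mono (K : Kernels) : Monotone (growth K) := fun x y h =>
  max_le_max le_rfl (Real.rpow_le_rpow_of_exponent_le (by norm_num)
    (mul_le_mul_of_nonneg_left h (by linarith [K.hβ.1])))

theorem growth_le_of_le_add (K : Kernels) {x y : ℝ} (h : y ≤ x + 2) :
    growth K y ≤ (2 : ℝ) ^ (K.β * 2) * growth K x := by
  have hβ := K.hβ.1
  have h1 : (1 : ℝ) ≤ 2 ^ (K.β * 2) := Real.one_le_rpow (by norm_num) (by linarith)
  refine (growth_mono K h).trans (max_le ?_ ?_)
  · nlinarith [one_le_growth K x]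
  · rw [mul_add, Real.rpow_add (by norm_num), mul_comm]
    gcongr
    exact le_max_right _ _

theorem wt_mul_growth (K : Kernels) (n : ℤ) : wt (K.β - 1) n * growth K n = (2 : ℝ) ^ |n| := by
  rcases le_or_gt n 0 with h | h
  · rw [wt, if_pos h, growth_of_nonpos K (by exact_mod_cast h), mul_one, abs_of_nonpos h]
  · rw [wt, if_neg (not_le.2 h), growth_of_nonneg K (by exact_mod_cast h.le), abs_of_pos h,
      ← Real.rpow_add (by norm_num), ← Real.rpow_intCast]
    congr 1
    ring

theorem wt_anti {θ θ' : ℝ} (h : θ ≤ θ') (n : ℤ) : wt θ' n ≤ wt θ n := by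
  unfold wt
  split_ifs with hn
  · exact le_rfl
  · have : (0 : ℝ) ≤ n := by exact_mod_cast (not_le.1 hn).le
    exact Real.rpow_le_rpow_of_exponent_le (by norm_num) (by nlinarith)

theorem zpow_neg_le_wt {θ : ℝ} (h : θ ≤ 1) (n : ℤ) : (2 : ℝ) ^ (-n) ≤ wt θ n := by
  have := wt_anti h n
  refine le_trans (le_of_eq ?_) this
  unfold wt
  split_ifs with hn
  · rfl
  · rw [one_mul, ← Real.rpow_intCast]; push_cast; rfl

theorem wt_succ_le (θ : ℝ) (n : ℤ) : wt θ (n + 1) ≤ (2 : ℝ) ^ |θ| * wt θ n := by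
  have h1 : (1 : ℝ) ≤ 2 ^ |θ| := Real.one_le_rpow (by norm_num) (abs_nonneg _)
  unfold wt
  split_ifs with h h' h'
  · have : (2 : ℝ) ^ (-(n + 1)) ≤ (2 : ℝ) ^ (-n) := zpow_le_zpow_right₀ (by norm_num) (by omega)
    have : (0 : ℝ) < 2 ^ (-n) := by positivity
    nlinarith
  · omega
  · obtain rfl : n = 0 := by omega
    simpa using neg_le_abs θ
  · rw [← Real.rpow_add (by norm_num)]
    refine Real.rpow_le_rpow_of_exponent_le (by norm_num) ?_
    push_cast
    linarith [neg_le_abs θ]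

/-- Shifts of size at most 1 move a position by at most 2 from the reference site, which costs a
factor `2^(2β)`. The upward rate is bounded uniformly because `exp (-A 2^n)` beats `1 + (2^n)^2`,
which dominates the growth of `γ` since `β < 2`. -/
theorem exists_rate_bounds (K : Kernels) {A : ℝ} (hA : 0 < A) : ∃ c C : ℝ, 0 < c ∧ 0 < C ∧
    ∀ q : ℤ → ℝ, (∀ n, |q n| ≤ 1) → ∀ n : ℤ,
      (c * growth K n ≤ gam K q n ∧ gam K q n ≤ C * growth K n) ∧
      (c * growth K n ≤ gam K q (n + 1) ∧ gam K q (n + 1) ≤ C * growth K n) ∧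
      jumpRatio K A q n * gam K q (n + 1) ≤ C := by
  obtain ⟨-, c, C, -, hc, hC, -, hb⟩ := K.exists_γ_bound
  obtain ⟨R, hR, hr, -⟩ := exists_jumpRatio_bound K (A := A)
  set P : ℝ := (2 : ℝ) ^ (K.β * 2) with hP
  have hP0 : 0 < P := by positivity
  have hhi : ∀ (q : ℤ → ℝ), (∀ n, |q n| ≤ 1) → ∀ n m : ℤ, (n = m ∨ n = m + 1) →
      c / P * growth K m ≤ gam K q n ∧ gam K q n ≤ C * P * growth K m := by
    intro q hq n m hnm
    have h1 := hb (n + q n)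
    have h2 := abs_le.1 (hq n)
    have h3 : (n : ℝ) = m ∨ (n : ℝ) = m + 1 := by exact_mod_cast hnm
    have h4 : (m : ℝ) ≤ n + q n + 2 := by rcases h3 with h | h <;> linarith
    have h5 : (n : ℝ) + q n ≤ m + 2 := by rcases h3 with h | h <;> linarith
    have h6 := growth_le_of_le_add K h4
    have h7 := growth_le_of_le_add K h5
    rw [← hP] at h6 h7
    constructor
    · calc c / P * growth K m ≤ c / P * (P * growth K (n + q n)) := by gcongr
        _ = c * growth K (n + q n) := by field_simp
        _ ≤ _ := h1.1
    · calc gam K q n ≤ C * growth K (n + q n) := h1.2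
        _ ≤ C * (P * growth K m) := by gcongr
        _ = _ := by ring
  refine ⟨c / P, max (C * P) (R * (C * P) * (1 + 2 / A ^ 2)), by positivity, by positivity,
    fun q hq n => ⟨?_, ?_, ?_⟩⟩
  · have := hhi q hq n n (Or.inl rfl)
    refine ⟨this.1, this.2.trans ?_⟩
    have := one_le_growth K n
    gcongr
    exact le_max_left _ _
  · have := hhi q hq (n + 1) n (Or.inr rfl)
    refine ⟨this.1, this.2.trans ?_⟩
    have := one_le_growth K n
    gcongr
    exact le_max_left _ _
  · have h1 := (hhi q hq (n + 1) n (Or.inr rfl)).2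
    have h2 := hr q hq n
    have hx : (0 : ℝ) < (2 : ℝ) ^ n := by positivity
    have h3 : growth K n ≤ 1 + ((2 : ℝ) ^ n) ^ 2 := by
      refine max_le (by nlinarith) ?_
      rcases le_total (n : ℝ) 0 with h | h
      · have := Real.rpow_le_one_of_one_le_of_nonpos (x := (2 : ℝ)) (by norm_num)
          (mul_nonpos_of_nonneg_of_nonpos (by linarith [K.hβ.1] : 0 ≤ K.β) h)
        nlinarith
      · have : (2 : ℝ) ^ (K.β * n) ≤ ((2 : ℝ) ^ n) ^ 2 := by
          rw [← Real.rpow_intCast, ← Real.rpow_natCast, ← Real.rpow_mul (by norm_num)]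
          exact Real.rpow_le_rpow_of_exponent_le (by norm_num) (by
            push_cast; nlinarith [K.hβ.2])
        linarith
    have h4 : Real.exp (-A * (2 : ℝ) ^ n) * (1 + ((2 : ℝ) ^ n) ^ 2) ≤ 1 + 2 / A ^ 2 := by
      generalize (2 : ℝ) ^ n = x at *
      have h5 := Real.quadratic_le_exp_of_nonneg (mul_pos hA hx).le
      have h6 : (1 + 2 / A ^ 2) * Real.exp (A * x) ≥ 1 + x ^ 2 := by
        have e1 : x ^ 2 ≤ 2 / A ^ 2 * Real.exp (A * x) := by
          rw [div_mul_eq_mul_div, le_div_iff₀ (by positivity)]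
          nlinarith [mul_pos hA hx]
        nlinarith [mul_pos hA hx, sq_nonneg (A * x)]
      have h7 : Real.exp (-A * x) * Real.exp (A * x) = 1 := by rw [← Real.exp_add]; simp
      calc Real.exp (-A * x) * (1 + x ^ 2)
          ≤ Real.exp (-A * x) * ((1 + 2 / A ^ 2) * Real.exp (A * x)) := by gcongr
        _ = (1 + 2 / A ^ 2) * (Real.exp (-A * x) * Real.exp (A * x)) := by ring
        _ = _ := by rw [h7, mul_one]
    refine le_trans ?_ (le_max_right _ _)
    calc jumpRatio K A q n * gam K q (n + 1)
        ≤ (R * Real.exp (-A * (2 : ℝ) ^ n)) * (C * P * growth K n) :=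
          mul_le_mul h2 h1 (gam_pos K q _).le (by positivity)
      _ = R * (C * P) * (Real.exp (-A * (2 : ℝ) ^ n) * growth K n) := by ring
      _ ≤ R * (C * P) * (Real.exp (-A * (2 : ℝ) ^ n) * (1 + ((2 : ℝ) ^ n) ^ 2)) := by gcongr
      _ ≤ _ := by gcongr

/-! ### Exponential decay -/

/-- `w` solves, for `n < N` and `t > t₁`, the system satisfied by the differences of solutions of
the truncated equation. -/
structure IsDiffSolution (K : Kernels) (A : ℝ) (N : ℤ) (p : ℝ → ℤ → ℝ) (t₁ : ℝ)
    (w : ℝ → ℤ → ℝ) : Prop where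
  bounded : ∀ T, ∃ B, ∀ t ∈ Icc t₁ T, ∀ n < N, |w t n| ≤ B * (2 : ℝ) ^ (-n)
  continuousOn : ∀ n < N, ContinuousOn (fun t => w t n) (Ici t₁)
  hasDerivAt : ∀ t, t₁ < t → ∀ n < N, HasDerivAt (fun s => w s n)
    (diffRhs (gam K (p t)) (upRate K A N (p t)) (w t) n) t

theorem IsDiffSolution.restrict {K : Kernels} {A : ℝ} {N : ℤ} {p : ℝ → ℤ → ℝ} {t₁ t₂ : ℝ}
    {w : ℝ → ℤ → ℝ} (h : IsDiffSolution K A N p t₁ w) (ht : t₁ ≤ t₂) :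
    IsDiffSolution K A N p t₂ w where
  bounded T := by
    obtain ⟨B, hB⟩ := h.bounded T
    exact ⟨B, fun t htT n hn => hB t ⟨ht.trans htT.1, htT.2⟩ n hn⟩
  continuousOn n hn := (h.continuousOn n hn).mono (Ici_subset_Ici.2 ht)
  hasDerivAt t htt n hn := h.hasDerivAt t (ht.trans_lt htt) n hn

theorem eventually_abs_le_of_continuousOn {f Φ : ℝ → ℝ} {t₁ K l : ℝ}
    (hf : ContinuousOn f (Ici t₁)) (hl : 0 < l) (hK : |f t₁| < K * l)
    (hΦ : ∀ᶠ t in 𝓝[>] t₁, l ≤ Φ t) : ∀ᶠ t in 𝓝[>] t₁, |f t| ≤ K * Φ t := by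
  have h1 : Tendsto (fun t => |f t|) (𝓝[>] t₁) (𝓝 |f t₁|) :=
    (((hf t₁ self_mem_Ici).mono Ioi_subset_Ici_self).tendsto).abs
  have hK0 : 0 < K := by
    by_contra! h
    have := abs_nonneg (f t₁)
    nlinarith
  filter_upwards [h1.eventually_lt_const hK, hΦ] with t h2 h3
  nlinarith

/-- With `φ n = v n / γ(2^(n+1))`, the inequality for the unshifted rates becomes that for `v` and
the ratio `r`. By `wt_mul_growth`, `v ≈ 2^|n|` means that `φ` has the weight `β - 1`. Replacing
shifted by unshifted rates costs four factors `e = exp (M η)`, which half of the margin absorbs.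
Truncation only lowers the neighbour part, since `upRate` at `n < N` is unaffected. -/
theorem exists_perturbed_supersolution (K : Kernels) {A : ℝ} (hA : 0 < A) :
    ∃ (φ : ℤ → ℝ) (η₀ c c₁ C₁ : ℝ), 0 < η₀ ∧ η₀ < 1 ∧ 0 < c ∧ c < 1 ∧ 0 < c₁ ∧ 0 < C₁ ∧
      (∀ n, c₁ * wt (K.β - 1) n ≤ φ n ∧ φ n ≤ C₁ * wt (K.β - 1) n) ∧
      ∀ q : ℤ → ℝ, (∀ n, |q n| ≤ η₀) → ∀ N : ℤ, ∀ n < N,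
        neighbourPart (gam K q) (upRate K A N q) φ n ≤
          (1 - c) * ((gam K q (n + 1) + upRate K A N q n) / 4 * φ n) := by
  obtain ⟨c₀, C₀, hc₀, hC₀, hrate⟩ := exists_rate_bounds K hA
  obtain ⟨R, hR, hr1, hr2⟩ := exists_jumpRatio_bound K (A := A)
  obtain ⟨L, -, -, hL, -, -, hγ, -⟩ := K.exists_γ_bound
  set q₀ : ℤ → ℝ := fun _ => 0 with hq₀
  have hq₀1 : ∀ n, |q₀ n| ≤ 1 := by simp [hq₀]
  set r := jumpRatio K A q₀ with hr
  have hrpos : ∀ n, 0 < r n := jumpRatio_pos K A q₀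
  obtain ⟨m₀, hm₀, hleft⟩ : ∃ m₀ : ℤ, m₀ ≤ 0 ∧ ∀ n ≤ m₀, 7 ≤ r n ∧ r n ≤ 9 := by
    have := (tendsto_jumpRatio_atBot K A).eventually (Icc_mem_nhds (by norm_num : (7 : ℝ) < 8)
      (by norm_num : (8 : ℝ) < 9))
    obtain ⟨m, hm⟩ := eventually_atBot.1 this
    exact ⟨min m 0, min_le_right _ _, fun n hn => hm n (hn.trans (min_le_left _ _))⟩
  obtain ⟨m₁, hm₁, hright⟩ : ∃ m₁ : ℤ, 0 ≤ m₁ ∧ ∀ n, m₁ < n → r n ≤ 1 / 8 := by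
    obtain ⟨k, hk⟩ := exists_nat_ge (8 * R / A)
    refine ⟨k, by positivity, fun n hn => ?_⟩
    have h1 : (k : ℝ) ≤ n := by exact_mod_cast hn.le
    have h2 : (n : ℝ) ≤ (2 : ℝ) ^ n := by
      obtain ⟨j, rfl⟩ : ∃ j : ℕ, n = j := ⟨n.toNat, by omega⟩
      have := (Nat.lt_two_pow_self (n := j)).le
      rw [zpow_natCast]
      exact_mod_cast this
    have h3 : 8 * R / A ≤ (2 : ℝ) ^ n := hk.trans (h1.trans h2)
    rw [div_le_iff₀ hA] at h3
    have h4 : 8 * R ≤ Real.exp (A * (2 : ℝ) ^ n) := by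
      have := Real.add_one_le_exp (A * (2 : ℝ) ^ n)
      linarith
    have h5 : Real.exp (-A * (2 : ℝ) ^ n) * Real.exp (A * (2 : ℝ) ^ n) = 1 := by
      rw [← Real.exp_add]; simp
    have h6 := Real.exp_pos (-A * (2 : ℝ) ^ n)
    have h7 := hr1 q₀ hq₀1 n
    nlinarith
  obtain ⟨v, c, c₁, C₁, hv, hc, hc1, hc₁, hC₁, hsup, hvb⟩ :=
    exists_static_supersolution hrpos hm₀ hm₁ hleft hright
  have hg0 : ∀ n, 0 < gam K q₀ n := gam_pos K q₀
  set M := max L R with hM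
  have hM0 : 0 < M := lt_max_of_lt_left hL
  refine ⟨fun n => v n / gam K q₀ (n + 1), min (1 / 2) (c / (8 * M)), c / 2, c₁ / C₀, C₁ / c₀,
    by positivity, (min_le_left _ _).trans_lt (by norm_num), by positivity, by linarith,
    by positivity, by positivity, fun n => ?_, fun q hq N n hn => ?_⟩
  · obtain ⟨-, ⟨h1, h2⟩, -⟩ := hrate q₀ hq₀1 n
    have h3 := hvb n
    rw [← wt_mul_growth K n] at h3
    have hw := wt_pos (K.β - 1) n
    constructor
    · rw [le_div_iff₀ (hg0 _)]
      calc c₁ / C₀ * wt (K.β - 1) n * gam K q₀ (n + 1)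
          ≤ c₁ / C₀ * wt (K.β - 1) n * (C₀ * growth K n) := by gcongr
        _ = c₁ * (wt (K.β - 1) n * growth K n) := by field_simp
        _ ≤ v n := h3.1
    · rw [div_le_iff₀ (hg0 _)]
      calc v n ≤ C₁ * (wt (K.β - 1) n * growth K n) := h3.2
        _ = C₁ / c₀ * wt (K.β - 1) n * (c₀ * growth K n) := by field_simp
        _ ≤ _ := by gcongr
  set η := min (1 / 2) (c / (8 * M)) with hη
  have hη0 : 0 < η := by positivity
  have hη1 : η ≤ 1 := (min_le_left _ _).trans (by norm_num)
  have hq1 : ∀ n, |q n| ≤ 1 := fun n => (hq n).trans hη1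
  have hMη : M * η ≤ c / 8 := by
    calc M * η ≤ M * (c / (8 * M)) := by gcongr; exact min_le_right _ _
      _ = c / 8 := by field_simp
  set e := Real.exp (M * η) with he
  have he0 : 0 < e := Real.exp_pos _
  have he1 : 1 ≤ e := Real.one_le_exp (by positivity)
  have hgam : ∀ q q' : ℤ → ℝ, (∀ n, |q n - q' n| ≤ η) → ∀ n, gam K q n ≤ e * gam K q' n := by
    intro q q' h n
    have h1 := (abs_le.1 (abs_log_gam_sub_le hγ q q' n n)).2
    have h2 : L * |(n + q n) - (n + q' n)| ≤ M * η := by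
      rw [add_sub_add_left_eq_sub]
      exact mul_le_mul (le_max_left _ _) (h n) (abs_nonneg _) hM0.le
    rw [← Real.exp_log (gam_pos K q n), ← Real.exp_log (gam_pos K q' n), he, ← Real.exp_add]
    exact Real.exp_le_exp.2 (by linarith)
  have hjump : ∀ q q' : ℤ → ℝ, (∀ n, |q n| ≤ 1) → (∀ n, |q' n| ≤ 1) → (∀ n, |q n - q' n| ≤ η) →
      ∀ n, jumpRatio K A q n ≤ e * jumpRatio K A q' n := by
    intro q q' h h' hd n
    refine (hr2 q q' h h' η hd n).trans ?_
    have := (jumpRatio_pos K A q' n).le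
    gcongr
    exact Real.exp_le_exp.2 (mul_le_mul_of_nonneg_right (le_max_right _ _) hη0.le)
  have hd1 : ∀ n, |q n - q₀ n| ≤ η := by simpa [hq₀] using hq
  have hd2 : ∀ n, |q₀ n - q n| ≤ η := by simpa [hq₀] using hq
  -- The choice of `η` gives `4 M η ≤ c/2`, hence `e^4 (1 - c/2) ≤ 1`; combine this with `1 - c ≤ (1
  -- - c/2)^2`.
  have hce : e ^ 4 * (1 - c) ≤ 1 - c / 2 := by
    have h1 : e ^ 4 = Real.exp (4 * (M * η)) := by rw [he, ← Real.exp_nat_mul]; norm_num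
    have h2 := Real.add_one_le_exp (-(4 * (M * η)))
    have h3 : e ^ 4 * Real.exp (-(4 * (M * η))) = 1 := by rw [h1, ← Real.exp_add]; simp
    have h4 : e ^ 4 * (1 - c / 2) ≤ 1 := by
      rw [← h3]; gcongr; linarith
    nlinarith [pow_pos he0 4]
  have hup : upRate K A N q n = jumpRatio K A q n * gam K q (n + 1) := if_pos hn
  have e1 : gam K q n * (v (n - 1) / gam K q₀ (n - 1 + 1)) ≤ e ^ 2 * v (n - 1) := by
    rw [sub_add_cancel, mul_div_assoc', div_le_iff₀ (hg0 n)]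
    have := hgam q q₀ hd1 n
    have h5 : e * (gam K q₀ n * v (n - 1)) ≤ e ^ 2 * (gam K q₀ n * v (n - 1)) :=
      mul_le_mul_of_nonneg_right (by nlinarith) (mul_pos (hg0 n) (hv _)).le
    nlinarith [hv (n - 1)]
  have e2 : upRate K A N q (n + 1) * (v (n + 1) / gam K q₀ (n + 1 + 1)) ≤
      e ^ 2 * (r (n + 1) * v (n + 1)) := by
    rw [mul_div_assoc', div_le_iff₀ (hg0 _)]
    have h1 := hgam q q₀ hd1 (n + 1 + 1)
    have h2 := hjump q q₀ hq1 hq₀1 hd1 (n + 1)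
    calc upRate K A N q (n + 1) * v (n + 1)
        ≤ (jumpRatio K A q (n + 1) * gam K q (n + 1 + 1)) * v (n + 1) :=
          mul_le_mul_of_nonneg_right (upRate_le _ _ _ _ _) (hv _).le
      _ ≤ ((e * r (n + 1)) * (e * gam K q₀ (n + 1 + 1))) * v (n + 1) := by
          refine mul_le_mul_of_nonneg_right ?_ (hv _).le
          exact mul_le_mul h2 h1 (gam_pos K q _).le (mul_pos he0 (hrpos _)).le
      _ = _ := by ring
  have e3 : (1 + r n) * v n ≤
      e ^ 2 * ((gam K q (n + 1) + upRate K A N q n) * (v n / gam K q₀ (n + 1))) := by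
    rw [hup, ← one_add_mul, mul_div_assoc', mul_div_assoc', le_div_iff₀ (hg0 _)]
    have h1 := hgam q₀ q hd2 (n + 1)
    have h2 := hjump q₀ q hq₀1 hq1 hd2 n
    have h3 : 1 + r n ≤ e * (1 + jumpRatio K A q n) := by
      rw [mul_add, mul_one]; exact add_le_add he1 h2
    calc (1 + r n) * v n * gam K q₀ (n + 1)
        = ((1 + r n) * gam K q₀ (n + 1)) * v n := by ring
      _ ≤ ((e * (1 + jumpRatio K A q n)) * (e * gam K q (n + 1))) * v n := by
          refine mul_le_mul_of_nonneg_right ?_ (hv _).le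
          exact mul_le_mul h3 h1 (hg0 _).le (mul_pos he0 (by
            linarith [jumpRatio_pos K A q n])).le
      _ = _ := by ring
  set X := (gam K q (n + 1) + upRate K A N q n) * (v n / gam K q₀ (n + 1)) with hX
  have hX0 : 0 ≤ X := mul_nonneg
    (add_nonneg (gam_pos K q _).le (upRate_nonneg _ _ _ _ _)) (div_pos (hv n) (hg0 _)).le
  simp only [neighbourPart]
  have h6 : e ^ 2 * (v (n - 1) + r (n + 1) * v (n + 1)) ≤ (1 - c / 2) * X := by
    calc e ^ 2 * (v (n - 1) + r (n + 1) * v (n + 1))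
        ≤ e ^ 2 * ((1 - c) * (e ^ 2 * X)) := by
          gcongr
          exact (hsup n).trans (mul_le_mul_of_nonneg_left e3 (by linarith))
      _ = e ^ 4 * (1 - c) * X := by ring
      _ ≤ _ := by gcongr
  have h7 : (1 - c / 2) * ((gam K q (n + 1) + upRate K A N q n) / 4 * (v n / gam K q₀ (n + 1))) =
      (1 - c / 2) * X / 4 := by rw [hX]; ring
  rw [h7]
  linarith

theorem exists_rate_bound_of_lt (K : Kernels) {A : ℝ} (hA : 0 < A) (N : ℤ) : ∃ R : ℝ, 0 < R ∧
    ∀ q : ℤ → ℝ, (∀ n, |q n| ≤ 1) → ∀ n ≤ N, gam K q n ≤ R ∧ gam K q (n + 1) ≤ R ∧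
      ∀ m, upRate K A N q m ≤ R := by
  obtain ⟨c₀, C₀, hc₀, hC₀, hrate⟩ := exists_rate_bounds K hA
  have hg1 := one_le_growth K N
  refine ⟨C₀ * growth K N, by positivity, fun q hq n hn => ?_⟩
  have hg : C₀ * growth K n ≤ C₀ * growth K N := by
    gcongr; exact growth_mono K (by exact_mod_cast hn)
  exact ⟨(hrate q hq n).1.2.trans hg, (hrate q hq n).2.1.2.trans hg, fun m =>
    (upRate_le _ _ _ _ _).trans ((hrate q hq m).2.2.trans (by nlinarith))⟩

/-- The barrier is `exp (-2ν(t - t₁)) φ`. The relative margin `c` and the lower bound `c₀` of the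
rates leave `c c₀ / 4 = 4ν` to spend: half on the decay, half on the strictness required by
`comparison`. -/
theorem exists_exponential_decay (K : Kernels) {A : ℝ} (hA : 0 < A) : ∃ η₀ ν C : ℝ,
    0 < η₀ ∧ η₀ < 1 ∧ 0 < ν ∧ 0 < C ∧ ∀ (N : ℤ) (p : ℝ → ℤ → ℝ),
      (∀ t, 0 < t → ∀ n, |p t n| ≤ η₀) → ∀ t₁, 0 ≤ t₁ → ∀ w : ℝ → ℤ → ℝ,
      IsDiffSolution K A N p t₁ w → ∀ K₀, 0 ≤ K₀ →
      (∀ n < N, |w t₁ n| ≤ K₀ * wt (K.β - 1) n) →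
      ∀ t, t₁ ≤ t → ∀ n < N,
        |w t n| ≤ C * K₀ * Real.exp (-(2 * ν) * (t - t₁)) * wt (K.β - 1) n := by
  obtain ⟨φ, η₀, c, c₁, C₁, hη₀, hη₀1, hc, hc1, hc₁, hC₁, hφ, hsup⟩ :=
    exists_perturbed_supersolution K hA
  obtain ⟨c₀, C₀, hc₀, hC₀, hrate⟩ := exists_rate_bounds K hA
  set ν := c * c₀ / 16 with hν
  have hν0 : 0 < ν := by positivity
  refine ⟨η₀, ν, max (2 * C₁ / c₁) 1, hη₀, hη₀1, hν0, by positivity,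
    fun N p hp t₁ ht₁ w hw K₀ hK₀ hinit t ht n hn => ?_⟩
  have hφpos : ∀ n, 0 < φ n := fun n =>
    lt_of_lt_of_le (mul_pos hc₁ (wt_pos _ _)) (hφ n).1
  rcases eq_or_lt_of_le ht with rfl | htt
  · rw [sub_self, mul_zero, Real.exp_zero, mul_one]
    refine (hinit n hn).trans (mul_le_mul_of_nonneg_right ?_ (wt_pos _ _).le)
    exact le_mul_of_one_le_left hK₀ (le_max_right _ _)
  have hwb : ∀ n, (2 : ℝ) ^ (-n) ≤ wt (K.β - 1) n := zpow_neg_le_wt (by linarith [K.hβ.2])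
  obtain ⟨B, hB⟩ := hw.bounded t
  obtain ⟨R, hR, hRb⟩ := exists_rate_bound_of_lt K hA N
  have hp1 : ∀ s ∈ Ioc t₁ t, ∀ n, |p s n| ≤ 1 := fun s hs n =>
    (hp s (ht₁.trans_lt hs.1) n).trans hη₀1.le
  -- The slack `δ` makes the initial inequality strict, so that it persists by continuity for short
  -- times; the factor 2 allows the barrier to drop to `φ / 2` there. Then `δ → 0`.
  have key : ∀ δ, 0 < δ → |w t n| ≤
      (2 * (K₀ + δ) / c₁) * (Real.exp (-(2 * ν) * (t - t₁)) * φ n) := by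
    intro δ hδ
    refine comparison (N := N) (t₀ := t₁) (T := t) (C := R) (δ := 2 * ν)
      (B := |B| * Real.exp (2 * ν * (t - t₁)) / c₁)
      (a := fun s => gam K (p s)) (b := fun s => upRate K A N (p s)) (w := w)
      (Φ := fun s n => Real.exp (-(2 * ν) * (s - t₁)) * φ n)
      (Φ' := fun s n => -(2 * ν) * (Real.exp (-(2 * ν) * (s - t₁)) * φ n))
      hR (by positivity) (by positivity) (fun s _ n => (gam_pos _ _ _).le)
      (fun s _ n => upRate_nonneg _ _ _ _ _) (fun s _ => by simp [upRate])
      (fun s hs m hm => hw.hasDerivAt s hs.1 m hm) (fun s hs m hm => ?_)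
      (fun s _ m => mul_pos (Real.exp_pos _) (hφpos m)) (fun s hs m hm => ?_)
      (fun s hs m hm => ?_) (fun s hs m hm => ?_) (fun m hm => ?_) t ⟨htt, le_rfl⟩ n hn
    · have := ((((hasDerivAt_id s).sub_const t₁).const_mul (-(2 * ν))).exp).mul_const (φ m)
      refine this.congr_deriv ?_
      simp only [id]; ring
    · have h1 := hsup (p s) (hp s (ht₁.trans_lt hs.1)) N m hm
      have h2 : neighbourPart (gam K (p s)) (upRate K A N (p s))
          (fun n => Real.exp (-(2 * ν) * (s - t₁)) * φ n) m =
          Real.exp (-(2 * ν) * (s - t₁)) *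
            neighbourPart (gam K (p s)) (upRate K A N (p s)) φ m := by
        simp only [neighbourPart]; ring
      have h3 : 2 * ν + 2 * ν ≤ c * ((gam K (p s) (m + 1) + upRate K A N (p s) m) / 4) := by
        have h4 := (hrate (p s) (hp1 s hs) m).2.1.1
        have h5 := one_le_growth K m
        have h6 := upRate_nonneg K A N (p s) m
        have h7 : c₀ ≤ gam K (p s) (m + 1) + upRate K A N (p s) m := by nlinarith
        rw [hν]; nlinarith
      have h8 := mul_le_mul_of_nonneg_right h3 (hφpos m).le
      have h9 : neighbourPart (gam K (p s)) (upRate K A N (p s)) φ m + 2 * ν * φ m ≤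
          -(2 * ν) * φ m + (gam K (p s) (m + 1) + upRate K A N (p s) m) / 4 * φ m := by
        linarith
      have h10 := mul_le_mul_of_nonneg_left h9 (Real.exp_pos (-(2 * ν) * (s - t₁))).le
      rw [h2]
      linarith
    · have h1 := hsup (p s) (hp s (ht₁.trans_lt hs.1)) N m hm
      have h2 : neighbourPart (gam K (p s)) (upRate K A N (p s))
          (fun n => Real.exp (-(2 * ν) * (s - t₁)) * φ n) m =
          Real.exp (-(2 * ν) * (s - t₁)) *
            neighbourPart (gam K (p s)) (upRate K A N (p s)) φ m := by
        simp only [neighbourPart]; ring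
      obtain ⟨-, h3, h4⟩ := hRb (p s) (hp1 s hs) m hm.le
      have h5 := h4 m
      have h6 := gam_pos K (p s) (m + 1)
      have h7 := upRate_nonneg K A N (p s) m
      have h8 : (1 - c) * ((gam K (p s) (m + 1) + upRate K A N (p s) m) / 4) ≤ R := by
        nlinarith
      have h9 := mul_le_mul_of_nonneg_right h8 (hφpos m).le
      have h10 : neighbourPart (gam K (p s)) (upRate K A N (p s)) φ m ≤ R * φ m := by linarith
      rw [h2, mul_left_comm]
      exact mul_le_mul_of_nonneg_left h10 (Real.exp_pos _).le
    · have h1 := hB s ⟨hs.1.le, hs.2⟩ m hm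
      have h2 : 1 ≤ Real.exp (2 * ν * (t - t₁)) * Real.exp (-(2 * ν) * (s - t₁)) := by
        rw [← Real.exp_add]
        exact Real.one_le_exp (by nlinarith [hs.2])
      calc |w s m| ≤ |B| * wt (K.β - 1) m :=
            h1.trans (mul_le_mul (le_abs_self B) (hwb m) (by positivity) (abs_nonneg _))
        _ = |B| / c₁ * (1 * (c₁ * wt (K.β - 1) m)) := by field_simp
        _ ≤ |B| / c₁ * ((Real.exp (2 * ν * (t - t₁)) * Real.exp (-(2 * ν) * (s - t₁))) * φ m) := by
            have := wt_pos (K.β - 1) m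
            gcongr
            exact (hφ m).1
        _ = _ := by ring
    · refine eventually_abs_le_of_continuousOn (l := φ m / 2) (hw.continuousOn m hm)
        (half_pos (hφpos m)) ?_ ?_
      · have h1 := hinit m hm
        have h2 := (hφ m).1
        have h3 := wt_pos (K.β - 1) m
        calc |w t₁ m| < (K₀ + δ) * wt (K.β - 1) m := by nlinarith
          _ = (K₀ + δ) / c₁ * (c₁ * wt (K.β - 1) m) := by field_simp
          _ ≤ (K₀ + δ) / c₁ * φ m := by gcongr
          _ = _ := by ring
      · have h1 : Tendsto (fun s => Real.exp (-(2 * ν) * (s - t₁)) * φ m) (𝓝[>] t₁)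
            (𝓝 (Real.exp (-(2 * ν) * (t₁ - t₁)) * φ m)) :=
          ((by fun_prop : Continuous fun s => Real.exp (-(2 * ν) * (s - t₁)) * φ m).tendsto
            t₁).mono_left nhdsWithin_le_nhds
        simp only [sub_self, mul_zero, Real.exp_zero, one_mul] at h1
        exact (h1.eventually_const_lt (half_lt_self (hφpos m))).mono fun _ h => h.le
  have hlim : Tendsto (fun δ : ℝ => (2 * (K₀ + δ) / c₁) *
      (Real.exp (-(2 * ν) * (t - t₁)) * φ n)) (𝓝[>] 0)
      (𝓝 ((2 * (K₀ + 0) / c₁) * (Real.exp (-(2 * ν) * (t - t₁)) * φ n))) :=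
    ((by fun_prop : Continuous fun δ : ℝ => (2 * (K₀ + δ) / c₁) *
      (Real.exp (-(2 * ν) * (t - t₁)) * φ n)).tendsto 0).mono_left nhdsWithin_le_nhds
  have h1 := ge_of_tendsto hlim (eventually_nhdsWithin_of_forall key)
  have hw0 := wt_pos (K.β - 1) n
  calc |w t n| ≤ (2 * (K₀ + 0) / c₁) * (Real.exp (-(2 * ν) * (t - t₁)) * φ n) := h1
    _ ≤ (2 * (K₀ + 0) / c₁) * (Real.exp (-(2 * ν) * (t - t₁)) * (C₁ * wt (K.β - 1) n)) := by
        have := (hφ n).2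
        rw [add_zero]
        gcongr
    _ = 2 * C₁ / c₁ * K₀ * Real.exp (-(2 * ν) * (t - t₁)) * wt (K.β - 1) n := by ring
    _ ≤ _ := by gcongr; exact le_max_left _ _

/-! ### The self-similar smoothing profile -/

/-- The profile `(1+s)^{-a} exp(-B/(1+s^κ))`. -/
noncomputable def smoothingProfile (a κ B s : ℝ) : ℝ :=
  (1 + s) ^ (-a) * Real.exp (-(B / (1 + s ^ κ)))

/-- The logarithmic derivative of `smoothingProfile`. -/
noncomputable def smoothingLogDeriv (a κ B s : ℝ) : ℝ :=
  -a / (1 + s) + B * κ * s ^ (κ - 1) / (1 + s ^ κ) ^ 2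

theorem hasDerivAt_smoothingProfile {a κ B s : ℝ} (hs : 0 < s) :
    HasDerivAt (smoothingProfile a κ B)
      (smoothingProfile a κ B s * smoothingLogDeriv a κ B s) s := by
  have h1 : (0 : ℝ) < 1 + s := by linarith
  have hx : 0 < s ^ κ := by positivity
  have d1 : HasDerivAt (fun s : ℝ => (1 + s) ^ (-a)) (1 * -a * (1 + s) ^ (-a - 1)) s :=
    ((hasDerivAt_id s).const_add 1).rpow_const (Or.inl h1.ne')
  have d2 : HasDerivAt (fun s : ℝ => 1 + s ^ κ) (1 * κ * s ^ (κ - 1)) s :=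
    ((hasDerivAt_id s).rpow_const (Or.inl hs.ne')).const_add 1
  have d3 := ((((hasDerivAt_const s B).div d2 (by positivity)).neg).exp)
  refine (d1.mul d3).congr_deriv ?_
  simp only [smoothingProfile, smoothingLogDeriv, Pi.div_apply, Pi.neg_apply]
  rw [Real.rpow_sub_one h1.ne']
  field_simp
  ring

theorem smoothingProfile_pos {a κ B s : ℝ} (hs : 0 ≤ s) : 0 < smoothingProfile a κ B s := by
  unfold smoothingProfile; positivity

theorem smoothingProfile_le {a κ B s : ℝ} (hB : 0 ≤ B) (hs : 0 ≤ s) :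
    smoothingProfile a κ B s ≤ (1 + s) ^ (-a) :=
  mul_le_of_le_one_right (by positivity) (Real.exp_le_one_iff.2 (by
    have : 0 ≤ B / (1 + s ^ κ) := by positivity
    linarith))

theorem le_smoothingProfile {a κ B s : ℝ} (hB : 0 ≤ B) (hs : 0 ≤ s) :
    Real.exp (-B) * (1 + s) ^ (-a) ≤ smoothingProfile a κ B s := by
  rw [mul_comm]
  unfold smoothingProfile
  gcongr
  exact div_le_self hB (by have : 0 ≤ s ^ κ := by positivity
                           linarith)

/-- The polynomial factor alone satisfies the dilation inequality, as `(2^β + s)^(-a) ≤ (1+s)^(-a)`.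
The exponential factor must beat `s^(-ρ)` in two regimes. For large `s` the dilation gains `1 - exp
(-d)` of order `s^(-κ)`, which wins because `κ < ρ`. For small `s` the logarithmic derivative is of
order `B s^(κ-1)`, which wins because `κ < 1 - ρ` and `B` is large. The order of choice is `κ`, then
the threshold `s₀`, then `B`; the regime of large `s` uses only `B ≥ 1`. -/
theorem exists_smoothingProfile_params {a ρ β g D : ℝ} (ha : 0 < a) (hρ : 0 < ρ) (hρ1 : ρ < 1)
    (hβ : 0 < β) (hg : 0 < g) (hD : 0 ≤ D) : ∃ κ B : ℝ, 0 < κ ∧ 0 < B ∧ ∀ s, 0 < s →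
      (2 : ℝ) ^ (-(β * a)) * smoothingProfile a κ B ((2 : ℝ) ^ (-β) * s) ≤
          smoothingProfile a κ B s ∧
      D * s ^ (-ρ) * smoothingProfile a κ B s ≤
        g * (smoothingProfile a κ B s -
          (2 : ℝ) ^ (-(β * a)) * smoothingProfile a κ B ((2 : ℝ) ^ (-β) * s)) +
        smoothingProfile a κ B s * smoothingLogDeriv a κ B s := by
  obtain ⟨κ, hκ, hκρ, hκ1⟩ : ∃ κ : ℝ, 0 < κ ∧ κ < ρ ∧ κ < 1 - ρ := by
    have : 0 < min ρ (1 - ρ) := lt_min hρ (by linarith)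
    exact ⟨min ρ (1 - ρ) / 2, by linarith, by linarith [min_le_left ρ (1 - ρ)],
      by linarith [min_le_right ρ (1 - ρ)]⟩
  set b : ℝ := (2 : ℝ) ^ (-(β * κ)) with hb
  have hb0 : 0 < b := by positivity
  have hb1 : b < 1 := Real.rpow_lt_one_of_one_lt_of_neg (by norm_num) (by
    have := mul_pos hβ hκ; linarith)
  have hlarge : ∃ s₀ : ℝ, 1 ≤ s₀ ∧ ∀ s, s₀ ≤ s → (D + a) * 8 / (g * (1 - b)) ≤ s ^ (ρ - κ) := by
    obtain ⟨s₁, hs₁⟩ := eventually_atTop.1 ((tendsto_rpow_atTop (sub_pos.2 hκρ)).eventually_ge_atTop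
      ((D + a) * 8 / (g * (1 - b))))
    exact ⟨max 1 s₁, le_max_left _ _, fun s hs => hs₁ s ((le_max_right _ _).trans hs)⟩
  obtain ⟨s₀, hs₀, hs₀l⟩ := hlarge
  have hs₀0 : 0 < s₀ := by linarith
  set z := s₀ ^ (κ - 1 + ρ) with hz
  have hz0 : 0 < z := by positivity
  set B := max 1 ((D + a * s₀ ^ ρ) * (1 + s₀ ^ κ) ^ 2 / (κ * z)) with hB
  have hB1 : 1 ≤ B := le_max_left _ _
  refine ⟨κ, B, hκ, by linarith, fun s hs => ?_⟩
  set x := s ^ κ with hx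
  have hx0 : 0 < x := by positivity
  set H := smoothingProfile a κ B s with hH
  have hH0 : 0 < H := smoothingProfile_pos hs.le
  set d := B / (1 + b * x) - B / (1 + x) with hd
  have hdeq : d = B * ((1 - b) * x / ((1 + b * x) * (1 + x))) := by
    rw [hd]; field_simp; ring
  have hd0 : 0 ≤ d := by
    rw [hdeq]
    have : 0 < 1 - b := by linarith
    positivity
  have hshift : (2 : ℝ) ^ (-(β * a)) * smoothingProfile a κ B ((2 : ℝ) ^ (-β) * s) ≤
      H * Real.exp (-d) := by
    have e1 : ((2 : ℝ) ^ (-β) * s) ^ κ = b * x := by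
      rw [Real.mul_rpow (by positivity) hs.le, ← Real.rpow_mul (by norm_num), neg_mul]
    have e2 : (2 : ℝ) ^ (-(β * a)) * (1 + (2 : ℝ) ^ (-β) * s) ^ (-a) ≤ (1 + s) ^ (-a) := by
      have : (2 : ℝ) ^ (-(β * a)) = ((2 : ℝ) ^ β) ^ (-a) := by
        rw [← Real.rpow_mul (by norm_num)]; ring_nf
      rw [this, ← Real.mul_rpow (by positivity) (by positivity)]
      refine Real.rpow_le_rpow_of_nonpos (by positivity) ?_ (by linarith)
      have h1 : (2 : ℝ) ^ β * (2 : ℝ) ^ (-β) = 1 := by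
        rw [← Real.rpow_add (by norm_num)]; simp
      have h2 : (1 : ℝ) ≤ 2 ^ β := Real.one_le_rpow (by norm_num) hβ.le
      rw [mul_add, ← mul_assoc, h1]
      linarith
    rw [hH, smoothingProfile, smoothingProfile, e1, mul_assoc _ _ (Real.exp (-d)), ← Real.exp_add]
    have e3 : -(B / (1 + x)) + -d = -(B / (1 + b * x)) := by rw [hd]; ring
    rw [e3, ← mul_assoc]
    gcongr
  have hexp1 : Real.exp (-d) ≤ 1 := Real.exp_le_one_iff.2 (by linarith)
  refine ⟨hshift.trans (mul_le_of_le_one_right hH0.le hexp1), ?_⟩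
  suffices h : D * s ^ (-ρ) ≤ g * (1 - Real.exp (-d)) + smoothingLogDeriv a κ B s by
    have h1 := mul_le_mul_of_nonneg_left h hH0.le
    have h2 : g * (H - H * Real.exp (-d)) ≤ g * (H -
        (2 : ℝ) ^ (-(β * a)) * smoothingProfile a κ B ((2 : ℝ) ^ (-β) * s)) := by gcongr
    linarith
  have hsρ : 0 < s ^ (-ρ) := by positivity
  have hdiv : a / (1 + s) ≤ a * s ^ (-ρ) ∨ s < s₀ := by
    rcases lt_or_ge s s₀ with h | h
    · exact Or.inr h
    · left
      rw [div_eq_mul_inv]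
      gcongr
      rw [Real.rpow_neg hs.le]
      gcongr
      calc s ^ ρ ≤ s ^ (1 : ℝ) := Real.rpow_le_rpow_of_exponent_le (by linarith) hρ1.le
        _ ≤ 1 + s := by rw [Real.rpow_one]; linarith
  rw [smoothingLogDeriv, ← hx]
  rcases lt_or_ge s s₀ with hlt | hge
  · have h1 : z * s ^ (-ρ) ≤ s ^ (κ - 1) := by
      have : s ^ (κ - 1) = s ^ (κ - 1 + ρ) * s ^ (-ρ) := by
        rw [← Real.rpow_add hs]; ring_nf
      rw [this]
      gcongr
      exact Real.rpow_le_rpow_of_nonpos hs hlt.le (by linarith)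
    have h2 : x ≤ s₀ ^ κ := Real.rpow_le_rpow hs.le hlt.le hκ.le
    have h3 : 1 ≤ s₀ ^ ρ * s ^ (-ρ) := by
      rw [Real.rpow_neg hs.le, ← div_eq_mul_inv, one_le_div (by positivity)]
      exact Real.rpow_le_rpow hs.le hlt.le hρ.le
    have h4 : a / (1 + s) ≤ a * s₀ ^ ρ * s ^ (-ρ) := by
      calc a / (1 + s) ≤ a := div_le_self ha.le (by linarith)
        _ ≤ a * (s₀ ^ ρ * s ^ (-ρ)) := le_mul_of_one_le_right ha.le h3
        _ = _ := by ring
    have h5 : (D + a * s₀ ^ ρ) * s ^ (-ρ) ≤ B * κ * s ^ (κ - 1) / (1 + x) ^ 2 := by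
      rw [le_div_iff₀ (by positivity)]
      calc (D + a * s₀ ^ ρ) * s ^ (-ρ) * (1 + x) ^ 2
          ≤ (D + a * s₀ ^ ρ) * s ^ (-ρ) * (1 + s₀ ^ κ) ^ 2 := by gcongr
        _ = (D + a * s₀ ^ ρ) * (1 + s₀ ^ κ) ^ 2 / (κ * z) * κ * (z * s ^ (-ρ)) := by field_simp
        _ ≤ B * κ * s ^ (κ - 1) := by
          gcongr
          exact le_max_right _ _
    have h6 : 0 ≤ g * (1 - Real.exp (-d)) := mul_nonneg hg.le (by linarith)
    have h7 : -a / (1 + s) = -(a / (1 + s)) := neg_div _ _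
    rw [h7]
    linarith
  · have h1 : a / (1 + s) ≤ a * s ^ (-ρ) := hdiv.resolve_right (not_lt.2 hge)
    have hx1 : 1 ≤ x := Real.one_le_rpow (hs₀.trans hge) hκ.le
    -- A lower bound for `d`, from `(1 + b x)(1 + x) ≤ 4 x^2` when `x ≥ 1`. Since `u ≤ 1`, the gain
    -- `1 - exp (-u)` is at least `u / 2`.
    set u := (1 - b) / (4 * x) with hu
    have h1b : 0 < 1 - b := by linarith
    have hu0 : 0 < u := by positivity
    have hu1 : u ≤ 1 := by rw [hu, div_le_one (by positivity)]; nlinarith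
    have hud : u ≤ d := by
      rw [hdeq]
      calc u = (1 - b) * x / ((x + x) * (x + x)) := by rw [hu]; field_simp; norm_num
        _ ≤ (1 - b) * x / ((1 + b * x) * (1 + x)) := by
          gcongr
          · nlinarith
        _ ≤ _ := le_mul_of_one_le_left (by positivity) hB1
    have h2 : u / 2 ≤ 1 - Real.exp (-d) := by
      have e1 : Real.exp (-d) ≤ Real.exp (-u) := Real.exp_le_exp.2 (by linarith)
      have e2 := Real.add_one_le_exp u
      have e3 : Real.exp (-u) * Real.exp u = 1 := by rw [← Real.exp_add]; simp
      have e4 := Real.exp_pos (-u)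
      nlinarith
    have h3 : (D + a) * s ^ (-ρ) ≤ g * (u / 2) := by
      have e1 := hs₀l s hge
      rw [Real.rpow_sub hs, div_le_div_iff₀ (by positivity) (by positivity)] at e1
      rw [Real.rpow_neg hs.le, hu, ← div_eq_mul_inv, div_le_iff₀ (by positivity)]
      rw [← hx] at e1
      have : g * ((1 - b) / (4 * x) / 2) * s ^ ρ = s ^ ρ * (g * (1 - b)) / (8 * x) := by
        field_simp; norm_num
      rw [this, le_div_iff₀ (by positivity)]
      linarith
    have h4 : g * (u / 2) ≤ g * (1 - Real.exp (-d)) := by gcongr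
    have h5 : 0 ≤ B * κ * s ^ (κ - 1) / (1 + x) ^ 2 := by positivity
    have h7 : -a / (1 + s) = -(a / (1 + s)) := neg_div _ _
    rw [h7]
    linarith

/-! ### Smoothing on unit time intervals -/

/-- The smoothing factor `(1 + 2^{βn} τ)^{-a}` at the sites `n > 0`. -/
noncomputable def smoothingFactor (K : Kernels) (a τ : ℝ) (n : ℤ) : ℝ :=
  if n ≤ 0 then 1 else (1 + (2 : ℝ) ^ (K.β * n) * τ) ^ (-a)

/-- The supersolution used for smoothing, up to an exponential factor; `q` is the shift at the
given time and `τ` is the elapsed time. -/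
noncomputable def smoothingWeight (K : Kernels) (θ a κ B : ℝ) (q : ℤ → ℝ) (τ : ℝ) (n : ℤ) : ℝ :=
  if n ≤ 0 then (2 : ℝ) ^ (-n) else (2 : ℝ) ^ ((K.β - θ) * n) *
    smoothingProfile a κ B ((2 : ℝ) ^ (K.β * n) * τ) / gam K q (n + 1)

theorem smoothingFactor_pos (K : Kernels) (a : ℝ) {τ : ℝ} (hτ : 0 ≤ τ) (n : ℤ) :
    0 < smoothingFactor K a τ n := by
  unfold smoothingFactor; split_ifs <;> positivity

theorem smoothingFactor_succ_le (K : Kernels) {a τ : ℝ} (ha : 0 ≤ a) (hτ : 0 ≤ τ) (n : ℤ) :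
    smoothingFactor K a τ (n + 1) ≤ smoothingFactor K a τ n := by
  have hβ := K.hβ.1
  unfold smoothingFactor
  split_ifs with h h' h'
  · exact le_rfl
  · omega
  · refine Real.rpow_le_one_of_one_le_of_nonpos ?_ (by linarith)
    have : 0 ≤ (2 : ℝ) ^ (K.β * ((n + 1 : ℤ) : ℝ)) * τ := by positivity
    linarith
  · refine Real.rpow_le_rpow_of_nonpos (by positivity) ?_ (by linarith)
    have : (2 : ℝ) ^ (K.β * (n : ℝ)) ≤ (2 : ℝ) ^ (K.β * ((n + 1 : ℤ) : ℝ)) :=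
      Real.rpow_le_rpow_of_exponent_le (by norm_num) (by push_cast; nlinarith)
    gcongr

/-- With `s = 2^(βn) τ`, the full power of `1 + s` is below the weaker power `s^(-(θ'-θ)/β)`, which
splits into a weight gain and a power of `τ`. One barrier thus serves every `θ'`. -/
theorem wt_mul_smoothingFactor_le (K : Kernels) {θ θ' τ : ℝ} (hθ : θ ≤ θ') (hθ' : θ' ≤ K.β)
    (hτ : 0 < τ) (hτ1 : τ ≤ 1) (n : ℤ) :
    wt θ n * smoothingFactor K ((K.β - θ) / K.β) τ n ≤ τ ^ (-((θ' - θ) / K.β)) * wt θ' n := by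
  have hβ : 0 < K.β := by linarith [K.hβ.1]
  have ha' : 0 ≤ (θ' - θ) / K.β := div_nonneg (by linarith) hβ.le
  unfold wt smoothingFactor
  split_ifs with h
  · rw [mul_one]
    exact le_mul_of_one_le_left (by positivity)
      (Real.one_le_rpow_of_pos_of_le_one_of_nonpos hτ hτ1 (by linarith))
  · set s := (2 : ℝ) ^ (K.β * n) * τ with hs
    have hs0 : 0 < s := by positivity
    have h1 : (1 + s) ^ (-((K.β - θ) / K.β)) ≤ s ^ (-((θ' - θ) / K.β)) := by
      calc (1 + s) ^ (-((K.β - θ) / K.β)) ≤ (1 + s) ^ (-((θ' - θ) / K.β)) :=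
            Real.rpow_le_rpow_of_exponent_le (by linarith) (by gcongr)
        _ ≤ s ^ (-((θ' - θ) / K.β)) :=
            Real.rpow_le_rpow_of_nonpos hs0 (by linarith) (by linarith)
    have h2 : s ^ (-((θ' - θ) / K.β)) = (2 : ℝ) ^ (-((θ' - θ) * n)) * τ ^ (-((θ' - θ) / K.β)) := by
      rw [hs, Real.mul_rpow (by positivity) hτ.le, ← Real.rpow_mul (by norm_num)]
      congr 2
      field_simp
    calc (2 : ℝ) ^ (-(θ * n)) * (1 + s) ^ (-((K.β - θ) / K.β))
        ≤ (2 : ℝ) ^ (-(θ * n)) * ((2 : ℝ) ^ (-((θ' - θ) * n)) * τ ^ (-((θ' - θ) / K.β))) := by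
          rw [← h2]; gcongr
      _ = τ ^ (-((θ' - θ) / K.β)) * ((2 : ℝ) ^ (-(θ * n)) * (2 : ℝ) ^ (-((θ' - θ) * n))) := by ring
      _ = _ := by
        rw [← Real.rpow_add (by norm_num)]
        ring_nf

theorem smoothingWeight_bounds {K : Kernels} {c C : ℝ} (hc : 0 < c) (hC : 0 < C)
    {q : ℤ → ℝ} (hg : ∀ n : ℤ, c * growth K n ≤ gam K q (n + 1) ∧ gam K q (n + 1) ≤ C * growth K n)
    (θ a κ : ℝ) {B τ : ℝ} (hB : 0 ≤ B) (hτ : 0 ≤ τ) (n : ℤ) :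
    min 1 (Real.exp (-B) / C) * (wt θ n * smoothingFactor K a τ n) ≤
        smoothingWeight K θ a κ B q τ n ∧
      smoothingWeight K θ a κ B q τ n ≤ max 1 (1 / c) * (wt θ n * smoothingFactor K a τ n) := by
  unfold wt smoothingFactor smoothingWeight
  split_ifs with h
  · have hp : (0 : ℝ) < 2 ^ (-n) := by positivity
    rw [mul_one]
    exact ⟨mul_le_of_le_one_left hp.le (min_le_left _ _),
      le_mul_of_one_le_left hp.le (le_max_left _ _)⟩
  · have hg' := hg n
    have hn : (0 : ℝ) ≤ n := by exact_mod_cast (not_le.1 h).le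
    rw [growth_of_nonneg K hn] at hg'
    set s := (2 : ℝ) ^ (K.β * n) * τ with hs
    have hs0 : 0 ≤ s := by positivity
    have hE : (2 : ℝ) ^ ((K.β - θ) * n) = (2 : ℝ) ^ (-(θ * n)) * (2 : ℝ) ^ (K.β * n) := by
      rw [← Real.rpow_add (by norm_num)]; ring_nf
    set E := (2 : ℝ) ^ (K.β * n) with hEdef
    set W := (2 : ℝ) ^ (-(θ * n)) with hW
    have hE0 : 0 < E := by positivity
    have hW0 : 0 < W := by positivity
    have hgp := gam_pos K q (n + 1)
    have h1 := smoothingProfile_le (a := a) (κ := κ) hB hs0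
    have h2 := le_smoothingProfile (a := a) (κ := κ) hB hs0
    have hp0 := smoothingProfile_pos (a := a) (κ := κ) (B := B) hs0
    have hP : 0 < (1 + s) ^ (-a) := by positivity
    rw [hE]
    constructor
    · rw [le_div_iff₀ hgp]
      calc min 1 (Real.exp (-B) / C) * (W * (1 + s) ^ (-a)) * gam K q (n + 1)
          ≤ Real.exp (-B) / C * (W * (1 + s) ^ (-a)) * (C * E) := by
            gcongr
            · exact min_le_right _ _
            · exact hg'.2
        _ = W * E * (Real.exp (-B) * (1 + s) ^ (-a)) := by field_simp
        _ ≤ _ := by gcongr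
    · rw [div_le_iff₀ hgp]
      calc W * E * smoothingProfile a κ B s ≤ W * E * (1 + s) ^ (-a) := by gcongr
        _ = 1 / c * (W * (1 + s) ^ (-a)) * (c * E) := by field_simp
        _ ≤ _ := by
          gcongr
          · exact le_max_right _ _
          · exact hg'.1

/-- The denominator of the weight at `n - 1` cancels the rate at `n`, and passing to the preceding
site dilates the self-similar variable by `2^(-β)`. The condition `n ≥ 2` keeps `n - 1` in the
self-similar range. -/
theorem gam_mul_smoothingWeight_pred (K : Kernels) (θ κ B : ℝ) (q : ℤ → ℝ) (τ : ℝ) {n : ℤ}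
    (hn : 2 ≤ n) :
    gam K q n * smoothingWeight K θ ((K.β - θ) / K.β) κ B q τ (n - 1) =
      (2 : ℝ) ^ ((K.β - θ) * n) * ((2 : ℝ) ^ (-(K.β * ((K.β - θ) / K.β))) *
        smoothingProfile ((K.β - θ) / K.β) κ B
          ((2 : ℝ) ^ (-K.β) * ((2 : ℝ) ^ (K.β * n) * τ))) := by
  have hβ : 0 < K.β := by linarith [K.hβ.1]
  have hβa : K.β * ((K.β - θ) / K.β) = K.β - θ := by field_simp
  have e1 : (2 : ℝ) ^ ((K.β - θ) * ((n - 1 : ℤ) : ℝ)) =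
      (2 : ℝ) ^ ((K.β - θ) * (n : ℝ)) * (2 : ℝ) ^ (-(K.β - θ)) := by
    rw [← Real.rpow_add (by norm_num)]; push_cast; ring_nf
  have e2 : (2 : ℝ) ^ (K.β * ((n - 1 : ℤ) : ℝ)) * τ =
      (2 : ℝ) ^ (-K.β) * ((2 : ℝ) ^ (K.β * n) * τ) := by
    rw [← mul_assoc, ← Real.rpow_add (by norm_num)]; push_cast; ring_nf
  rw [smoothingWeight, if_neg (by omega), sub_add_cancel, mul_div_cancel₀ _ (gam_pos K q n).ne',
    e1, e2, hβa, mul_assoc]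

/-- With `E = 2^(βn)` and `s = E (t - t₁)`, the derivative of the shift contributes at most `D E
s^(-θ₁/β)` relative to the weight: the singularity in `t` is dominated by the one in `t - t₁ ≤ min t
1`. Dividing by `E` reduces the transport inequality to the one for the profile, with `g = c/4` from
`gam ≥ c E`. -/
theorem exists_smoothingWeight_deriv (K : Kernels) {θ κ B c L D θ₁ : ℝ} {p : ℝ → ℤ → ℝ}
    (hL : 0 ≤ L)
    (hγ : ∀ x : ℝ, ∃ d, HasDerivAt (fun x : ℝ => K.γ ((2 : ℝ) ^ x)) d x ∧
      |d| ≤ L * K.γ ((2 : ℝ) ^ x))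
    (hD : D = 2 * L * 2 ^ |θ₁ - K.β|) (hθ₁ : 0 < θ₁)
    (hparam : ∀ s, 0 < s →
      (2 : ℝ) ^ (-(K.β * ((K.β - θ) / K.β))) *
          smoothingProfile ((K.β - θ) / K.β) κ B ((2 : ℝ) ^ (-K.β) * s) ≤
          smoothingProfile ((K.β - θ) / K.β) κ B s ∧
      D * s ^ (-(θ₁ / K.β)) * smoothingProfile ((K.β - θ) / K.β) κ B s ≤
        c / 4 * (smoothingProfile ((K.β - θ) / K.β) κ B s -
          (2 : ℝ) ^ (-(K.β * ((K.β - θ) / K.β))) *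
            smoothingProfile ((K.β - θ) / K.β) κ B ((2 : ℝ) ^ (-K.β) * s)) +
        smoothingProfile ((K.β - θ) / K.β) κ B s * smoothingLogDeriv ((K.β - θ) / K.β) κ B s)
    {t₁ t : ℝ} (ht₁ : 0 ≤ t₁) (ht : t ∈ Ioc t₁ (t₁ + 1))
    (hg : ∀ n : ℤ, c * growth K n ≤ gam K (p t) (n + 1))
    (hpd : ∀ n, DifferentiableAt ℝ (fun s => p s n) t ∧
      |deriv (fun s => p s n) t| ≤ (1 + t ^ (-(θ₁ / K.β))) * wt (θ₁ - K.β) n) (n : ℤ) :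
    ∃ d, HasDerivAt (fun s => smoothingWeight K θ ((K.β - θ) / K.β) κ B (p s) (s - t₁) n) d t ∧
      0 ≤ d + gam K (p t) (n + 1) / 4 *
        smoothingWeight K θ ((K.β - θ) / K.β) κ B (p t) (t - t₁) n ∧
      (2 ≤ n → gam K (p t) n / 4 *
          smoothingWeight K θ ((K.β - θ) / K.β) κ B (p t) (t - t₁) (n - 1) ≤
        d + gam K (p t) (n + 1) / 4 *
          smoothingWeight K θ ((K.β - θ) / K.β) κ B (p t) (t - t₁) n) := by
  have hβ : 0 < K.β := by linarith [K.hβ.1]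
  set a := (K.β - θ) / K.β with ha
  have hβa : K.β * a = K.β - θ := by rw [ha]; field_simp
  have hτ : 0 < t - t₁ := sub_pos.2 ht.1
  have hgp := gam_pos K (p t) (n + 1)
  rcases le_or_gt n 0 with h | h
  · refine ⟨0, ?_, ?_, fun h2 => by omega⟩
    · simp only [smoothingWeight, if_pos h]
      exact hasDerivAt_const _ _
    · simp only [smoothingWeight, if_pos h]
      positivity
  have hn0 : ¬ n ≤ 0 := not_le.2 h
  have hnr : (0 : ℝ) ≤ n := by exact_mod_cast h.le
  set E := (2 : ℝ) ^ (K.β * n) with hE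
  have hE0 : 0 < E := by positivity
  set F := (2 : ℝ) ^ ((K.β - θ) * n) with hF
  have hF0 : 0 < F := by positivity
  set s := E * (t - t₁) with hs
  have hs0 : 0 < s := by positivity
  set H := smoothingProfile a κ B s with hH
  have hH0 : 0 < H := smoothingProfile_pos hs0.le
  set G := gam K (p t) (n + 1) with hG
  obtain ⟨dγ, hdγ, hdγL⟩ := hγ (((n + 1 : ℤ) : ℝ) + p t (n + 1))
  obtain ⟨hpdiff, hpb⟩ := hpd (n + 1)
  have hGd : HasDerivAt (fun s => gam K (p s) (n + 1))
      (dγ * deriv (fun s => p s (n + 1)) t) t :=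
    HasDerivAt.comp (h₂ := fun x : ℝ => K.γ ((2 : ℝ) ^ x)) t hdγ (hpdiff.hasDerivAt.const_add _)
  have hHd : HasDerivAt (fun r => smoothingProfile a κ B (E * (r - t₁)))
      (H * smoothingLogDeriv a κ B s * (E * 1)) t :=
    HasDerivAt.comp (h₂ := smoothingProfile a κ B) t (hasDerivAt_smoothingProfile hs0)
      (((hasDerivAt_id' t).sub_const t₁).const_mul E)
  set P := dγ * deriv (fun s => p s (n + 1)) t with hP
  have hPb : |P| ≤ D * E * s ^ (-(θ₁ / K.β)) * G := by
    have h1 : wt (θ₁ - K.β) (n + 1) ≤ 2 ^ |θ₁ - K.β| * (2 : ℝ) ^ (-((θ₁ - K.β) * n)) := by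
      have := wt_succ_le (θ₁ - K.β) n
      rwa [wt, wt, if_neg hn0] at this
    have h2 : t ^ (-(θ₁ / K.β)) ≤ (t - t₁) ^ (-(θ₁ / K.β)) :=
      Real.rpow_le_rpow_of_nonpos hτ (by linarith) (by
        have : 0 < θ₁ / K.β := by positivity
        linarith)
    have h3 : 1 ≤ (t - t₁) ^ (-(θ₁ / K.β)) :=
      Real.one_le_rpow_of_pos_of_le_one_of_nonpos hτ (by linarith [ht.2]) (by
        have : 0 < θ₁ / K.β := by positivity
        linarith)
    have h4 : s ^ (-(θ₁ / K.β)) = (2 : ℝ) ^ (-(θ₁ * n)) * (t - t₁) ^ (-(θ₁ / K.β)) := by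
      rw [hs, Real.mul_rpow hE0.le hτ.le, hE, ← Real.rpow_mul (by norm_num)]
      congr 2
      field_simp
    have h5 : (2 : ℝ) ^ (-((θ₁ - K.β) * n)) = E * (2 : ℝ) ^ (-(θ₁ * n)) := by
      rw [hE, ← Real.rpow_add (by norm_num)]; ring_nf
    have h6 : |dγ| ≤ L * G := hdγL
    rw [hP, abs_mul]
    calc |dγ| * |deriv (fun s => p s (n + 1)) t|
        ≤ (L * G) * ((1 + t ^ (-(θ₁ / K.β))) * wt (θ₁ - K.β) (n + 1)) := by gcongr
      _ ≤ (L * G) * ((2 * (t - t₁) ^ (-(θ₁ / K.β))) *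
            (2 ^ |θ₁ - K.β| * (2 : ℝ) ^ (-((θ₁ - K.β) * n)))) := by
          have := (wt_pos (θ₁ - K.β) (n + 1)).le
          gcongr
          linarith
      _ = _ := by rw [h4, h5, hD]; ring
  have hval : smoothingWeight K θ a κ B (p t) (t - t₁) n = F * H / G := by
    rw [smoothingWeight, if_neg hn0]
  have hderiv : HasDerivAt (fun s => smoothingWeight K θ a κ B (p s) (s - t₁) n)
      ((F * (H * smoothingLogDeriv a κ B s * (E * 1)) * G - F * H * P) / G ^ 2) t := by
    simp only [smoothingWeight, if_neg hn0]
    exact (hHd.const_mul F).div hGd hgp.ne'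
  set Q := (2 : ℝ) ^ (-(K.β * a)) * smoothingProfile a κ B ((2 : ℝ) ^ (-K.β) * s) with hQ
  obtain ⟨hk1, hk2⟩ := hparam s hs0
  have hGE : c * E ≤ G := by
    have := hg n
    rwa [growth_of_nonneg K hnr] at this
  have key : F * Q / 4 ≤ (F * (H * smoothingLogDeriv a κ B s * (E * 1)) * G - F * H * P) / G ^ 2 +
      G / 4 * (F * H / G) := by
    have e1 : (F * (H * smoothingLogDeriv a κ B s * (E * 1)) * G - F * H * P) / G ^ 2 +
        G / 4 * (F * H / G) =
        F / G * (E * (H * smoothingLogDeriv a κ B s) - H * (P / G) + G / 4 * H) := by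
      field_simp
    have e2 : F * Q / 4 = F / G * (G / 4 * Q) := by field_simp
    rw [e1, e2]
    refine mul_le_mul_of_nonneg_left ?_ (by positivity)
    have e3 : P / G ≤ D * E * s ^ (-(θ₁ / K.β)) := by
      rw [div_le_iff₀ hgp]; exact (le_abs_self P).trans hPb
    have e4 := mul_le_mul_of_nonneg_left e3 hH0.le
    have e5 := mul_le_mul_of_nonneg_left hk2 hE0.le
    have e6 := mul_le_mul_of_nonneg_right hGE (sub_nonneg.2 hk1)
    linarith
  have hQ0 : 0 < Q := mul_pos (by positivity) (smoothingProfile_pos (by positivity))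
  refine ⟨_, hderiv, ?_, fun h2 => ?_⟩
  · rw [hval]
    have : 0 ≤ F * Q / 4 := by positivity
    linarith
  · rw [hval]
    rw [div_mul_eq_mul_div, gam_mul_smoothingWeight_pred K θ κ B (p t) (t - t₁) h2]
    exact key

/-- Purely qualitative: it turns the a priori bound with weight `2^(-n)` into a multiple of the
barrier. That multiple, which depends on `N`, drops out in `comparison`. -/
theorem exists_lower_bound_smoothingFactor (K : Kernels) (θ : ℝ) {a : ℝ} (ha : 0 ≤ a) (N : ℤ) :
    ∃ d : ℝ, 0 < d ∧ ∀ τ, 0 ≤ τ → τ ≤ 1 → ∀ n < N,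
      d * (2 : ℝ) ^ (-n) ≤ wt θ n * smoothingFactor K a τ n := by
  have hβ := K.hβ.1
  refine ⟨(2 : ℝ) ^ (-(|1 - θ| * |(N : ℝ)|)) * (1 + (2 : ℝ) ^ (K.β * |(N : ℝ)|)) ^ (-a),
    by positivity, fun τ hτ hτ1 n hn => ?_⟩
  have h1 : (2 : ℝ) ^ (-(|1 - θ| * |(N : ℝ)|)) ≤ 1 :=
    Real.rpow_le_one_of_one_le_of_nonpos (by norm_num) (by
      have := mul_nonneg (abs_nonneg (1 - θ)) (abs_nonneg (N : ℝ)); linarith)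
  have h2 : (1 + (2 : ℝ) ^ (K.β * |(N : ℝ)|)) ^ (-a) ≤ 1 :=
    Real.rpow_le_one_of_one_le_of_nonpos (by
      have : (0 : ℝ) ≤ (2 : ℝ) ^ (K.β * |(N : ℝ)|) := by positivity
      linarith) (by linarith)
  unfold wt smoothingFactor
  split_ifs with h
  · rw [mul_one]
    exact mul_le_of_le_one_left (by positivity) (mul_le_one₀ h1 (by positivity) h2)
  · have hn0 : (0 : ℝ) ≤ n := by exact_mod_cast (not_le.1 h).le
    have hnN : (n : ℝ) ≤ |(N : ℝ)| := le_trans (by exact_mod_cast hn.le) (le_abs_self _)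
    have h3 : (2 : ℝ) ^ (-(|1 - θ| * |(N : ℝ)|)) * (2 : ℝ) ^ (-n) ≤ (2 : ℝ) ^ (-(θ * n)) := by
      rw [← Real.rpow_intCast, ← Real.rpow_add (by norm_num)]
      refine Real.rpow_le_rpow_of_exponent_le (by norm_num) ?_
      push_cast
      have e1 := mul_le_mul_of_nonneg_left hnN (abs_nonneg (1 - θ))
      have e2 := mul_le_mul_of_nonneg_right (neg_abs_le (1 - θ)) hn0
      linarith
    have h4 : (1 + (2 : ℝ) ^ (K.β * |(N : ℝ)|)) ^ (-a) ≤ (1 + (2 : ℝ) ^ (K.β * n) * τ) ^ (-a) := by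
      refine Real.rpow_le_rpow_of_nonpos (by positivity) ?_ (by linarith)
      have e1 : (2 : ℝ) ^ (K.β * n) ≤ (2 : ℝ) ^ (K.β * |(N : ℝ)|) :=
        Real.rpow_le_rpow_of_exponent_le (by norm_num) (by nlinarith)
      have e2 : (0 : ℝ) < (2 : ℝ) ^ (K.β * n) := by positivity
      nlinarith
    calc (2 : ℝ) ^ (-(|1 - θ| * |(N : ℝ)|)) * (1 + (2 : ℝ) ^ (K.β * |(N : ℝ)|)) ^ (-a) *
          (2 : ℝ) ^ (-n)
        = ((2 : ℝ) ^ (-(|1 - θ| * |(N : ℝ)|)) * (2 : ℝ) ^ (-n)) *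
          (1 + (2 : ℝ) ^ (K.β * |(N : ℝ)|)) ^ (-a) := by ring
      _ ≤ _ := mul_le_mul h3 h4 (by positivity) (by positivity)

theorem eventually_le_smoothingFactor (K : Kernels) {a : ℝ} (ha : 0 ≤ a) (t₁ : ℝ) (n : ℤ) :
    ∀ᶠ t in 𝓝[>] t₁, (2 : ℝ) ^ (-a) ≤ smoothingFactor K a (t - t₁) n := by
  unfold smoothingFactor
  split_ifs with h
  · exact Eventually.of_forall fun _ =>
      Real.rpow_le_one_of_one_le_of_nonpos (by norm_num) (by linarith)
  · have h1 : Tendsto (fun t => (2 : ℝ) ^ (K.β * n) * (t - t₁)) (𝓝[>] t₁)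
        (𝓝 ((2 : ℝ) ^ (K.β * n) * (t₁ - t₁))) :=
      ((by fun_prop : Continuous fun t => (2 : ℝ) ^ (K.β * n) * (t - t₁)).tendsto
        t₁).mono_left nhdsWithin_le_nhds
    rw [sub_self, mul_zero] at h1
    filter_upwards [h1.eventually_lt_const one_pos, self_mem_nhdsWithin] with t ht ht'
    have : 0 < t - t₁ := sub_pos.2 ht'
    exact Real.rpow_le_rpow_of_nonpos (by positivity) (by linarith) (by linarith)

set_option maxHeartbeats 1000000 in
-- The barrier is `exp (Λ τ) ψ`. For `n ≥ 2` the transport inequality for `ψ` controls the inflow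
-- from below; for `n ≤ 1` the rates are bounded and adjacent values of `ψ` comparable, at the cost
-- `C₃`. The upward rates are bounded, at the cost `C₄`. The factor `exp (Λ τ)` absorbs both costs,
-- the extra 1 in `Λ` being the strictness, and is harmless on a unit interval.
theorem exists_smoothing (K : Kernels) {A : ℝ} (hA : 0 < A) {θ₁ : ℝ} (hθ₁ : 0 < θ₁)
    (hθ₁β : θ₁ < K.β) {θ : ℝ} (hθ : θ < K.β) : ∃ C : ℝ, 0 < C ∧
      ∀ (N : ℤ) (p : ℝ → ℤ → ℝ), (∀ t, 0 < t → ∀ n, |p t n| ≤ 1) →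
      (∀ t, 0 < t → ∀ n, DifferentiableAt ℝ (fun s => p s n) t ∧
        |deriv (fun s => p s n) t| ≤ (1 + t ^ (-(θ₁ / K.β))) * wt (θ₁ - K.β) n) →
      ∀ t₁, 0 ≤ t₁ → ∀ w : ℝ → ℤ → ℝ, IsDiffSolution K A N p t₁ w → ∀ K₀, 0 ≤ K₀ →
      (∀ n < N, |w t₁ n| ≤ K₀ * wt θ n) →
      ∀ t ∈ Ioc t₁ (t₁ + 1), ∀ n < N,
        |w t n| ≤ C * K₀ * (wt θ n * smoothingFactor K ((K.β - θ) / K.β) (t - t₁) n) := by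
  have hβ : 0 < K.β := by linarith [K.hβ.1]
  obtain ⟨c₀, C₀, hc₀, hC₀, hrate⟩ := exists_rate_bounds K hA
  obtain ⟨L, -, -, hL, -, -, hγ, -⟩ := K.exists_γ_bound
  set a := (K.β - θ) / K.β with ha
  have ha0 : 0 < a := div_pos (by linarith) hβ
  set D := 2 * L * 2 ^ |θ₁ - K.β| with hD
  obtain ⟨κ, B, hκ, hB, hparam⟩ := exists_smoothingProfile_params (ρ := θ₁ / K.β) (β := K.β)
    (g := c₀ / 4) (D := D) ha0 (by positivity) (by rw [div_lt_one hβ]; exact hθ₁β) hβ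
    (by positivity) (by positivity)
  set m := min 1 (Real.exp (-B) / C₀) with hm
  have hm0 : 0 < m := by positivity
  set M := max 1 (1 / c₀) with hM
  have hM0 : 0 < M := by positivity
  -- Up to the factor `m`, a lower bound for `ψ` at site 1 over the unit interval, the factor being
  -- smallest at `τ = 1`. It controls `ψ 0 / ψ 1 = 1 / ψ 1` where the two branches of the weight
  -- meet.
  set S := wt θ 1 * smoothingFactor K a 1 1 with hS
  have hS0 : 0 < S := mul_pos (wt_pos _ _) (smoothingFactor_pos K a zero_le_one 1)
  set R₁ := C₀ * growth K 1 with hR₁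
  have hg1 := one_le_growth K 1
  have hR₁0 : 0 < R₁ := by positivity
  set C₃ := R₁ / 4 * (2 + 1 / (m * S)) with hC₃
  set C₄ := C₀ / 4 * (M * 2 ^ |θ| / m) with hC₄
  set Λ := C₃ + C₄ + 1 with hΛ
  refine ⟨2 ^ a / m * (Real.exp Λ * M), by positivity,
    fun N p hp hpd t₁ ht₁ w hw K₀ hK₀ hinit t ht n hn => ?_⟩
  set ψ : ℝ → ℤ → ℝ := fun s n => smoothingWeight K θ a κ B (p s) (s - t₁) n with hψ
  have hb : ∀ s ∈ Ioc t₁ (t₁ + 1), ∀ n,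
      m * (wt θ n * smoothingFactor K a (s - t₁) n) ≤ ψ s n ∧
      ψ s n ≤ M * (wt θ n * smoothingFactor K a (s - t₁) n) := fun s hs n =>
    smoothingWeight_bounds hc₀ hC₀
      (fun n => (hrate (p s) (hp s (ht₁.trans_lt hs.1)) n).2.1) θ a κ hB.le
      (sub_nonneg.2 hs.1.le) n
  have hσ0 : ∀ s ∈ Ioc t₁ (t₁ + 1), ∀ n, 0 < wt θ n * smoothingFactor K a (s - t₁) n :=
    fun s hs n => mul_pos (wt_pos _ _) (smoothingFactor_pos K a (sub_nonneg.2 hs.1.le) n)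
  have hψ0 : ∀ s ∈ Ioc t₁ (t₁ + 1), ∀ n, 0 < ψ s n := fun s hs n =>
    (mul_pos hm0 (hσ0 s hs n)).trans_le (hb s hs n).1
  have hsucc : ∀ s ∈ Ioc t₁ (t₁ + 1), ∀ n, ψ s (n + 1) ≤ M * 2 ^ |θ| / m * ψ s n := by
    intro s hs n
    have h1 := (hb s hs (n + 1)).2
    have h2 := (hb s hs n).1
    have h3 := wt_succ_le θ n
    have h4 := smoothingFactor_succ_le K ha0.le (sub_nonneg.2 hs.1.le) n
    have h5 := smoothingFactor_pos K a (sub_nonneg.2 hs.1.le) (n + 1)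
    have h6 := wt_pos θ n
    calc ψ s (n + 1) ≤ M * (wt θ (n + 1) * smoothingFactor K a (s - t₁) (n + 1)) := h1
      _ ≤ M * ((2 ^ |θ| * wt θ n) * smoothingFactor K a (s - t₁) n) := by gcongr
      _ = M * 2 ^ |θ| / m * (m * (wt θ n * smoothingFactor K a (s - t₁) n)) := by field_simp
      _ ≤ _ := by gcongr
  have hpred : ∀ s ∈ Ioc t₁ (t₁ + 1), ∀ n ≤ 1, ψ s (n - 1) ≤ (2 + 1 / (m * S)) * ψ s n := by
    intro s hs n hn
    have hp0 := hψ0 s hs n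
    have hmS : 0 < 1 / (m * S) := by positivity
    rcases le_or_gt n 0 with h | h
    · have e1 : ψ s (n - 1) = 2 * ψ s n := by
        simp only [hψ, smoothingWeight, if_pos h, if_pos (show n - 1 ≤ 0 by omega)]
        rw [show -(n - 1) = 1 + -n by ring, zpow_add₀ two_ne_zero, zpow_one]
      rw [e1]
      nlinarith
    · obtain rfl : n = 1 := by omega
      have e1 : ψ s (1 - 1) = 1 := by simp [hψ, smoothingWeight]
      have e2 : smoothingFactor K a 1 1 ≤ smoothingFactor K a (s - t₁) 1 := by
        simp only [smoothingFactor, if_neg (show ¬ (1 : ℤ) ≤ 0 by norm_num)]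
        have : 0 < s - t₁ := sub_pos.2 hs.1
        refine Real.rpow_le_rpow_of_nonpos (by positivity) ?_ (by linarith)
        have : s - t₁ ≤ 1 := by linarith [hs.2]
        gcongr
      have e3 : m * S ≤ ψ s 1 := by
        refine le_trans ?_ (hb s hs 1).1
        have := wt_pos θ 1
        rw [hS]; gcongr
      rw [e1]
      have e4 : 1 ≤ 1 / (m * S) * ψ s 1 := by
        rw [one_div_mul_eq_div, one_le_div (by positivity)]; exact e3
      linarith
  have hp1 : ∀ s ∈ Ioc t₁ (t₁ + 1), ∀ n, |p s n| ≤ 1 := fun s hs => hp s (ht₁.trans_lt hs.1)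
  have hsub : ∀ s ∈ Ioc t₁ t, s ∈ Ioc t₁ (t₁ + 1) := fun s hs => ⟨hs.1, hs.2.trans ht.2⟩
  have hderiv : ∀ s ∈ Ioc t₁ (t₁ + 1), ∀ n, ∃ d, HasDerivAt (fun s => ψ s n) d s ∧
      0 ≤ d + gam K (p s) (n + 1) / 4 * ψ s n ∧
      (2 ≤ n → gam K (p s) n / 4 * ψ s (n - 1) ≤ d + gam K (p s) (n + 1) / 4 * ψ s n) :=
    fun s hs n => exists_smoothingWeight_deriv K hL.le hγ hD hθ₁ hparam ht₁ hs
      (fun n => (hrate (p s) (hp1 s hs) n).2.1.1) (hpd s (ht₁.trans_lt hs.1)) n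
  choose! d hd hd0 hd2 using hderiv
  have hdown : ∀ s ∈ Ioc t₁ (t₁ + 1), ∀ n, gam K (p s) n / 4 * ψ s (n - 1) ≤
      C₃ * ψ s n + (d s n + gam K (p s) (n + 1) / 4 * ψ s n) := by
    intro s hs n
    have hC₃0 : 0 < C₃ := by positivity
    rcases le_or_gt 2 n with h | h
    · have := hd2 s hs n h
      have := mul_pos hC₃0 (hψ0 s hs n)
      linarith
    · have h1 := hpred s hs n (by omega)
      have h2 : gam K (p s) n ≤ R₁ := by
        refine (hrate (p s) (hp1 s hs) n).1.2.trans ?_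
        rw [hR₁]
        gcongr
        exact growth_mono K (by exact_mod_cast (show n ≤ 1 by omega))
      have h3 := hd0 s hs n
      have h4 : gam K (p s) n / 4 * ψ s (n - 1) ≤ R₁ / 4 * ((2 + 1 / (m * S)) * ψ s n) := by
        have := (hψ0 s hs (n - 1)).le
        gcongr
      rw [hC₃, mul_assoc]
      linarith
  have hup : ∀ s ∈ Ioc t₁ (t₁ + 1), ∀ n,
      upRate K A N (p s) (n + 1) / 4 * ψ s (n + 1) ≤ C₄ * ψ s n := by
    intro s hs n
    have h1 := hsucc s hs n
    have h2 := (upRate_le K A N (p s) (n + 1)).trans (hrate (p s) (hp1 s hs) (n + 1)).2.2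
    have h3 := (hψ0 s hs (n + 1)).le
    calc upRate K A N (p s) (n + 1) / 4 * ψ s (n + 1)
        ≤ C₀ / 4 * (M * 2 ^ |θ| / m * ψ s n) := by gcongr
      _ = _ := by rw [hC₄]; ring
  obtain ⟨Bw, hBw⟩ := hw.bounded t
  obtain ⟨R, hR, hRb⟩ := exists_rate_bound_of_lt K hA N
  obtain ⟨e, he, hel⟩ := exists_lower_bound_smoothingFactor K θ ha0.le N
  have hΛ0 : 0 < Λ := by positivity
  have hexp : ∀ s ∈ Ioc t₁ t, 1 ≤ Real.exp (Λ * (s - t₁)) := fun s hs =>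
    Real.one_le_exp (mul_nonneg hΛ0.le (sub_nonneg.2 hs.1.le))
  have hnbexp : ∀ s n, neighbourPart (gam K (p s)) (upRate K A N (p s))
      (fun n => Real.exp (Λ * (s - t₁)) * ψ s n) n = Real.exp (Λ * (s - t₁)) *
        (gam K (p s) n / 4 * ψ s (n - 1) + upRate K A N (p s) (n + 1) / 4 * ψ s (n + 1)) := by
    intro s n
    simp only [neighbourPart]; ring
  have key : ∀ δ, 0 < δ → |w t n| ≤
      (2 ^ a / m * (K₀ + δ)) * (Real.exp (Λ * (t - t₁)) * ψ t n) := by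
    intro δ hδ
    refine comparison (N := N) (t₀ := t₁) (T := t) (C := R + C₃ + C₄) (δ := 1)
      (B := |Bw| / (m * e))
      (a := fun s => gam K (p s)) (b := fun s => upRate K A N (p s)) (w := w)
      (Φ := fun s n => Real.exp (Λ * (s - t₁)) * ψ s n)
      (Φ' := fun s n => Real.exp (Λ * (s - t₁)) * (Λ * ψ s n + d s n))
      (by positivity) one_pos (by positivity) (fun s _ n => (gam_pos _ _ _).le)
      (fun s _ n => upRate_nonneg _ _ _ _ _) (fun s _ => by simp [upRate])
      (fun s hs m hm => hw.hasDerivAt s hs.1 m hm) (fun s hs j hj => ?_)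
      (fun s hs j => mul_pos (Real.exp_pos _) (hψ0 s (hsub s hs) j)) (fun s hs j hj => ?_)
      (fun s hs j hj => ?_) (fun s hs j hj => ?_) (fun j hj => ?_) t ⟨ht.1, le_rfl⟩ n hn
    · have h1 := ((((hasDerivAt_id s).sub_const t₁).const_mul Λ).exp).mul (hd s (hsub s hs) j)
      refine h1.congr_deriv ?_
      simp only [id]; ring
    · have h1 := hdown s (hsub s hs) j
      have h2 := hup s (hsub s hs) j
      have h3 := mul_nonneg (upRate_nonneg K A N (p s) j) (hψ0 s (hsub s hs) j).le
      have h4 : gam K (p s) j / 4 * ψ s (j - 1) + upRate K A N (p s) (j + 1) / 4 * ψ s (j + 1) +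
          ψ s j ≤ Λ * ψ s j + d s j +
            (gam K (p s) (j + 1) + upRate K A N (p s) j) / 4 * ψ s j := by
        rw [hΛ]; linarith
      have h5 := mul_le_mul_of_nonneg_left h4 (Real.exp_pos (Λ * (s - t₁))).le
      rw [hnbexp]
      linarith
    -- Only finiteness of the ratio matters here, so the bound `R` on the rates may depend on `N`.
    · have h2 := hup s (hsub s hs) j
      have h0 := hψ0 s (hsub s hs) j
      obtain ⟨h3, h4, -⟩ := hRb (p s) (hp1 s (hsub s hs)) j hj.le
      have h1 : gam K (p s) j / 4 * ψ s (j - 1) ≤ (R + C₃) * ψ s j := by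
        rcases le_or_gt 1 j with h | h
        · rcases eq_or_lt_of_le h with rfl | h
          · have e1 := hpred s (hsub s hs) 1 le_rfl
            have e2 := (hrate (p s) (hp1 s (hsub s hs)) 1).1.2
            rw [Int.cast_one] at e2
            have e3 := (hψ0 s (hsub s hs) (1 - 1)).le
            have e4 : gam K (p s) 1 / 4 * ψ s (1 - 1) ≤ R₁ / 4 * ((2 + 1 / (m * S)) * ψ s 1) := by
              gcongr
            rw [add_mul, hC₃, mul_assoc]
            have := mul_pos hR h0
            linarith
          · have hn1 : ¬ j - 1 ≤ 0 := by omega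
            have hn2 : ¬ j ≤ 0 := by omega
            have e0 : 0 < C₃ := by positivity
            have e1 : gam K (p s) j * ψ s (j - 1) ≤ gam K (p s) (j + 1) * ψ s j := by
              have hτ : 0 < s - t₁ := sub_pos.2 hs.1
              rw [gam_mul_smoothingWeight_pred K θ κ B (p s) (s - t₁) h]
              simp only [hψ, smoothingWeight, if_neg hn2]
              rw [mul_div_cancel₀ _ (gam_pos K (p s) (j + 1)).ne']
              have := (hparam ((2 : ℝ) ^ (K.β * j) * (s - t₁)) (by positivity)).1
              gcongr
            have e2 := mul_le_mul_of_nonneg_right h4 h0.le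
            have e3 := mul_pos e0 h0
            have e4 := mul_pos hR h0
            linarith
        · have e1 := hpred s (hsub s hs) j h.le
          have e2 : gam K (p s) j ≤ R₁ := by
            refine (hrate (p s) (hp1 s (hsub s hs)) j).1.2.trans ?_
            rw [hR₁]
            gcongr
            exact growth_mono K (by exact_mod_cast h.le)
          have e3 := (hψ0 s (hsub s hs) (j - 1)).le
          have e4 : gam K (p s) j / 4 * ψ s (j - 1) ≤ R₁ / 4 * ((2 + 1 / (m * S)) * ψ s j) := by
            gcongr
          rw [add_mul, hC₃, mul_assoc]
          have := mul_pos hR h0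
          linarith
      have h5 := mul_le_mul_of_nonneg_left (add_le_add h1 h2) (Real.exp_pos (Λ * (s - t₁))).le
      rw [hnbexp]
      linarith
    · have h1 := hBw s ⟨hs.1.le, hs.2⟩ j hj
      have h2 := hel (s - t₁) (sub_nonneg.2 hs.1.le) (by linarith [hs.2, ht.2]) j hj
      have h3 := (hb s (hsub s hs) j).1
      have h4 : m * e * (2 : ℝ) ^ (-j) ≤ Real.exp (Λ * (s - t₁)) * ψ s j := by
        have e1 := hexp s hs
        have e2 := hψ0 s (hsub s hs) j
        have e3 := mul_le_mul_of_nonneg_left h2 hm0.le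
        rw [mul_assoc]
        exact (e3.trans h3).trans (le_mul_of_one_le_left e2.le e1)
      calc |w s j| ≤ |Bw| * (2 : ℝ) ^ (-j) :=
            h1.trans (mul_le_mul_of_nonneg_right (le_abs_self _) (by positivity))
        _ = |Bw| / (m * e) * (m * e * (2 : ℝ) ^ (-j)) := by field_simp
        _ ≤ _ := by gcongr
    · have hwt := wt_pos θ j
      refine eventually_abs_le_of_continuousOn (l := m * (wt θ j * 2 ^ (-a)))
        (hw.continuousOn j hj) (by positivity) ?_ ?_
      · have e1 : (2 : ℝ) ^ a * (2 : ℝ) ^ (-a) = 1 := by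
          rw [← Real.rpow_add (by norm_num)]; simp
        calc |w t₁ j| < (K₀ + δ) * wt θ j := by nlinarith [hinit j hj]
          _ = (K₀ + δ) * wt θ j * ((2 : ℝ) ^ a * (2 : ℝ) ^ (-a)) := by rw [e1, mul_one]
          _ = _ := by field_simp
      · filter_upwards [eventually_le_smoothingFactor K ha0.le t₁ j, Ioc_mem_nhdsGT ht.1]
          with s hs1 hs2
        have e1 := hexp s hs2
        have e2 := hψ0 s (hsub s hs2) j
        have e3 : m * (wt θ j * 2 ^ (-a)) ≤ ψ s j := by
          refine le_trans ?_ (hb s (hsub s hs2) j).1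
          gcongr
        exact e3.trans (le_mul_of_one_le_left e2.le e1)
  have hlim : Tendsto (fun δ : ℝ => (2 ^ a / m * (K₀ + δ)) * (Real.exp (Λ * (t - t₁)) * ψ t n))
      (𝓝[>] 0) (𝓝 ((2 ^ a / m * (K₀ + 0)) * (Real.exp (Λ * (t - t₁)) * ψ t n))) :=
    ((by fun_prop : Continuous fun δ : ℝ => (2 ^ a / m * (K₀ + δ)) *
      (Real.exp (Λ * (t - t₁)) * ψ t n)).tendsto 0).mono_left nhdsWithin_le_nhds
  have h1 := ge_of_tendsto hlim (eventually_nhdsWithin_of_forall key)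
  have h2 := (hb t ht n).2
  have h3 := hψ0 t ht n
  rw [add_zero] at h1
  calc |w t n| ≤ (2 ^ a / m * K₀) * (Real.exp (Λ * (t - t₁)) * ψ t n) := h1
    _ ≤ (2 ^ a / m * K₀) * (Real.exp Λ * (M * (wt θ n * smoothingFactor K a (t - t₁) n))) := by
        gcongr
        exact mul_le_of_le_one_right hΛ0.le (by linarith [ht.2])
    _ = _ := by ring

/-! ### The norms of `𝒴_θ` in terms of the weights -/

/-- The factor 2 arises because the norm is a sum of two suprema. -/
theorem seqNorm_le_of_abs_le {θ X : ℝ} {y : ℤ → ℝ} (hX : 0 ≤ X)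
    (h : ∀ n, |y n| ≤ X * wt θ n) : seqNorm θ y ≤ ENNReal.ofReal (2 * X) := by
  rw [two_mul, ENNReal.ofReal_add hX hX]
  refine add_le_add (iSup₂_le fun n hn => ENNReal.ofReal_le_ofReal ?_)
    (iSup₂_le fun n hn => ENNReal.ofReal_le_ofReal ?_)
  · have h1 := h n
    rw [wt, if_pos hn] at h1
    calc (2 : ℝ) ^ n * |y n| ≤ (2 : ℝ) ^ n * (X * (2 : ℝ) ^ (-n)) := by gcongr
      _ = X := by rw [zpow_neg]; field_simp
  · have h1 := h n
    rw [wt, if_neg (not_le.2 hn)] at h1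
    calc (2 : ℝ) ^ (θ * n) * |y n| ≤ (2 : ℝ) ^ (θ * n) * (X * (2 : ℝ) ^ (-(θ * n))) := by gcongr
      _ = X * (2 : ℝ) ^ (θ * n + -(θ * n)) := by rw [Real.rpow_add (by norm_num)]; ring
      _ = X := by simp

theorem abs_le_of_seqNorm_le {θ X : ℝ} {y : ℤ → ℝ} (hX : 0 ≤ X)
    (h : seqNorm θ y ≤ ENNReal.ofReal X) (n : ℤ) : |y n| ≤ X * wt θ n := by
  unfold wt
  split_ifs with hn
  · have h1 : ENNReal.ofReal ((2 : ℝ) ^ n * |y n|) ≤ ENNReal.ofReal X :=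
      ((le_iSup₂ (f := fun (n : ℤ) (_ : n ≤ 0) => ENNReal.ofReal ((2 : ℝ) ^ n * |y n|)) n hn).trans
        le_self_add).trans h
    rw [ENNReal.ofReal_le_ofReal_iff hX] at h1
    rw [zpow_neg, ← div_eq_mul_inv, le_div_iff₀ (by positivity)]
    linarith
  · have h1 : ENNReal.ofReal ((2 : ℝ) ^ (θ * n) * |y n|) ≤ ENNReal.ofReal X :=
      ((le_iSup₂ (f := fun (n : ℤ) (_ : 0 < n) => ENNReal.ofReal ((2 : ℝ) ^ (θ * n) * |y n|)) n
        (not_le.1 hn)).trans le_add_self).trans h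
    rw [ENNReal.ofReal_le_ofReal_iff hX] at h1
    rw [Real.rpow_neg (by norm_num), ← div_eq_mul_inv, le_div_iff₀ (by positivity)]
    linarith

theorem abs_le_of_mem_seqSpace {θ : ℝ} {y : ℤ → ℝ} (h : y ∈ seqSpace θ) (n : ℤ) :
    |y n| ≤ (seqNorm θ y).toReal * wt θ n :=
  abs_le_of_seqNorm_le ENNReal.toReal_nonneg (ENNReal.ofReal_toReal (ne_of_lt h)).ge n

theorem mem_seqSpace_of_abs_le {θ X : ℝ} {y : ℤ → ℝ} (h : ∀ n, |y n| ≤ X * wt θ n) :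
    y ∈ seqSpace θ :=
  (seqNorm_le_of_abs_le (abs_nonneg X) fun n => (h n).trans
    (mul_le_mul_of_nonneg_right (le_abs_self X) (wt_pos θ n).le)).trans_lt ENNReal.ofReal_lt_top

theorem sub_mem_seqSpace {θ : ℝ} {y z : ℤ → ℝ} (hy : y ∈ seqSpace θ) (hz : z ∈ seqSpace θ) :
    (fun n => y n - z n) ∈ seqSpace θ := by
  refine mem_seqSpace_of_abs_le (X := (seqNorm θ y).toReal + (seqNorm θ z).toReal) fun n => ?_
  rw [add_mul]
  exact (abs_sub _ _).trans
    (add_le_add (abs_le_of_mem_seqSpace hy n) (abs_le_of_mem_seqSpace hz n))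

/-- On `n ≤ N` the weights differ only at finitely many sites, so all are equivalent to `2^(-n)`,
with constants depending on `N`. This suffices for the qualitative arguments. -/
theorem exists_wt_le (θ : ℝ) (N : ℤ) : ∃ D : ℝ, 0 < D ∧ ∀ n ≤ N,
    wt θ n ≤ D * (2 : ℝ) ^ (-n) ∧ (2 : ℝ) ^ (-n) ≤ D * wt θ n := by
  have hmono : ∀ n ≤ N, 0 < n → ∀ x : ℝ, x ≤ |1 - θ| →
      (2 : ℝ) ^ (x * n) ≤ (2 : ℝ) ^ (|1 - θ| * |(N : ℝ)|) := by
    intro n hn hn0 x hx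
    have hn0 : (0 : ℝ) ≤ n := by exact_mod_cast hn0.le
    have hnN : (n : ℝ) ≤ |(N : ℝ)| := le_trans (by exact_mod_cast hn) (le_abs_self _)
    exact Real.rpow_le_rpow_of_exponent_le (by norm_num)
      (mul_le_mul hx hnN hn0 (abs_nonneg _))
  have hD1 : (1 : ℝ) ≤ (2 : ℝ) ^ (|1 - θ| * |(N : ℝ)|) :=
    Real.one_le_rpow (by norm_num) (by positivity)
  refine ⟨(2 : ℝ) ^ (|1 - θ| * |(N : ℝ)|), by positivity, fun n hn => ?_⟩
  unfold wt
  split_ifs with h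
  · have := le_mul_of_one_le_left (show (0 : ℝ) ≤ 2 ^ (-n) by positivity) hD1
    exact ⟨this, this⟩
  · have e0 : (2 : ℝ) ^ (-n) = (2 : ℝ) ^ (-(n : ℝ)) := by
      rw [← Real.rpow_intCast]; push_cast; rfl
    have e1 : (2 : ℝ) ^ (-(θ * n)) = (2 : ℝ) ^ ((1 - θ) * n) * (2 : ℝ) ^ (-n) := by
      rw [e0, ← Real.rpow_add (by norm_num)]; ring_nf
    have e2 : (2 : ℝ) ^ (-n) = (2 : ℝ) ^ (-(1 - θ) * n) * (2 : ℝ) ^ (-(θ * n)) := by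
      rw [e0, ← Real.rpow_add (by norm_num)]; ring_nf
    constructor
    · rw [e1]
      exact mul_le_mul_of_nonneg_right (hmono n hn (not_le.1 h) _ (le_abs_self _)) (by positivity)
    · conv_lhs => rw [e2]
      exact mul_le_mul_of_nonneg_right (hmono n hn (not_le.1 h) _ (neg_le_abs _)) (by positivity)

theorem IsAdmissibleShift.abs_deriv_le {K : Kernels} {θ₁ η₀ ν : ℝ} {p : ℝ → ℤ → ℝ}
    (h : IsAdmissibleShift K θ₁ η₀ ν p) (hη : 0 ≤ η₀) (hη1 : η₀ ≤ 1) (hν : 0 ≤ ν) {t : ℝ}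
    (ht : 0 < t) (n : ℤ) :
    |deriv (fun s => p s n) t| ≤ (1 + t ^ (-(θ₁ / K.β))) * wt (θ₁ - K.β) n := by
  have h0 : 0 ≤ 1 + t ^ (-(θ₁ / K.β)) := by positivity
  have h1 := abs_le_of_seqNorm_le (by positivity) (h.deriv_le t ht) n
  refine h1.trans (mul_le_mul_of_nonneg_right ?_ (wt_pos _ _).le)
  have h2 : Real.exp (-(ν / 2) * t) ≤ 1 := Real.exp_le_one_iff.2 (by
    have := mul_nonneg hν ht.le; linarith)
  calc η₀ * (1 + t ^ (-(θ₁ / K.β))) * Real.exp (-(ν / 2) * t)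
      ≤ 1 * (1 + t ^ (-(θ₁ / K.β))) * 1 := by gcongr
    _ = _ := by ring

/-! ### Differences of solutions of the truncated equation -/

theorem abs_opTrunc_le {K : Kernels} {A b R : ℝ} {N n : ℤ} {q y : ℤ → ℝ}
    (hgam : gam K q n ≤ R) (hup : upRate K A N q n ≤ R) (hy : ∀ m, |y m| ≤ b * (2 : ℝ) ^ (-m)) :
    |opTrunc K A N q y n| ≤ 2 * R * b * (2 : ℝ) ^ (-n) := by
  have h0 := hy n
  have h1 := hy (n + 1)
  have h2 := hy (n - 1)
  have e1 : (2 : ℝ) ^ (-(n + 1)) = 1 / 2 * (2 : ℝ) ^ (-n) := by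
    rw [show -(n + 1) = -1 + -n by ring, zpow_add₀ two_ne_zero]; norm_num
  have e2 : (2 : ℝ) ^ (-(n - 1)) = 2 * (2 : ℝ) ^ (-n) := by
    rw [show -(n - 1) = 1 + -n by ring, zpow_add₀ two_ne_zero, zpow_one]
  rw [e1] at h1
  rw [e2] at h2
  set z := b * (2 : ℝ) ^ (-n) with hz
  have hz0 : 0 ≤ z := (abs_nonneg _).trans h0
  have h3 : |upRate K A N q n * (y (n + 1) - y n)| ≤ R * (3 / 2 * z) := by
    rw [abs_mul, abs_of_nonneg (upRate_nonneg _ _ _ _ _)]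
    refine mul_le_mul hup ((abs_sub _ _).trans ?_) (abs_nonneg _)
      ((upRate_nonneg _ _ _ _ _).trans hup)
    linarith
  have h4 : |gam K q n * (y n - y (n - 1))| ≤ R * (3 * z) := by
    rw [abs_mul, abs_of_pos (gam_pos _ _ _)]
    refine mul_le_mul hgam ((abs_sub _ _).trans ?_) (abs_nonneg _)
      ((gam_pos _ _ _).le.trans hgam)
    linarith
  have h5 := abs_sub (upRate K A N q n * (y (n + 1) - y n)) (gam K q n * (y n - y (n - 1)))
  have hR : 0 ≤ R := (gam_pos _ _ _).le.trans hgam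
  have h6 := mul_nonneg hR hz0
  rw [opTrunc_eq, abs_div, abs_of_pos (show (0 : ℝ) < 4 by norm_num), div_le_iff₀ (by norm_num)]
  have : 2 * R * b * (2 : ℝ) ^ (-n) = 2 * (R * z) := by rw [hz]; ring
  rw [this]
  linarith

theorem opTrunc_sub (K : Kernels) (A : ℝ) (N : ℤ) (q y z : ℤ → ℝ) (n : ℤ) :
    opTrunc K A N q (fun m => y m - z m) n = opTrunc K A N q y n - opTrunc K A N q z n := by
  simp only [opTrunc]; ring

theorem opTrunc_congr (K : Kernels) (A : ℝ) {N n : ℤ} (q : ℤ → ℝ) {y z : ℤ → ℝ}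
    (h : ∀ m ≤ N, y m = z m) (hn : n ≤ N) : opTrunc K A N q y n = opTrunc K A N q z n := by
  rw [opTrunc_eq, opTrunc_eq, h n hn, h (n - 1) (by omega)]
  rcases lt_or_eq_of_le hn with h1 | h1
  · rw [h (n + 1) (by omega)]
  · simp [upRate, h1]

theorem IsTruncSolution.sub {K : Kernels} {A θ t₀ : ℝ} {N : ℤ} {p : ℝ → ℤ → ℝ} {y₀ z₀ : ℤ → ℝ}
    {y z : ℝ → ℤ → ℝ} (hy : IsTruncSolution K A N p θ t₀ y₀ y)
    (hz : IsTruncSolution K A N p θ t₀ z₀ z) :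
    IsTruncSolution K A N p θ t₀ (fun n => y₀ n - z₀ n) (fun t n => y t n - z t n) where
  mem t ht := sub_mem_seqSpace (hy.mem t ht) (hz.mem t ht)
  initial := by rw [hy.initial, hz.initial]
  continuousOn n := (hy.continuousOn n).sub (hz.continuousOn n)
  eq_zero t ht n hn := by rw [hy.eq_zero t ht n hn, hz.eq_zero t ht n hn, sub_zero]
  hasDerivAt t ht n hn := by
    rw [opTrunc_sub]
    exact (hy.hasDerivAt t ht n hn).sub (hz.hasDerivAt t ht n hn)

/-- After multiplication by `2^n` and restriction to `n ≤ N`, the operator is bounded on bounded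
sequences, so the Baire argument applies. -/
theorem IsTruncSolution.exists_bound {K : Kernels} {A θ t₀ : ℝ} {N : ℤ} {p : ℝ → ℤ → ℝ}
    {y₀ : ℤ → ℝ} {y : ℝ → ℤ → ℝ} (hA : 0 < A) (hp : ∀ t, 0 < t → ∀ n, |p t n| ≤ 1)
    (ht₀ : 0 ≤ t₀) (h : IsTruncSolution K A N p θ t₀ y₀ y) (T : ℝ) :
    ∃ B, ∀ t ∈ Icc t₀ T, ∀ n, |y t n| ≤ B * (2 : ℝ) ^ (-n) := by
  obtain ⟨R, hR, hRb⟩ := exists_rate_bound_of_lt K hA N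
  have hzz : ∀ n : ℤ, (2 : ℝ) ^ n * (2 : ℝ) ^ (-n) = 1 := fun n => by
    rw [← zpow_add₀ two_ne_zero]; simp
  have hconv : ∀ (x b : ℝ) (n : ℤ), |(2 : ℝ) ^ n * x| ≤ b → |x| ≤ b * (2 : ℝ) ^ (-n) := by
    intro x b n hx
    rw [abs_mul, abs_of_pos (show (0 : ℝ) < 2 ^ n by positivity)] at hx
    rw [zpow_neg, ← div_eq_mul_inv, le_div_iff₀ (by positivity)]
    linarith
  have hex := exists_bound_of_pointwise_bounded
    (u := fun (n : {n : ℤ // n ≤ N}) t => (2 : ℝ) ^ (n : ℤ) * y t n) (t₀ := t₀) (Λ := 2 * R)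
    (fun n => continuousOn_const.mul (h.continuousOn n)) (by positivity)
    (fun t ht n => ⟨_, (h.hasDerivAt t ht n n.2).const_mul _, fun b hb => ?_⟩)
    (fun t ht => ?_) T
  · obtain ⟨B, hB⟩ := hex
    refine ⟨|B|, fun t ht n => ?_⟩
    rcases le_or_gt n N with hn | hn
    · exact hconv _ _ _ ((hB t ht ⟨n, hn⟩).trans (le_abs_self B))
    · rw [h.eq_zero t ht.1 n hn, abs_zero]; positivity
  · obtain ⟨h1, -, h2⟩ := hRb (p t) (hp t (ht₀.trans_lt ht)) n n.2
    have hb0 : 0 ≤ b := (abs_nonneg _).trans (hb n)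
    have h3 := abs_opTrunc_le (A := A) (N := N) (y := y t) (b := b) h1 (h2 n) (fun m => by
      rcases le_or_gt m N with hm | hm
      · exact hconv _ _ _ (hb ⟨m, hm⟩)
      · rw [h.eq_zero t ht.le m hm, abs_zero]; positivity)
    rw [abs_mul, abs_of_pos (show (0 : ℝ) < 2 ^ (n : ℤ) by positivity)]
    calc (2 : ℝ) ^ (n : ℤ) * |opTrunc K A N (p t) (y t) n|
        ≤ (2 : ℝ) ^ (n : ℤ) * (2 * R * b * (2 : ℝ) ^ (-(n : ℤ))) := by gcongr
      _ = 2 * R * b * ((2 : ℝ) ^ (n : ℤ) * (2 : ℝ) ^ (-(n : ℤ))) := by ring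
      _ = 2 * R * b := by rw [hzz, mul_one]
  · obtain ⟨D, hD, hDb⟩ := exists_wt_le θ N
    refine ⟨(seqNorm θ (y t)).toReal * D, fun n => ?_⟩
    have h1 := abs_le_of_mem_seqSpace (h.mem t ht) n
    rw [abs_mul, abs_of_pos (show (0 : ℝ) < 2 ^ (n : ℤ) by positivity)]
    calc (2 : ℝ) ^ (n : ℤ) * |y t n|
        ≤ (2 : ℝ) ^ (n : ℤ) * ((seqNorm θ (y t)).toReal * (D * (2 : ℝ) ^ (-(n : ℤ)))) := by
          have := (hDb n n.2).1
          have := ENNReal.toReal_nonneg (a := seqNorm θ (y t))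
          refine mul_le_mul_of_nonneg_left (h1.trans ?_) (by positivity)
          gcongr
      _ = (seqNorm θ (y t)).toReal * D * ((2 : ℝ) ^ (n : ℤ) * (2 : ℝ) ^ (-(n : ℤ))) := by ring
      _ = _ := by rw [hzz, mul_one]

theorem IsTruncSolution.isDiffSolution {K : Kernels} {A θ t₀ : ℝ} {N : ℤ} {p : ℝ → ℤ → ℝ}
    {y₀ : ℤ → ℝ} {y : ℝ → ℤ → ℝ} (hA : 0 < A) (hp : ∀ t, 0 < t → ∀ n, |p t n| ≤ 1)
    (ht₀ : 0 ≤ t₀) (h : IsTruncSolution K A N p θ t₀ y₀ y) :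
    IsDiffSolution K A N p t₀ fun t => dPlus (y t) where
  bounded T := by
    obtain ⟨B, hB⟩ := h.exists_bound hA hp ht₀ T
    refine ⟨2 * B, fun t ht n _ => ?_⟩
    have h1 := hB t ht n
    have h2 := hB t ht (n + 1)
    have e1 : (2 : ℝ) ^ (-(n + 1)) = 1 / 2 * (2 : ℝ) ^ (-n) := by
      rw [show -(n + 1) = -1 + -n by ring, zpow_add₀ two_ne_zero]; norm_num
    rw [e1] at h2
    have h3 := abs_sub (y t (n + 1)) (y t n)
    have h4 := (abs_nonneg _).trans h1
    rw [dPlus]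
    linarith
  continuousOn n _ := (h.continuousOn (n + 1)).sub (h.continuousOn n)
  hasDerivAt t ht n hn := by
    rw [← dPlus_opTrunc]
    exact (h.hasDerivAt t ht (n + 1) (by omega)).sub (h.hasDerivAt t ht n hn.le)

theorem abs_dPlus_le {θ X : ℝ} {y : ℤ → ℝ} (h : ∀ n, |y n| ≤ X * wt θ n) (n : ℤ) :
    |dPlus y n| ≤ (1 + 2 ^ |θ|) * X * wt θ n := by
  have h1 := h n
  have h2 := h (n + 1)
  have h3 := wt_succ_le θ n
  have hX : 0 ≤ X := by
    by_contra! hneg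
    have := mul_neg_of_neg_of_pos hneg (wt_pos θ n)
    linarith [abs_nonneg (y n)]
  have h4 := mul_le_mul_of_nonneg_left h3 hX
  have h5 := abs_sub (y (n + 1)) (y n)
  rw [dPlus]
  linarith

/-- For `θ > 0` the weight decays geometrically with ratio at most `r < 1`, so the telescoping sum
from `n` to `N` is dominated by its first term, with constant `1/(1-r)` independent of `N`. -/
theorem abs_sub_le_of_abs_dPlus_le {θ : ℝ} (hθ : 0 < θ) : ∃ C : ℝ, 0 < C ∧
    ∀ (N : ℤ) (y : ℤ → ℝ) (Z : ℝ), 0 ≤ Z → (∀ n < N, |dPlus y n| ≤ Z * wt θ n) →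
      ∀ n ≤ N, |y n - y N| ≤ C * Z * wt θ n := by
  set r := max (1 / 2) ((2 : ℝ) ^ (-θ)) with hr
  have hr1 : r < 1 := max_lt (by norm_num) (Real.rpow_lt_one_of_one_lt_of_neg (by norm_num)
    (by linarith))
  have hr0 : 0 < 1 - r := by linarith
  have hwt : ∀ n, wt θ (n + 1) ≤ r * wt θ n := by
    intro n
    unfold wt
    split_ifs with h h' h'
    · have e1 : (2 : ℝ) ^ (-(n + 1)) = 1 / 2 * (2 : ℝ) ^ (-n) := by
        rw [show -(n + 1) = -1 + -n by ring, zpow_add₀ two_ne_zero]; norm_num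
      rw [e1]
      gcongr
      exact le_max_left _ _
    · omega
    · obtain rfl : n = 0 := by omega
      simp only [zero_add, Int.cast_one, mul_one, neg_zero, zpow_zero]
      exact le_max_right _ _
    · have e1 : (2 : ℝ) ^ (-(θ * ((n + 1 : ℤ) : ℝ))) = (2 : ℝ) ^ (-θ) * (2 : ℝ) ^ (-(θ * n)) := by
        rw [← Real.rpow_add (by norm_num)]; push_cast; ring_nf
      rw [e1]
      gcongr
      exact le_max_right _ _
  refine ⟨1 / (1 - r), by positivity, fun N y Z hZ hy n hn => ?_⟩
  obtain ⟨k, rfl⟩ : ∃ k : ℕ, n = N - k := ⟨(N - n).toNat, by omega⟩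
  clear hn
  induction k with
  | zero =>
    have := wt_pos θ N
    simp only [Nat.cast_zero, sub_zero, sub_self, abs_zero]
    positivity
  | succ k ih =>
    set m : ℤ := N - ((k + 1 : ℕ) : ℤ) with hm
    have hm1 : N - (k : ℤ) = m + 1 := by rw [hm]; push_cast; ring
    rw [hm1] at ih
    have h1 := hy m (by rw [hm]; push_cast; omega)
    have h2 := mul_le_mul_of_nonneg_left (hwt m) (show 0 ≤ 1 / (1 - r) * Z by positivity)
    have h3 : 1 / (1 - r) * Z * (r * wt θ m) + Z * wt θ m = 1 / (1 - r) * Z * wt θ m := by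
      field_simp; ring
    have h4 : |y m - y N| ≤ |y (m + 1) - y N| + |dPlus y m| := by
      have : y m - y N = (y (m + 1) - y N) - dPlus y m := by rw [dPlus]; ring
      rw [this]
      exact abs_sub _ _
    linarith

/-! ### Decay estimates -/

/-- The shifts are bounded by `η₀` and their time derivatives have the weighted bound that is
integrable at `t = 0`. -/
structure IsControlledShift (K : Kernels) (θ₁ η₀ : ℝ) (p : ℝ → ℤ → ℝ) : Prop where
  abs_le : ∀ t, 0 < t → ∀ n, |p t n| ≤ η₀
  deriv_le : ∀ t, 0 < t → ∀ n, DifferentiableAt ℝ (fun s => p s n) t ∧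
    |deriv (fun s => p s n) t| ≤ (1 + t ^ (-(θ₁ / K.β))) * wt (θ₁ - K.β) n

/-- Up to time 1, smoothing suffices. Later, smoothing over the first half unit reaches the weight
`β`, hence `β - 1`; the static barrier gives decay until `t - 1/2`; a last half unit of smoothing
restores the weight `β`. The constants `η₀` and `ν` come from the decay step alone and so precede
the choice of `θ`. -/
theorem exists_diff_decay (K : Kernels) {A : ℝ} (hA : 0 < A) {θ₁ : ℝ} (hθ₁ : 0 < θ₁)
    (hθ₁β : θ₁ < K.β) : ∃ η₀ ν : ℝ, 0 < η₀ ∧ η₀ < 1 ∧ 0 < ν ∧ ∀ θ, θ < K.β → ∃ C : ℝ, 0 < C ∧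
      ∀ (N : ℤ) (p : ℝ → ℤ → ℝ), IsControlledShift K θ₁ η₀ p →
      ∀ t₀, 0 ≤ t₀ → ∀ w : ℝ → ℤ → ℝ, IsDiffSolution K A N p t₀ w → ∀ K₀, 0 ≤ K₀ →
      (∀ n < N, |w t₀ n| ≤ K₀ * wt θ n) → ∀ θ', θ ≤ θ' → θ' ≤ K.β → θ' - θ < K.β →
      ∀ t, t₀ < t → ∀ n < N, |w t n| ≤
        C * K₀ * (t - t₀) ^ (-((θ' - θ) / K.β)) * Real.exp (-ν * (t - t₀)) * wt θ' n := by
  have hβ : 0 < K.β := by linarith [K.hβ.1]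
  obtain ⟨η₀, ν, C₂, hη₀, hη₀1, hν, hC₂, hlong⟩ := exists_exponential_decay K hA
  refine ⟨η₀, ν, hη₀, hη₀1, hν, fun θ hθ => ?_⟩
  obtain ⟨C₁, hC₁, hshort⟩ := exists_smoothing K hA hθ₁ hθ₁β hθ
  obtain ⟨C₃, hC₃, hshort'⟩ := exists_smoothing K hA hθ₁ hθ₁β (θ := K.β - 1) (by linarith)
  set h₁ : ℝ := (1 / 2 : ℝ) ^ (-((K.β - θ) / K.β)) with hh₁
  set h₂ : ℝ := (1 / 2 : ℝ) ^ (-((K.β - (K.β - 1)) / K.β)) with hh₂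
  have hh₁0 : 0 < h₁ := by positivity
  have hh₂0 : 0 < h₂ := by positivity
  set C₄ := C₃ * (C₂ * (C₁ * h₁) * Real.exp (2 * ν)) * h₂ / ν with hC₄
  refine ⟨max (C₁ * Real.exp ν) C₄, by positivity,
    fun N p hp t₀ ht₀ w hw K₀ hK₀ hinit θ' hθθ' hθ'β hθ'θ t ht n hn => ?_⟩
  have hp1 : ∀ t, 0 < t → ∀ n, |p t n| ≤ 1 := fun t ht n => (hp.abs_le t ht n).trans hη₀1.le
  have hsh := hshort N p hp1 hp.deriv_le
  have hsh' := hshort' N p hp1 hp.deriv_le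
  have hτ : 0 < t - t₀ := sub_pos.2 ht
  set ρ := (θ' - θ) / K.β with hρ
  have hρ0 : 0 ≤ ρ := div_nonneg (by linarith) hβ.le
  have hρ1 : ρ ≤ 1 := by rw [hρ, div_le_one hβ]; exact hθ'θ.le
  have hw' := wt_pos θ' n
  rcases le_or_gt (t - t₀) 1 with hτ1 | hτ1
  · have h1 := hsh t₀ ht₀ w hw K₀ hK₀ hinit t ⟨ht, by linarith⟩ n hn
    have h2 := wt_mul_smoothingFactor_le K hθθ' hθ'β hτ hτ1 n
    have h3 : 1 ≤ Real.exp ν * Real.exp (-ν * (t - t₀)) := by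
      rw [← Real.exp_add]
      exact Real.one_le_exp (by nlinarith)
    calc |w t n| ≤ C₁ * K₀ * ((t - t₀) ^ (-ρ) * wt θ' n) := h1.trans (by gcongr)
      _ = 1 * (C₁ * K₀ * ((t - t₀) ^ (-ρ) * wt θ' n)) := by ring
      _ ≤ (Real.exp ν * Real.exp (-ν * (t - t₀))) * (C₁ * K₀ * ((t - t₀) ^ (-ρ) * wt θ' n)) := by
        gcongr
      _ = C₁ * Real.exp ν * K₀ * (t - t₀) ^ (-ρ) * Real.exp (-ν * (t - t₀)) * wt θ' n := by ring
      _ ≤ _ := by gcongr; exact le_max_left _ _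
  · have hw2 := hw.restrict (t₂ := t₀ + 1 / 2) (by linarith)
    have hw3 := hw.restrict (t₂ := t - 1 / 2) (by linarith)
    have s1 : ∀ m < N, |w (t₀ + 1 / 2) m| ≤ C₁ * K₀ * h₁ * wt (K.β - 1) m := by
      intro m hm
      have e1 := hsh t₀ ht₀ w hw K₀ hK₀ hinit (t₀ + 1 / 2) ⟨by linarith, by linarith⟩ m hm
      rw [add_sub_cancel_left] at e1
      have e2 := wt_mul_smoothingFactor_le K hθ.le le_rfl (by norm_num : (0 : ℝ) < 1 / 2)
        (by norm_num) m
      have e3 : wt K.β m ≤ wt (K.β - 1) m := wt_anti (by linarith) m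
      calc |w (t₀ + 1 / 2) m| ≤ C₁ * K₀ * (h₁ * wt K.β m) := e1.trans (by gcongr)
        _ ≤ C₁ * K₀ * (h₁ * wt (K.β - 1) m) := by gcongr
        _ = _ := by ring
    have s2 := hlong N p hp.abs_le (t₀ + 1 / 2) (by linarith) w hw2 (C₁ * K₀ * h₁)
      (by positivity) s1 (t - 1 / 2) (by linarith)
    have s3 := hsh' (t - 1 / 2) (by linarith) w hw3 _ (by positivity) s2 t
      ⟨by linarith, by linarith⟩ n hn
    rw [show t - (t - 1 / 2) = 1 / 2 by ring] at s3
    have s4 := wt_mul_smoothingFactor_le K (θ := K.β - 1) (by linarith) le_rfl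
      (by norm_num : (0 : ℝ) < 1 / 2) (by norm_num) n
    have s5 : wt K.β n ≤ wt θ' n := wt_anti hθ'β n
    have s6 : Real.exp (-(2 * ν) * (t - 1 / 2 - (t₀ + 1 / 2))) =
        Real.exp (2 * ν) * (Real.exp (-ν * (t - t₀)) * Real.exp (-ν * (t - t₀))) := by
      rw [← Real.exp_add, ← Real.exp_add]; ring_nf
    -- The decay rate is `2ν`; one of the two factors `exp (-ν (t - t₀))` is spent on the algebraic
    -- factor, using `(t - t₀)⁻¹ ≤ (t - t₀)^(-ρ)` for `t - t₀ ≥ 1` and `ρ ≤ 1`.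
    have s7 : Real.exp (-ν * (t - t₀)) ≤ (t - t₀) ^ (-ρ) / ν := by
      have e1 := Real.add_one_le_exp (ν * (t - t₀))
      have e2 : Real.exp (-ν * (t - t₀)) * Real.exp (ν * (t - t₀)) = 1 := by
        rw [← Real.exp_add]; simp
      have e3 := Real.exp_pos (-ν * (t - t₀))
      have e4 : (t - t₀) ^ (-(1 : ℝ)) ≤ (t - t₀) ^ (-ρ) :=
        Real.rpow_le_rpow_of_exponent_le hτ1.le (by linarith)
      rw [le_div_iff₀ hν]
      refine le_trans ?_ e4
      rw [Real.rpow_neg_one, ← one_div, le_div_iff₀ hτ]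
      nlinarith
    rw [s6] at s3
    set x := Real.exp (-ν * (t - t₀)) with hx
    have hx0 : 0 < x := Real.exp_pos _
    have hwβ := wt_pos K.β n
    calc |w t n| ≤ C₃ * (C₂ * (C₁ * K₀ * h₁) * (Real.exp (2 * ν) * (x * x))) *
          (h₂ * wt K.β n) := s3.trans (by gcongr)
      _ ≤ C₃ * (C₂ * (C₁ * K₀ * h₁) * (Real.exp (2 * ν) * ((t - t₀) ^ (-ρ) / ν * x))) *
          (h₂ * wt θ' n) := by gcongr
      _ = C₄ * K₀ * (t - t₀) ^ (-ρ) * x * wt θ' n := by rw [hC₄]; ring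
      _ ≤ _ := by gcongr; exact le_max_right _ _

theorem IsAdmissibleShift.isControlledShift {K : Kernels} {θ₁ η₀ ν : ℝ} {p : ℝ → ℤ → ℝ}
    (h : IsAdmissibleShift K θ₁ η₀ ν p) (hη : 0 ≤ η₀) (hη1 : η₀ ≤ 1) (hν : 0 ≤ ν) :
    IsControlledShift K θ₁ η₀ p where
  abs_le := h.abs_le
  deriv_le t ht n := ⟨h.differentiable t ht n, h.abs_deriv_le hη hη1 hν ht n⟩

/-- At `N` the upward rate vanishes and only `-γ D⁺_{N-1} / 4` remains. The summand 2 in the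
constant covers `N = 0`, where the weight at `-1` is 2. -/
theorem exists_opTrunc_boundary_le (K : Kernels) {A : ℝ} (hA : 0 < A) (θ : ℝ) :
    ∃ C : ℝ, 0 < C ∧ ∀ (N : ℕ) (q y : ℤ → ℝ) (Z : ℝ), (∀ n, |q n| ≤ 1) → 0 ≤ Z →
      (∀ n < (N : ℤ), |dPlus y n| ≤ Z * wt θ n) →
      |opTrunc K A N q y N| ≤ C * (2 : ℝ) ^ ((K.β - θ) * N) * Z := by
  obtain ⟨c₀, C₀, hc₀, hC₀, hrate⟩ := exists_rate_bounds K hA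
  refine ⟨C₀ / 4 * (2 + 2 ^ |θ|), by positivity, fun N q y Z hq hZ hy => ?_⟩
  have h1 := hy (N - 1) (by omega)
  have h2 := (hrate q hq N).1.2
  rw [growth_of_nonneg K (by positivity)] at h2
  have h3 : wt θ ((N : ℤ) - 1) ≤ (2 + 2 ^ |θ|) * (2 : ℝ) ^ (-(θ * N)) := by
    have hp : (0 : ℝ) < 2 ^ |θ| := by positivity
    rcases Nat.eq_zero_or_pos N with rfl | hN
    · simp [wt]
      linarith
    · have e1 : (2 : ℝ) ^ (-(θ * ((N - 1 : ℤ) : ℝ))) ≤ 2 ^ |θ| * (2 : ℝ) ^ (-(θ * N)) := by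
        rw [← Real.rpow_add (by norm_num)]
        refine Real.rpow_le_rpow_of_exponent_le (by norm_num) ?_
        push_cast
        linarith [le_abs_self θ]
      have e2 : wt θ ((N : ℤ) - 1) = (2 : ℝ) ^ (-(θ * ((N - 1 : ℤ) : ℝ))) := by
        unfold wt
        split_ifs with h
        · obtain rfl : N = 1 := by omega
          simp
        · rfl
      rw [e2, add_mul]
      have : (0 : ℝ) < (2 : ℝ) ^ (-(θ * N)) := by positivity
      linarith
  have h4 : opTrunc K A N q y N = -(gam K q N * dPlus y (N - 1)) / 4 := by
    rw [opTrunc_eq, upRate, if_neg (lt_irrefl _), dPlus, sub_add_cancel]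
    ring
  have h5 : (2 : ℝ) ^ ((K.β - θ) * N) = (2 : ℝ) ^ (K.β * N) * (2 : ℝ) ^ (-(θ * N)) := by
    rw [← Real.rpow_add (by norm_num)]; ring_nf
  rw [h4, abs_div, abs_neg, abs_mul, abs_of_pos (gam_pos K q N),
    abs_of_pos (show (0 : ℝ) < 4 by norm_num), h5]
  have h6 := (gam_pos K q N).le
  rw [Int.cast_natCast] at h2
  calc gam K q N * |dPlus y (N - 1)| / 4
      ≤ (C₀ * (2 : ℝ) ^ (K.β * N)) * (Z * ((2 + 2 ^ |θ|) * (2 : ℝ) ^ (-(θ * N)))) / 4 := by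
        have := h1.trans (mul_le_mul_of_nonneg_left h3 hZ)
        gcongr
    _ = _ := by ring

/-! ### Existence and uniqueness -/

/-- In the unknowns `2^n y_n` the truncated system is Lipschitz in the supremum norm, with constant
`2R`. Sites above `N` are frozen, and the upward rate at `N` does not see them. -/
theorem exists_isTruncSolution (K : Kernels) {A : ℝ} (hA : 0 < A) {θ t₀ : ℝ} {N : ℤ}
    {p : ℝ → ℤ → ℝ} (hp : ∀ t, 0 < t → ∀ n, |p t n| ≤ 1)
    (hpc : ∀ t, 0 < t → ∀ n, DifferentiableAt ℝ (fun s => p s n) t) (ht₀ : 0 ≤ t₀)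
    {y₀ : ℤ → ℝ} (hy₀ : y₀ ∈ seqSpace θ) (hy₀N : ∀ n, N < n → y₀ n = 0) :
    ∃ y, IsTruncSolution K A N p θ t₀ y₀ y := by
  obtain ⟨R, hR, hRb⟩ := exists_rate_bound_of_lt K hA N
  obtain ⟨D, hD, hDb⟩ := exists_wt_le θ N
  have hzz : ∀ n : ℤ, (2 : ℝ) ^ n * (2 : ℝ) ^ (-n) = 1 := fun n => by
    rw [← zpow_add₀ two_ne_zero]; simp
  have habs : ∀ (n : ℤ) (x : ℝ), |(2 : ℝ) ^ n * x| = (2 : ℝ) ^ n * |x| := fun n x => by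
    rw [abs_mul, abs_of_pos (show (0 : ℝ) < 2 ^ n by positivity)]
  set F : ℤ → ℝ → (ℤ → ℝ) → ℝ := fun n t u => if n ≤ N then
    (2 : ℝ) ^ n * opTrunc K A N (p t) (fun m => (2 : ℝ) ^ (-m) * u m) n else 0 with hF
  have hX0 := ENNReal.toReal_nonneg (a := seqNorm θ y₀)
  obtain ⟨u, hu0, huc, hub, hud⟩ := exists_solution_of_bounded_rhs (F := F) (Λ := 2 * R) (t₀ := t₀)
    (u₀ := fun n => (2 : ℝ) ^ n * y₀ n) (b₀ := (seqNorm θ y₀).toReal * D) (by positivity)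
    (fun n t ht u v b hb => by
      have hb0 : 0 ≤ b := (abs_nonneg _).trans (hb 0)
      simp only [hF]
      split_ifs with hn
      · obtain ⟨h1, -, h2⟩ := hRb (p t) (hp t (ht₀.trans_lt ht)) n hn
        rw [← mul_sub, ← opTrunc_sub, habs]
        have h3 := abs_opTrunc_le (A := A) (N := N) (b := b)
          (y := fun m => (2 : ℝ) ^ (-m) * u m - (2 : ℝ) ^ (-m) * v m) h1 (h2 n) (fun m => by
            rw [← mul_sub, habs, mul_comm]
            gcongr
            exact hb m)
        calc (2 : ℝ) ^ n * |opTrunc K A N (p t)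
              (fun m => (2 : ℝ) ^ (-m) * u m - (2 : ℝ) ^ (-m) * v m) n|
            ≤ (2 : ℝ) ^ n * (2 * R * b * (2 : ℝ) ^ (-n)) := by gcongr
          _ = 2 * R * b * ((2 : ℝ) ^ n * (2 : ℝ) ^ (-n)) := by ring
          _ = _ := by rw [hzz, mul_one]
      · rw [sub_self, abs_zero]; positivity)
    (fun n t => by simp [hF, opTrunc])
    (fun n u hu => by
      have hpos : ∀ t ∈ Ioi t₀, 0 < t := fun t ht => ht₀.trans_lt ht
      have hpc' : ∀ n, ContinuousOn (fun t => p t n) (Ioi t₀) := fun n t ht =>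
        (hpc t (hpos t ht) n).continuousAt.continuousWithinAt
      have hg := continuous_gam (K := K) hpc'
      have hj := continuous_jumpRatio (K := K) (A := A) hpc' (fun t ht => hp t (hpos t ht))
      have huc : ∀ m : ℤ, ContinuousOn (fun t => (2 : ℝ) ^ (-m) * u m t) (Ioi t₀) := fun m =>
        (continuous_const.mul (hu m)).continuousOn
      have hup : ContinuousOn (fun t => upRate K A N (p t) n) (Ioi t₀) := by
        unfold upRate
        split_ifs
        · exact (hj n).mul (hg (n + 1))
        · exact continuousOn_const
      simp only [hF]
      split_ifs
      · simp only [opTrunc_eq]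
        exact continuousOn_const.mul (((hup.mul ((huc _).sub (huc _))).sub
          ((hg n).mul ((huc _).sub (huc _)))).div_const 4)
      · exact continuousOn_const)
    (fun n => by
      rw [habs]
      rcases le_or_gt n N with hn | hn
      · calc (2 : ℝ) ^ n * |y₀ n|
            ≤ (2 : ℝ) ^ n * ((seqNorm θ y₀).toReal * (D * (2 : ℝ) ^ (-n))) := by
              have h1 := abs_le_of_mem_seqSpace hy₀ n
              have h2 := (hDb n hn).1
              refine mul_le_mul_of_nonneg_left (h1.trans ?_) (by positivity)
              gcongr
          _ = (seqNorm θ y₀).toReal * D * ((2 : ℝ) ^ n * (2 : ℝ) ^ (-n)) := by ring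
          _ ≤ _ := by rw [hzz, mul_one]
      · rw [hy₀N n hn, abs_zero, mul_zero]; positivity)
  refine ⟨fun t n => if n ≤ N then (2 : ℝ) ^ (-n) * u n t else 0, fun t ht => ?_, ?_, fun n => ?_,
    fun t _ n hn => if_neg (not_le.2 hn), fun t ht n hn => ?_⟩
  · obtain ⟨b, hb⟩ := hub t ht
    have hb0 : 0 ≤ b := (abs_nonneg _).trans (hb 0)
    refine mem_seqSpace_of_abs_le (X := D * b) fun n => ?_
    have := wt_pos θ n
    split_ifs with hn
    · rw [habs]
      calc (2 : ℝ) ^ (-n) * |u n t| ≤ (D * wt θ n) * b := by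
            gcongr
            · exact (hDb n hn).2
            · exact hb n
        _ = _ := by ring
    · rw [abs_zero]; positivity
  · funext n
    split_ifs with hn
    · rw [hu0, ← mul_assoc, mul_comm ((2 : ℝ) ^ (-n)), hzz, one_mul]
    · exact (hy₀N n (not_le.1 hn)).symm
  · split_ifs
    · exact (continuous_const.mul (huc n)).continuousOn
    · exact continuousOn_const
  · have h1 := (hud t ht n).const_mul ((2 : ℝ) ^ (-n))
    simp only [if_pos hn]
    refine h1.congr_deriv ?_
    simp only [hF, if_pos hn]
    rw [← mul_assoc, mul_comm ((2 : ℝ) ^ (-n)), hzz, one_mul]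
    exact opTrunc_congr K A _ (fun m hm => (if_pos hm).symm) hn

/-- Vanishing differences make the boundary flux zero, so the value at `N` keeps its initial value
`0`; telescoping from `N` carries this to the other sites. -/
theorem IsTruncSolution.eq_zero_of_dPlus_eq_zero {K : Kernels} {A θ t₀ : ℝ} {N : ℤ}
    {p : ℝ → ℤ → ℝ} {d : ℝ → ℤ → ℝ} (h : IsTruncSolution K A N p θ t₀ (fun _ => 0) d)
    (hd : ∀ t, t₀ < t → ∀ n < N, dPlus (d t) n = 0) {t : ℝ} (ht : t₀ ≤ t) (n : ℤ) :
    d t n = 0 := by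
  rcases eq_or_lt_of_le ht with rfl | ht
  · rw [h.initial]
  rcases lt_or_ge N n with hn | hn
  · exact h.eq_zero t ht.le n hn
  have hop : ∀ s, t₀ < s → opTrunc K A N (p s) (d s) N = 0 := by
    intro s hs
    have := hd s hs (N - 1) (by omega)
    rw [dPlus, sub_add_cancel] at this
    rw [opTrunc_eq, upRate, if_neg (lt_irrefl _), this]
    ring
  have hN : d t N = 0 := by
    obtain ⟨c, hc, hceq⟩ := exists_hasDerivAt_eq_slope (fun s => d s N)
      (fun s => opTrunc K A N (p s) (d s) N) ht
      ((h.continuousOn N).mono Icc_subset_Ici_self)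
      (fun s hs => h.hasDerivAt s hs.1 N le_rfl)
    rw [hop c hc.1, eq_comm, div_eq_zero_iff] at hceq
    rcases hceq with h1 | h1
    · rwa [h.initial, sub_zero] at h1
    · linarith
  obtain ⟨C, -, hC⟩ := abs_sub_le_of_abs_dPlus_le one_pos
  have h1 := hC N (d t) 0 le_rfl (fun m hm => by rw [hd t ht m hm]; simp) n hn
  rw [hN, mul_zero, zero_mul, sub_zero] at h1
  exact abs_eq_zero.1 (le_antisymm h1 (abs_nonneg _))

end CoagFrag

/-! ### Assembly of the theorem -/

theorem theorem4p3 (K : CoagFrag.Kernels) (θ₁ : ℝ) (hθ₁ : θ₁ ∈ Set.Ioo (K.β - 1) 1)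
    (M : ℝ) (hM : 0 < M) (A : ℝ) (hA : CoagFrag.IsMassParameter K M A) :
    ∃ η₀ ν : ℝ, 0 < η₀ ∧ η₀ < 1 ∧ 0 < ν ∧
      ∀ θ : ℝ, -1 < θ → θ < K.β →
        -- existence and uniqueness in `𝒴_θ`
        (∀ (N : ℕ) (p : ℝ → ℤ → ℝ), CoagFrag.IsAdmissibleShift K θ₁ η₀ ν p →
          ∀ y₀ ∈ CoagFrag.seqSpace θ, (∀ n : ℤ, (N : ℤ) < n → y₀ n = 0) →
          ∀ t₀ : ℝ, 0 ≤ t₀ →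
            ∃ y : ℝ → ℤ → ℝ, CoagFrag.IsTruncSolution K A N p θ t₀ y₀ y ∧
              ∀ z : ℝ → ℤ → ℝ, CoagFrag.IsTruncSolution K A N p θ t₀ y₀ z →
                ∀ t, t₀ ≤ t → z t = y t) ∧
        -- decay estimates, with constants independent of `N`, `p`, `y₀`, `t₀`, `t`
        ∀ θ' : ℝ, θ ≤ θ' → θ' ≤ K.β → θ' - θ < K.β →
          ∃ C₁ C₂ : ℝ, ∀ (N : ℕ) (p : ℝ → ℤ → ℝ), CoagFrag.IsAdmissibleShift K θ₁ η₀ ν p →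
            ∀ y₀ ∈ CoagFrag.seqSpace θ, (∀ n : ℤ, (N : ℤ) < n → y₀ n = 0) →
            ∀ t₀ : ℝ, 0 ≤ t₀ →
            ∀ y : ℝ → ℤ → ℝ, CoagFrag.IsTruncSolution K A N p θ t₀ y₀ y →
            ∀ t : ℝ, t₀ < t →
              CoagFrag.seqNorm θ' (CoagFrag.cutoff ((N : ℤ) - 1) (CoagFrag.dPlus (y t))) ≤
                ENNReal.ofReal (C₁ * (CoagFrag.seqNorm θ y₀).toReal *
                  (t - t₀) ^ (-((θ' - θ) / K.β)) * Real.exp (-ν * (t - t₀))) ∧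
              (0 < θ' →
                CoagFrag.seqNorm θ' (CoagFrag.cutoff N (fun n => y t n - y t N)) ≤
                  ENNReal.ofReal (C₂ * (CoagFrag.seqNorm θ y₀).toReal *
                    (t - t₀) ^ (-((θ' - θ) / K.β)) * Real.exp (-ν * (t - t₀)))) ∧
              (0 < θ' →
                |CoagFrag.opTrunc K A N (p t) (y t) N| ≤
                  C₂ * (2 : ℝ) ^ ((K.β - θ') * N) * (CoagFrag.seqNorm θ y₀).toReal *
                    (t - t₀) ^ (-((θ' - θ) / K.β)) * Real.exp (-ν * (t - t₀))) := by
  have hA0 := hA.1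
  have hβ1 := K.hβ.1
  have hβ2 := K.hβ.2
  obtain ⟨η₀, ν, hη₀, hη₀1, hν, hdecay⟩ := CoagFrag.exists_diff_decay K hA0 (θ₁ := θ₁)
    (by linarith [hθ₁.1]) (by linarith [hθ₁.2])
  refine ⟨η₀, ν, hη₀, hη₀1, hν, fun θ hθ hθβ => ?_⟩
  obtain ⟨C, hC, hdec⟩ := hdecay θ hθβ
  have hdiff : ∀ (N : ℕ) (p : ℝ → ℤ → ℝ), CoagFrag.IsAdmissibleShift K θ₁ η₀ ν p →
      ∀ y₀ ∈ CoagFrag.seqSpace θ, ∀ t₀ : ℝ, 0 ≤ t₀ →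
      ∀ y : ℝ → ℤ → ℝ, CoagFrag.IsTruncSolution K A N p θ t₀ y₀ y →
      ∀ θ', θ ≤ θ' → θ' ≤ K.β → θ' - θ < K.β → ∀ t : ℝ, t₀ < t → ∀ n < (N : ℤ),
      |CoagFrag.dPlus (y t) n| ≤ C * ((1 + 2 ^ |θ|) * (CoagFrag.seqNorm θ y₀).toReal) *
        (t - t₀) ^ (-((θ' - θ) / K.β)) * Real.exp (-ν * (t - t₀)) * CoagFrag.wt θ' n := by
    intro N p hp y₀ hy₀ t₀ ht₀ y hy θ' h1 h2 h3 t ht n hn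
    have hc := hp.isControlledShift hη₀.le hη₀1.le hν.le
    refine hdec N p hc t₀ ht₀ (fun t => CoagFrag.dPlus (y t))
      (hy.isDiffSolution hA0 (fun t ht n => (hc.abs_le t ht n).trans hη₀1.le) ht₀) _
      (by positivity) (fun m _ => ?_) θ' h1 h2 h3 t ht n hn
    rw [hy.initial]
    exact CoagFrag.abs_dPlus_le (CoagFrag.abs_le_of_mem_seqSpace hy₀) m
  refine ⟨fun N p hp y₀ hy₀ hy₀N t₀ ht₀ => ?_, fun θ' hθθ' hθ'β hθ'θ => ?_⟩
  · have hc := hp.isControlledShift hη₀.le hη₀1.le hν.le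
    obtain ⟨y, hy⟩ := CoagFrag.exists_isTruncSolution K hA0 (N := N) (p := p)
      (fun t ht n => (hc.abs_le t ht n).trans hη₀1.le) hp.differentiable ht₀ hy₀ hy₀N
    refine ⟨y, hy, fun z hz t ht => ?_⟩
    have hd := hz.sub hy
    simp only [sub_self] at hd
    have hzero : (CoagFrag.seqNorm θ fun _ : ℤ => 0).toReal = 0 := by
      simp [CoagFrag.seqNorm]
    funext n
    refine sub_eq_zero.1 (hd.eq_zero_of_dPlus_eq_zero (fun s hs m hm => ?_) ht n)
    -- Uniqueness: the estimate with `θ' = θ` and zero initial norm forces the differences of `z -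
    -- y` to vanish.
    have h1 := hdiff N p hp _ (CoagFrag.mem_seqSpace_of_abs_le (X := 0) (by simp)) t₀ ht₀ _ hd
      θ le_rfl hθβ.le (by linarith) s hs m hm
    rw [hzero, mul_zero, mul_zero, zero_mul, zero_mul, zero_mul] at h1
    exact abs_eq_zero.1 (le_antisymm h1 (abs_nonneg _))
  · set C' := C * (1 + 2 ^ |θ|) with hC'
    have hC'0 : 0 < C' := by positivity
    obtain ⟨C₂, hC₂, hbd⟩ := CoagFrag.exists_opTrunc_boundary_le K hA0 θ'
    -- Telescoping is available only for `θ' > 0`; a dummy constant in the other case lets `C₂` be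
    -- fixed beforehand.
    have hsum : ∃ C₃ : ℝ, 0 < C₃ ∧ (0 < θ' → ∀ (N : ℤ) (y : ℤ → ℝ) (Z : ℝ), 0 ≤ Z →
        (∀ n < N, |CoagFrag.dPlus y n| ≤ Z * CoagFrag.wt θ' n) →
        ∀ n ≤ N, |y n - y N| ≤ C₃ * Z * CoagFrag.wt θ' n) := by
      rcases lt_or_ge 0 θ' with h | h
      · obtain ⟨C₃, hC₃, h3⟩ := CoagFrag.abs_sub_le_of_abs_dPlus_le h
        exact ⟨C₃, hC₃, fun _ => h3⟩
      · exact ⟨1, one_pos, fun h' => absurd h' (not_lt.2 h)⟩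
    obtain ⟨C₃, hC₃, hsum⟩ := hsum
    refine ⟨2 * C', 2 * C₃ * C' + C₂ * C', fun N p hp y₀ hy₀ hy₀N t₀ ht₀ y hy t ht => ?_⟩
    set X := (CoagFrag.seqNorm θ y₀).toReal with hX
    have hX0 : 0 ≤ X := ENNReal.toReal_nonneg
    have hτ : 0 < t - t₀ := sub_pos.2 ht
    set E := (t - t₀) ^ (-((θ' - θ) / K.β)) with hE
    set G := Real.exp (-ν * (t - t₀)) with hG
    have hE0 : 0 < E := by positivity
    have hG0 : 0 < G := Real.exp_pos _
    have hw : ∀ n < (N : ℤ), |CoagFrag.dPlus (y t) n| ≤ C' * X * E * G * CoagFrag.wt θ' n := by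
      intro n hn
      have := hdiff N p hp y₀ hy₀ t₀ ht₀ y hy θ' hθθ' hθ'β hθ'θ t ht n hn
      rwa [← mul_assoc C] at this
    have hZ : 0 ≤ C' * X * E * G := by positivity
    refine ⟨?_, fun hθ'0 => ?_, fun _ => ?_⟩
    · refine (CoagFrag.seqNorm_le_of_abs_le hZ fun n => ?_).trans_eq (by ring_nf)
      unfold CoagFrag.cutoff
      split_ifs with hn
      · exact hw n (by omega)
      · have := CoagFrag.wt_pos θ' n
        rw [abs_zero]; positivity
    · refine (CoagFrag.seqNorm_le_of_abs_le (X := C₃ * (C' * X * E * G)) (by positivity)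
        fun n => ?_).trans (ENNReal.ofReal_le_ofReal ?_)
      · unfold CoagFrag.cutoff
        split_ifs with hn
        · exact hsum hθ'0 N (y t) _ hZ hw n hn
        · have := CoagFrag.wt_pos θ' n
          rw [abs_zero]; positivity
      · have : 0 ≤ C₂ * C' * X * E * G := by positivity
        linarith
    · have h1 := hbd N (p t) (y t) _
        (fun n => (hp.abs_le t (ht₀.trans_lt ht) n).trans hη₀1.le) hZ hw
      refine h1.trans ?_
      have : 0 ≤ 2 * C₃ * C' * (2 : ℝ) ^ ((K.β - θ') * N) * X * E * G := by positivity
      linarith
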